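/- Let $0<d<1$ and let $n\ge 7$ be an integer with $(2n-1)^d\ge 24$. For an integer $L>0$, let $R_L$ be the set of reduced words of length $L$ in the letters $s_1,\dots,s_n$ and their inverses, let $R$ be a $\lfloor(2n-1)^{dL}\rfloor$-tuple of elements of $R_L$ chosen uniformly at random, and let $G=\langle s_1,\dots,s_n\mid R\rangle$ be the random group at density $d$ and length $L$. Then, as $L\to\infty$, the probability of the following event tends to $1$: every action of $G$ by cubical automorphisms on a $\mathrm{CAT}(0)$ square complex $X$ fixes a point of $X$. Here a square complex is a cube complex of dimension at most $2$, and it is $\mathrm{CAT}(0)$ if it is nonempty, simply connected, and every vertex link is a flag complex. It need not be finite or locally finite, and the fixed point is a point of the geometric realization, not necessarily a vertex. -/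

import Mathlib

open Filter Topology

universe u v

/-- A cube complex of dimension at most two on the vertex set `V`. Edges are given by a simple
graph, and `IsSquare a b c d` says that the 4-cycle `a, b, c, d` (in this cyclic order) is the
boundary of a square. The last three conditions say that cubes are embedded and that two cubes
are disjoint or meet in a common face; the definition of a cubical complex asks for this, and it
holds automatically for every cube complex that is CAT(0). -/
structure SquareComplex (V : Type u) where
  graph : SimpleGraph V
  IsSquare : V → V → V → V → Prop
  rotate : ∀ {a b c d : V}, IsSquare a b c d → IsSquare b c d a
  reflect : ∀ {a b c d : V}, IsSquare a b c d → IsSquare a d c b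
  adj : ∀ {a b c d : V}, IsSquare a b c d → graph.Adj a b
  diag_ne : ∀ {a b c d : V}, IsSquare a b c d → a ≠ c
  diag_not_adj : ∀ {a b c d : V}, IsSquare a b c d → ¬ graph.Adj a c
  diag_unique : ∀ {a b c d b' d' : V}, IsSquare a b c d → IsSquare a b' c d' →
    (b = b' ∧ d = d') ∨ (b = d' ∧ d = b')

namespace SquareComplex

variable {V : Type u} (X : SquareComplex V)

/-- Homotopy of edge paths relative to their endpoints: the smallest congruence under which
backtracks may be removed and two consecutive sides of a square may be replaced by the other
two. -/
inductive Homotopic : {u v : V} → X.graph.Walk u v → X.graph.Walk u v → Prop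
  | refl {u v : V} (p : X.graph.Walk u v) : Homotopic p p
  | symm {u v : V} {p q : X.graph.Walk u v} : Homotopic p q → Homotopic q p
  | trans {u v : V} {p q r : X.graph.Walk u v} :
      Homotopic p q → Homotopic q r → Homotopic p r
  | cons {u v w : V} (h : X.graph.Adj u v) {p q : X.graph.Walk v w} :
      Homotopic p q → Homotopic (SimpleGraph.Walk.cons h p) (SimpleGraph.Walk.cons h q)
  | backtrack {u v w : V} (h : X.graph.Adj u v) (p : X.graph.Walk u w) :
      Homotopic (SimpleGraph.Walk.cons h (SimpleGraph.Walk.cons h.symm p)) p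
  | square {a b c d w : V} (hab : X.graph.Adj a b) (hbc : X.graph.Adj b c)
      (had : X.graph.Adj a d) (hdc : X.graph.Adj d c) (hsq : X.IsSquare a b c d)
      (p : X.graph.Walk c w) :
      Homotopic (SimpleGraph.Walk.cons hab (SimpleGraph.Walk.cons hbc p))
        (SimpleGraph.Walk.cons had (SimpleGraph.Walk.cons hdc p))

/-- The complex is connected (in particular nonempty) and has trivial fundamental group: every
closed edge path is null-homotopic. -/
def IsSimplyConnected : Prop :=
  X.graph.Connected ∧
    ∀ (v : V) (p : X.graph.Walk v v), X.Homotopic p SimpleGraph.Walk.nil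

/-- The link of the vertex `v`: its vertices are the edges at `v` (that is, the neighbours of
`v`), and its edges are the corners of squares at `v`. By `diag_unique`, two edges at `v` span at
most one such corner, so the link is a simple graph. -/
def link (v : V) : SimpleGraph {b : V // X.graph.Adj v b} where
  Adj b d := ∃ c, X.IsSquare v b c d
  symm := ⟨fun _ _ ⟨c, h⟩ => ⟨c, X.reflect h⟩⟩
  loopless := ⟨fun _ ⟨_, h⟩ => X.diag_ne (X.rotate h) rfl⟩

/-- Gromov's link condition: all links are flag complexes. As there are no 3-cubes, links have
dimension at most one, so that being flag means having no three pairwise adjacent vertices. -/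
def IsNonpositivelyCurved : Prop :=
  ∀ v : V, (X.link v).CliqueFree 3

/-- A CAT(0) square complex is a simply connected, nonpositively curved square complex. -/
def IsCAT0 : Prop :=
  X.IsSimplyConnected ∧ X.IsNonpositivelyCurved

/-- The group of cubical automorphisms. -/
def aut : Subgroup (Equiv.Perm V) where
  carrier := {σ | (∀ a b, X.graph.Adj (σ a) (σ b) ↔ X.graph.Adj a b) ∧
    ∀ a b c d, X.IsSquare (σ a) (σ b) (σ c) (σ d) ↔ X.IsSquare a b c d}
  mul_mem' := fun {σ τ} hσ hτ =>
    ⟨fun a b => (hσ.1 (τ a) (τ b)).trans (hτ.1 a b),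
      fun a b c d => (hσ.2 (τ a) (τ b) (τ c) (τ d)).trans (hτ.2 a b c d)⟩
  one_mem' := ⟨fun _ _ => Iff.rfl, fun _ _ _ _ => Iff.rfl⟩
  inv_mem' := fun {σ} hσ =>
    ⟨fun a b => by simpa using (hσ.1 (σ⁻¹ a) (σ⁻¹ b)).symm,
      fun a b c d => by simpa using (hσ.2 (σ⁻¹ a) (σ⁻¹ b) (σ⁻¹ c) (σ⁻¹ d)).symm⟩

/-- Points of the geometric realization, which is embedded in the space of functions on the
vertex set: a vertex `a` is the indicator function of `a`, an edge is the segment between its two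
ends, and the square `a, b, c, d` is the image of the unit square under the multilinear map that
sends the corners `(0,0), (1,0), (1,1), (0,1)` to `a, b, c, d`. -/
def IsPoint (w : V → ℝ) : Prop :=
  (∃ a, w a = 1 ∧ ∀ v, v ≠ a → w v = 0) ∨
  (∃ a b, X.graph.Adj a b ∧ ∃ t ∈ Set.Icc (0 : ℝ) 1,
    w a = 1 - t ∧ w b = t ∧ ∀ v, v ≠ a → v ≠ b → w v = 0) ∨
  (∃ a b c d, X.IsSquare a b c d ∧ ∃ s ∈ Set.Icc (0 : ℝ) 1, ∃ t ∈ Set.Icc (0 : ℝ) 1,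
    w a = (1 - s) * (1 - t) ∧ w b = s * (1 - t) ∧ w c = s * t ∧ w d = (1 - s) * t ∧
    ∀ v, v ≠ a → v ≠ b → v ≠ c → v ≠ d → w v = 0)

/-- The geometric realization. -/
def Realization : Type u := {w : V → ℝ // X.IsPoint w}

theorem IsPoint.comp_inv {X : SquareComplex V} {w : V → ℝ} (hw : X.IsPoint w) (σ : X.aut) :
    X.IsPoint (fun v => w ((σ : Equiv.Perm V)⁻¹ v)) := by
  obtain ⟨σ, hσ⟩ := σ
  have key : ∀ v a : V, v ≠ σ a → σ⁻¹ v ≠ a := by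
    rintro v a h rfl
    simp at h
  rcases hw with ⟨a, h1, h2⟩ | ⟨a, b, hab, t, ht, h1, h2, h3⟩ |
    ⟨a, b, c, d, hsq, s, hs, t, ht, h1, h2, h3, h4, h5⟩
  · exact Or.inl ⟨σ a, by simpa using h1, fun v hv => h2 _ (key v a hv)⟩
  · exact Or.inr (Or.inl ⟨σ a, σ b, (hσ.1 a b).2 hab, t, ht, by simpa using h1,
      by simpa using h2, fun v hva hvb => h3 _ (key v a hva) (key v b hvb)⟩)
  · exact Or.inr (Or.inr ⟨σ a, σ b, σ c, σ d, (hσ.2 a b c d).2 hsq, s, hs, t, ht,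
      by simpa using h1, by simpa using h2, by simpa using h3, by simpa using h4,
      fun v hva hvb hvc hvd =>
        h5 _ (key v a hva) (key v b hvb) (key v c hvc) (key v d hvd)⟩)

/-- Cubical automorphisms act on the geometric realization, affinely on each cube. -/
instance : MulAction X.aut X.Realization where
  smul σ p := ⟨fun v => p.1 ((σ : Equiv.Perm V)⁻¹ v), p.2.comp_inv σ⟩
  one_smul _ := rfl
  mul_smul _ _ _ := rfl

/-- An action `ρ` by cubical automorphisms has a global fixed point if it fixes a point of the
geometric realization (not necessarily a vertex). -/
def HasGlobalFixedPoint {G : Type v} [Group G] (ρ : G →* X.aut) : Prop :=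
  ∃ p : X.Realization, ∀ g : G, ρ g • p = p

end SquareComplex

/-- `G` does not act without global fixed point on a CAT(0) square complex. -/
def HasPropertyFC2 (G : Type v) [Group G] : Prop :=
  ∀ (V : Type u) (X : SquareComplex V), X.IsCAT0 →
    ∀ ρ : G →* X.aut, X.HasGlobalFixedPoint ρ

/-- Reduced words of length `L` in the letters `s₁, …, sₙ` and their inverses; the letter
`(i, true)` stands for `sᵢ` and `(i, false)` for its inverse. -/
abbrev ReducedWord (n L : ℕ) : Type :=
  {w : List.Vector (Fin n × Bool) L // FreeGroup.IsReduced w.toList}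

/-- The number of relators at density `d` and length `L`. -/
noncomputable def numRelators (n : ℕ) (d : ℝ) (L : ℕ) : ℕ :=
  ⌊(2 * (n : ℝ) - 1) ^ (d * (L : ℝ))⌋₊

/-- A tuple of relators at density `d` and length `L`. -/
abbrev Relators (n : ℕ) (d : ℝ) (L : ℕ) : Type :=
  Fin (numRelators n d L) → ReducedWord n L

/-- The group `⟨s₁, …, sₙ | R⟩`. -/
abbrev relatorGroup {n : ℕ} {d : ℝ} {L : ℕ} (R : Relators n d L) : Type :=
  PresentedGroup (Set.range fun i => FreeGroup.mk (R i).1.toList)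

/-- The probability that a random group on `n` generators at density `d` and length `L`, whose
tuple of relators is uniformly distributed, has the property `P`. -/
noncomputable def randomGroupProb (n : ℕ) (d : ℝ) (P : (G : Type) → [Group G] → Prop)
    (L : ℕ) : ℝ :=
  (Nat.card {R : Relators n d L // P (relatorGroup R)} : ℝ) / (Nat.card (Relators n d L) : ℝ)

/-- A random group on `n` generators at density `d` has the property `P` with overwhelming
probability. -/
def HoldsWithOverwhelmingProbability (n : ℕ) (d : ℝ)
    (P : (G : Type) → [Group G] → Prop) : Prop :=
  Tendsto (randomGroupProb n d P) atTop (𝓝 1)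

/-!
The cubical subdivision of a CAT(0) square complex is graded by the dimension of cubes, every edge
has two complementary convex halfspaces, and automorphisms preserve the grading. Given an action
without fixed point, consider a vertex `v` at which the sum of the distances to its images under
all reduced words of some fixed length is minimal. Unless many of these words carry some halfspace
at `v` into another one, moving `v` to a neighbor decreases the sum or the grading is violated.
This yields a finite automaton whose states are halfspaces at `v` that do not contain `v`, in which
a fixed proportion of the words can be read at every state, and all runs of which have products that
move `v`.

Relators act trivially, so no conjugate of a relator is the product of a run. But if the words read
are long, passing to a fixed proportion of them costs less exponential growth than the density
makes up for: every automaton of this kind recognizes so many words of length `L` that a random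
tuple of relators avoids all of them only with probability exponentially small in `L`. The automata
in question are finitely many, independently of `L`, so the union bound applies.
-/

namespace SquareComplex

variable {V : Type u} (X : SquareComplex V)

/-- A single replacement of two consecutive sides of a square by the other two, in an edge path
given by the list of its vertices. -/
inductive Swap : List V → List V → Prop
  | top {x y z y' : V} (l : List V) (h : X.IsSquare x y z y') :
      Swap (x :: y :: z :: l) (x :: y' :: z :: l)
  | cons (a : V) {l l' : List V} (h : Swap l l') : Swap (a :: l) (a :: l')

/-- Equivalence of edge paths under replacements across squares, without removal of backtracks. -/
def SwapEq : List V → List V → Prop := Relation.ReflTransGen X.Swap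

/-- The edge path traverses some edge back and forth. -/
def Backtracks : List V → Prop
  | x :: y :: z :: l => x = z ∨ Backtracks (y :: z :: l)
  | _ => False

/-- Reduced edge paths: no equivalent edge path backtracks. -/
def Reduced (l : List V) : Prop := ∀ m, X.SwapEq l m → ¬ Backtracks m

variable {X}

theorem isSquare_ne {a b c d : V} (h : X.IsSquare a b c d) : b ≠ d :=
  X.diag_ne (X.rotate h)

theorem corner_unique {a b c c' d : V} (h : X.IsSquare a b c d) (h' : X.IsSquare a b c' d) :
    c = c' := by
  rcases X.diag_unique (X.rotate h) (X.rotate h') with h | h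
  · exact h.1
  · exact h.1.trans h.2

theorem Swap.symm {l l' : List V} (h : X.Swap l l') : X.Swap l' l := by
  induction h with
  | top l h => exact .top l (X.reflect h)
  | cons a _ ih => exact .cons a ih

namespace SwapEq

theorem refl (l : List V) : X.SwapEq l l := Relation.ReflTransGen.refl

theorem trans {l m r : List V} (h : X.SwapEq l m) (h' : X.SwapEq m r) : X.SwapEq l r :=
  Relation.ReflTransGen.trans h h'

theorem symm {l m : List V} (h : X.SwapEq l m) : X.SwapEq m l := by
  induction h with
  | refl => exact refl _
  | tail _ h ih => exact trans (Relation.ReflTransGen.single h.symm) ih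

theorem cons (a : V) {l m : List V} (h : X.SwapEq l m) : X.SwapEq (a :: l) (a :: m) := by
  induction h with
  | refl => exact refl _
  | tail _ h ih => exact trans ih (Relation.ReflTransGen.single (.cons a h))

theorem top {x y z y' : V} (l : List V) (h : X.IsSquare x y z y') :
    X.SwapEq (x :: y :: z :: l) (x :: y' :: z :: l) :=
  Relation.ReflTransGen.single (.top l h)

end SwapEq

theorem Swap.length_eq {l l' : List V} (h : X.Swap l l') : l.length = l'.length := by
  induction h with
  | top l _ => rfl
  | cons a _ ih => simp [ih]

theorem SwapEq.length_eq {l l' : List V} (h : X.SwapEq l l') : l.length = l'.length := by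
  induction h with
  | refl => rfl
  | tail _ h ih => exact ih.trans h.length_eq

theorem Swap.exists_cons {a : V} {l m : List V} (h : X.Swap (a :: l) m) : ∃ l', m = a :: l' := by
  cases h <;> exact ⟨_, rfl⟩

theorem SwapEq.exists_cons {a : V} {l m : List V} (h : X.SwapEq (a :: l) m) :
    ∃ l', m = a :: l' := by
  induction h with
  | refl => exact ⟨_, rfl⟩
  | tail _ h ih => obtain ⟨l', rfl⟩ := ih; exact h.exists_cons

theorem SwapEq.exists_cons_cons {a b : V} {l m : List V} (h : X.SwapEq (a :: b :: l) m) :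
    ∃ b' l', m = a :: b' :: l' := by
  obtain ⟨l', rfl⟩ := h.exists_cons
  have := h.length_eq
  cases l' with
  | nil => simp at this
  | cons b' l' => exact ⟨_, _, rfl⟩

theorem IsNonpositivelyCurved.not_three_squares (hX : X.IsNonpositivelyCurved)
    {v a b c p q r : V} (hab : X.IsSquare v a p b) (hbc : X.IsSquare v b q c)
    (hac : X.IsSquare v a r c) : False := by
  classical
  refine hX v {⟨a, X.adj hab⟩, ⟨b, X.adj hbc⟩, ⟨c, X.adj (X.reflect hac)⟩} ?_
  rw [SimpleGraph.is3Clique_triple_iff]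
  exact ⟨⟨_, hab⟩, ⟨_, hac⟩, ⟨_, hbc⟩⟩

/-- Relation between the edge paths `x :: y :: l` and `x :: y' :: l'` that is read off their first
edges: these coincide, or they span a square at `x` through which both paths can be pushed. -/
def FirstEdgeRel (X : SquareComplex V) (x y y' : V) (l l' : List V) : Prop :=
  (y = y' ∧ X.SwapEq (y :: l) (y' :: l')) ∨
    ∃ z r, X.IsSquare x y z y' ∧ X.SwapEq (y :: l) (y :: z :: r) ∧
      X.SwapEq (y' :: l') (y' :: z :: r)

theorem Swap.firstEdgeRel {x y y' : V} {l l' : List V} (h : X.Swap (x :: y :: l) (x :: y' :: l')) :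
    X.FirstEdgeRel x y y' l l' := by
  cases h with
  | top l hsq => exact Or.inr ⟨_, _, hsq, .refl _, .refl _⟩
  | cons _ htail =>
    obtain ⟨m, hm⟩ := htail.exists_cons
    obtain ⟨rfl, rfl⟩ := List.cons.inj hm
    exact Or.inl ⟨rfl, Relation.ReflTransGen.single htail⟩

theorem FirstEdgeRel.trans (hX : X.IsNonpositivelyCurved) {x y w y' : V} {l t l' : List V}
    (ih : ∀ z z' r r', r.length < l.length → X.SwapEq (w :: z :: r) (w :: z' :: r') →
      X.FirstEdgeRel w z z' r r')
    (h : X.FirstEdgeRel x y w l t) (h' : X.FirstEdgeRel x w y' t l') :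
    X.FirstEdgeRel x y y' l l' := by
  rcases h with ⟨rfl, hl⟩ | ⟨z, r, hsq, hl, ht⟩ <;>
    rcases h' with ⟨rfl, ht'⟩ | ⟨z', r', hsq', ht', hl'⟩
  · exact Or.inl ⟨rfl, hl.trans ht'⟩
  · exact Or.inr ⟨z', r', hsq', hl.trans ht', hl'⟩
  · exact Or.inr ⟨z, r, hsq, hl, ht'.symm.trans ht⟩
  have hlen : r.length < l.length := by
    have := hl.length_eq
    simp only [List.length_cons] at this
    omega
  rcases ih z z' r r' hlen (ht.symm.trans ht') with ⟨rfl, hr⟩ | ⟨q, -, hq, -, -⟩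
  · rcases X.diag_unique hsq (X.reflect hsq') with ⟨rfl, -⟩ | ⟨hyw, -⟩
    · exact Or.inl ⟨rfl, hl.trans ((hr.cons _).trans hl'.symm)⟩
    · exact absurd hyw (isSquare_ne hsq)
  · have hx : X.IsSquare w x y z := X.rotate (X.rotate (X.rotate hsq))
    exact (hX.not_three_squares hx hq (X.reflect (X.rotate hsq'))).elim

theorem SwapEq.firstEdgeRel (hX : X.IsNonpositivelyCurved) {x y y' : V} {l l' : List V}
    (h : X.SwapEq (x :: y :: l) (x :: y' :: l')) : X.FirstEdgeRel x y y' l l' := by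
  induction hn : l.length using Nat.strong_induction_on generalizing x y y' l l' with
  | _ n ih =>
  subst hn
  generalize hm : x :: y' :: l' = m at h
  induction h generalizing y' l' with
  | refl =>
    obtain ⟨-, rfl, rfl⟩ : x = x ∧ y' = y ∧ l' = l := by simpa using hm
    exact Or.inl ⟨rfl, .refl _⟩
  | tail hfirst hlast ih_path =>
    obtain ⟨w, t, rfl⟩ := SwapEq.exists_cons_cons hfirst
    subst hm
    exact .trans hX (fun z z' r r' hr hzz' => ih _ hr hzz' rfl) (ih_path rfl) hlast.firstEdgeRel

theorem SwapEq.cancel (hX : X.IsNonpositivelyCurved) {x y : V} {l l' : List V}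
    (h : X.SwapEq (x :: y :: l) (x :: y :: l')) : X.SwapEq (y :: l) (y :: l') := by
  rcases h.firstEdgeRel hX with ⟨-, htail⟩ | ⟨z, r, hsq, -, -⟩
  · exact htail
  · exact absurd rfl (isSquare_ne hsq)

theorem SwapEq.exists_square (hX : X.IsNonpositivelyCurved) {x y y' : V} {l l' : List V}
    (h : X.SwapEq (x :: y :: l) (x :: y' :: l')) (hne : y ≠ y') :
    ∃ z r, X.IsSquare x y z y' ∧ X.SwapEq (y :: l) (y :: z :: r) ∧
        X.SwapEq (y' :: l') (y' :: z :: r) :=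
  (h.firstEdgeRel hX).resolve_left fun hyy' => hne hyy'.1

theorem Backtracks.cons {a : V} {l : List V} (h : Backtracks l) : Backtracks (a :: l) := by
  match l, h with
  | x :: y :: z :: l, h => exact Or.inr h

theorem Reduced.tail {a : V} {l : List V} (h : X.Reduced (a :: l)) : X.Reduced l :=
  fun _ hm hb => h _ (hm.cons a) hb.cons

theorem Reduced.congr {l m : List V} (h : X.Reduced l) (hm : X.SwapEq l m) : X.Reduced m :=
  fun _ hr => h _ (hm.trans hr)

theorem reduced_singleton (a : V) : X.Reduced [a] := by
  intro m hm hb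
  obtain ⟨l, rfl⟩ := hm.exists_cons
  have := hm.length_eq
  cases l with
  | nil => exact hb
  | cons => simp at this

theorem Reduced.cons (hX : X.IsNonpositivelyCurved) {x w : V} {l : List V}
    (hl : X.Reduced (x :: l)) (hw : ∀ l', ¬ X.SwapEq (x :: l) (x :: w :: l')) :
    X.Reduced (w :: x :: l) := by
  induction hn : l.length using Nat.strong_induction_on generalizing x w l with
  | _ n ih =>
  subst hn
  intro m hm hback
  obtain ⟨y, l', rfl⟩ := hm.exists_cons_cons
  rcases hm.firstEdgeRel hX with ⟨rfl, htail⟩ | ⟨z, r, hsq, hxz, hyz⟩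
  · match l', hback with
    | z :: t, hback =>
      rcases hback with rfl | hback
      · exact hw _ htail
      · exact hl _ htail hback
  · have hy : ∀ t, ¬ X.SwapEq (z :: r) (z :: y :: t) := fun t ht =>
      hw _ (hxz.trans ((ht.cons x).trans (.top t (X.rotate hsq))))
    match l', hback with
    | w' :: t, hback =>
      rcases hback with rfl | hback
      · obtain ⟨p, s, hp, -, hzs⟩ := hyz.exists_square hX (X.diag_ne hsq)
        obtain rfl := corner_unique hp (X.rotate (X.rotate (X.rotate hsq)))
        exact hl _ (hxz.trans (hzs.cons _)) (Or.inl rfl)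
      · have hlen : r.length < l.length := by
          have := hxz.length_eq
          simp only [List.length_cons] at this
          omega
        exact ih _ hlen (hl.congr hxz).tail hy rfl _ hyz.symm hback

open Classical in
/-- The reduced path obtained from a reduced path `l` by adding the edge from `w` to its first
vertex: if `l` is equivalent to a path that starts with this edge, the edge is cancelled. -/
noncomputable def prepend (X : SquareComplex V) (w : V) : List V → List V
  | [] => [w]
  | x :: l => if h : ∃ l', X.SwapEq (x :: l) (x :: w :: l') then w :: h.choose else w :: x :: l

theorem prepend_of_swapEq (hX : X.IsNonpositivelyCurved) {w x : V} {l l' : List V}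
    (h : X.SwapEq (x :: l) (x :: w :: l')) : X.SwapEq (X.prepend w (x :: l)) (w :: l') := by
  have h' : ∃ l', X.SwapEq (x :: l) (x :: w :: l') := ⟨_, h⟩
  rw [prepend, dif_pos h']
  exact (h'.choose_spec.symm.trans h).cancel hX

theorem prepend_of_not_swapEq {w x : V} {l : List V}
    (h : ∀ l', ¬ X.SwapEq (x :: l) (x :: w :: l')) : X.prepend w (x :: l) = w :: x :: l := by
  rw [prepend, dif_neg (not_exists.2 h)]

theorem prepend_exists_cons (w : V) (l : List V) : ∃ l', X.prepend w l = w :: l' := by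
  cases l with
  | nil => exact ⟨_, rfl⟩
  | cons x l => rw [prepend]; split <;> exact ⟨_, rfl⟩

theorem prepend_congr (hX : X.IsNonpositivelyCurved) {w : V} {l m : List V} (h : X.SwapEq l m) :
    X.SwapEq (X.prepend w l) (X.prepend w m) := by
  cases l with
  | nil =>
    have := h.length_eq
    simp only [List.length_nil] at this
    obtain rfl := List.length_eq_zero_iff.1 this.symm
    exact .refl _
  | cons x l =>
    obtain ⟨m, rfl⟩ := h.exists_cons
    by_cases h' : ∃ l', X.SwapEq (x :: l) (x :: w :: l')
    · obtain ⟨l', h'⟩ := h'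
      exact (prepend_of_swapEq hX h').trans (prepend_of_swapEq hX (h.symm.trans h')).symm
    · rw [not_exists] at h'
      rw [prepend_of_not_swapEq h', prepend_of_not_swapEq fun l' hl' => h' l' (h.trans hl')]
      exact h.cons w

theorem Reduced.prepend (hX : X.IsNonpositivelyCurved) {w : V} {l : List V} (h : X.Reduced l) :
    X.Reduced (X.prepend w l) := by
  cases l with
  | nil => exact reduced_singleton w
  | cons x l =>
    by_cases h' : ∃ l', X.SwapEq (x :: l) (x :: w :: l')
    · obtain ⟨l', h'⟩ := h'
      exact (h.congr h').tail.congr (prepend_of_swapEq hX h').symm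
    · rw [not_exists] at h'
      rw [prepend_of_not_swapEq h']
      exact h.cons hX h'

theorem prepend_backtrack (hX : X.IsNonpositivelyCurved) {w x : V} {l : List V}
    (hl : X.Reduced (x :: l)) : X.SwapEq (X.prepend x (X.prepend w (x :: l))) (x :: l) := by
  by_cases hcancel : ∃ l', X.SwapEq (x :: l) (x :: w :: l')
  · obtain ⟨l', hl'⟩ := hcancel
    refine (prepend_congr hX (prepend_of_swapEq hX hl')).trans ?_
    rw [prepend_of_not_swapEq]
    · exact hl'.symm
    · intro t ht
      exact hl _ (hl'.trans (ht.cons x)) (Or.inl rfl)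
  · rw [not_exists] at hcancel
    rw [prepend_of_not_swapEq hcancel]
    exact prepend_of_swapEq hX (.refl _)

theorem prepend_square_of_swapEq (hX : X.IsNonpositivelyCurved) {x b c d : V} {l t : List V}
    (hsq : X.IsSquare x b c d) (hb : X.SwapEq (x :: l) (x :: b :: t)) :
    X.SwapEq (X.prepend c (X.prepend b (x :: l))) (X.prepend c (X.prepend d (x :: l))) := by
  refine (prepend_congr hX (prepend_of_swapEq hX hb)).trans ?_
  by_cases hc : ∃ r, X.SwapEq (b :: t) (b :: c :: r)
  · obtain ⟨r, hr⟩ := hc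
    have hd : X.SwapEq (x :: l) (x :: d :: c :: r) := hb.trans ((hr.cons x).trans (.top r hsq))
    exact (prepend_of_swapEq hX hr).trans
      ((prepend_congr hX (prepend_of_swapEq hX hd)).trans (prepend_of_swapEq hX (.refl _))).symm
  · rw [not_exists] at hc
    have hd : ∀ r, ¬ X.SwapEq (x :: l) (x :: d :: r) := by
      intro r hr
      obtain ⟨z, r', hz, hbz, -⟩ := (hb.symm.trans hr).exists_square hX (isSquare_ne hsq)
      obtain rfl := corner_unique hz hsq
      exact hc _ hbz
    rw [prepend_of_not_swapEq hc, prepend_of_not_swapEq hd]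
    refine (prepend_of_swapEq hX ?_).symm
    exact (hb.cons d).trans (.top t (X.rotate (X.rotate (X.rotate hsq))))

theorem not_swapEq_of_isSquare (hX : X.IsNonpositivelyCurved) {x b c d : V} {l : List V}
    (hsq : X.IsSquare x b c d) (hd : ∀ t, ¬ X.SwapEq (x :: l) (x :: d :: t)) (t : List V) :
    ¬ X.SwapEq (b :: x :: l) (b :: c :: t) := by
  intro h
  obtain ⟨z, r, hz, hxz, -⟩ := h.exists_square hX (X.diag_ne hsq)
  obtain rfl := corner_unique hz (X.reflect (X.rotate hsq))
  exact hd _ hxz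

theorem prepend_square (hX : X.IsNonpositivelyCurved) {x b c d : V} {l : List V}
    (hsq : X.IsSquare x b c d) :
    X.SwapEq (X.prepend c (X.prepend b (x :: l))) (X.prepend c (X.prepend d (x :: l))) := by
  by_cases hb : ∃ t, X.SwapEq (x :: l) (x :: b :: t)
  · obtain ⟨t, ht⟩ := hb
    exact prepend_square_of_swapEq hX hsq ht
  by_cases hd : ∃ t, X.SwapEq (x :: l) (x :: d :: t)
  · obtain ⟨t, ht⟩ := hd
    exact (prepend_square_of_swapEq hX (X.reflect hsq) ht).symm
  rw [not_exists] at hb hd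
  rw [prepend_of_not_swapEq hb, prepend_of_not_swapEq hd,
    prepend_of_not_swapEq (not_swapEq_of_isSquare hX hsq hd),
    prepend_of_not_swapEq (not_swapEq_of_isSquare hX (X.reflect hsq) hb)]
  exact .top l (X.reflect (X.rotate (X.rotate hsq)))

/-- The reduced path homotopic to an edge path, built up by prepending one edge at a time. -/
noncomputable def normalForm (X : SquareComplex V) : List V → List V
  | [] => []
  | w :: l => X.prepend w (normalForm X l)

theorem Reduced.normalForm_swapEq (hX : X.IsNonpositivelyCurved) {l : List V} (h : X.Reduced l) :
    X.SwapEq (X.normalForm l) l := by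
  induction l with
  | nil => exact .refl _
  | cons w l ih =>
    refine (prepend_congr hX (ih h.tail)).trans ?_
    cases l with
    | nil => exact .refl _
    | cons x l =>
      rw [prepend_of_not_swapEq]
      · exact .refl _
      · intro l' hl'
        exact h _ (hl'.cons w) (Or.inl rfl)

/-- The list of vertices of an edge path that ends at `o`. -/
inductive IsPath (X : SquareComplex V) (o : V) : List V → Prop
  | single : IsPath X o [o]
  | cons {w x : V} {l : List V} (h : X.graph.Adj w x) (hl : IsPath X o (x :: l)) :
      IsPath X o (w :: x :: l)

theorem Swap.isPath {o : V} {l l' : List V} (h : X.Swap l l') (hl : X.IsPath o l) :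
    X.IsPath o l' := by
  induction h with
  | top l hsq =>
    obtain _ | ⟨-, _ | ⟨-, htail⟩⟩ := hl
    exact .cons (X.adj (X.reflect hsq)) (.cons (X.adj (X.rotate (X.reflect hsq))) htail)
  | cons a h ih =>
    obtain _ | ⟨hadj, htail⟩ := hl
    · cases h
    · obtain ⟨t, rfl⟩ := h.exists_cons
      exact .cons hadj (ih htail)

theorem SwapEq.isPath {o : V} {l l' : List V} (h : X.SwapEq l l') (hl : X.IsPath o l) :
    X.IsPath o l' := by
  induction h with
  | refl => exact hl
  | tail _ h ih => exact h.isPath ih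

theorem IsPath.dist_le (hc : X.graph.Connected) {o x : V} {l : List V}
    (h : X.IsPath o (x :: l)) : X.graph.dist o x ≤ l.length := by
  induction l generalizing x with
  | nil => cases h; simp
  | cons y l ih =>
    obtain _ | ⟨hxy, hl⟩ := h
    have htri := hc.dist_triangle (u := o) (v := y) (w := x)
    have hyx : X.graph.dist y x = 1 := SimpleGraph.dist_eq_one_iff_adj.2 hxy.symm
    have := ih hl
    simp only [List.length_cons]
    omega

theorem IsPath.exists_shorter {o x : V} {l : List V} (h : X.IsPath o (x :: l))
    (hback : Backtracks (x :: l)) : ∃ l', X.IsPath o (x :: l') ∧ l'.length < l.length := by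
  induction l generalizing x with
  | nil => exact hback.elim
  | cons y l ih =>
    obtain _ | ⟨hxy, _ | ⟨hyz, hl⟩⟩ := h
    · exact hback.elim
    rcases hback with rfl | hback
    · exact ⟨_, hl, by simp⟩
    · obtain ⟨l', hl', hlt⟩ := ih (.cons hyz hl) hback
      exact ⟨_, .cons hxy hl', by simpa using hlt⟩

theorem exists_isPath_of_walk {o x : V} (p : X.graph.Walk x o) :
    ∃ l, X.IsPath o (x :: l) ∧ l.length = p.length := by
  induction p with
  | nil => exact ⟨[], .single, rfl⟩
  | cons h p ih =>
    obtain ⟨l, hl, hlen⟩ := ih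
    exact ⟨_, .cons h hl, by simp [hlen]⟩

theorem exists_isPath (hc : X.graph.Connected) (o x : V) :
    ∃ l, X.IsPath o (x :: l) ∧ l.length = X.graph.dist o x := by
  obtain ⟨p, hp⟩ := hc.exists_walk_length_eq_dist x o
  obtain ⟨l, hl, hlen⟩ := exists_isPath_of_walk p
  exact ⟨l, hl, by rw [hlen, hp, SimpleGraph.dist_comm]⟩

/-- Up to replacements across squares, the normal form of an edge path depends only on its ends.
This is how simple connectedness is used. -/
def UniqueNormalForms (X : SquareComplex V) : Prop :=
  ∀ (o x : V) (l l' : List V), X.IsPath o (x :: l) → X.IsPath o (x :: l') →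
    X.SwapEq (X.normalForm (x :: l)) (X.normalForm (x :: l'))

theorem exists_reduced_isPath_cons (hc : X.graph.Connected) {o x y : V} (hxy : X.graph.Adj x y)
    (hdist : X.graph.dist o y + 1 = X.graph.dist o x) :
    ∃ l, X.IsPath o (x :: y :: l) ∧ X.Reduced (x :: y :: l) ∧ l.length = X.graph.dist o y := by
  obtain ⟨l, hl, hlen⟩ := exists_isPath hc o y
  refine ⟨l, .cons hxy hl, fun m hm hback => ?_, hlen⟩
  obtain ⟨t, rfl⟩ := hm.exists_cons
  obtain ⟨t', ht', hshort⟩ := (hm.isPath (.cons hxy hl)).exists_shorter hback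
  have hdist_le := ht'.dist_le hc
  have hlen_eq := hm.length_eq
  simp only [List.length_cons] at hlen_eq
  omega

theorem quadrangle (hX : X.IsNonpositivelyCurved) (hc : X.graph.Connected)
    (hu : X.UniqueNormalForms) {o x y y' : V} (hy : X.graph.Adj x y) (hy' : X.graph.Adj x y')
    (hne : y ≠ y') (hdist : X.graph.dist o y + 1 = X.graph.dist o x)
    (hdist' : X.graph.dist o y' + 1 = X.graph.dist o x) :
    ∃ z, X.IsSquare x y z y' ∧ X.graph.dist o z + 2 = X.graph.dist o x := by
  obtain ⟨l, hl, hl_red, hlen⟩ := exists_reduced_isPath_cons hc hy hdist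
  obtain ⟨l', hl', hl'_red, -⟩ := exists_reduced_isPath_cons hc hy' hdist'
  have hswap : X.SwapEq (x :: y :: l) (x :: y' :: l') :=
    (hl_red.normalForm_swapEq hX).symm.trans
      ((hu o x _ _ hl hl').trans (hl'_red.normalForm_swapEq hX))
  obtain ⟨z, r, hsq, hyz, -⟩ := hswap.exists_square hX hne
  refine ⟨z, hsq, ?_⟩
  have hz_le : X.graph.dist o z ≤ r.length := by
    cases hl with
    | cons _ hl =>
      cases hyz.isPath hl with
      | cons _ hr => exact hr.dist_le hc
  have hlen_eq := hyz.length_eq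
  simp only [List.length_cons] at hlen_eq
  have htri := hc.dist_triangle (u := o) (v := z) (w := y)
  have hzy : X.graph.dist z y = 1 :=
    SimpleGraph.dist_eq_one_iff_adj.2 (X.adj (X.rotate hsq)).symm
  omega

end SquareComplex

namespace SquareComplex

variable {V : Type u} (X : SquareComplex V)

/-- The cubes of a square complex, as sets of vertices. -/
def Cube : Type u := {S : Set V // (∃ a, S = {a}) ∨ (∃ a b, X.graph.Adj a b ∧ S = {a, b}) ∨
  ∃ a b c d, X.IsSquare a b c d ∧ S = {a, b, c, d}}

variable {X}

namespace Cube

def vertex (X : SquareComplex V) (a : V) : X.Cube := ⟨{a}, Or.inl ⟨a, rfl⟩⟩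

def edge {a b : V} (h : X.graph.Adj a b) : X.Cube := ⟨{a, b}, Or.inr (Or.inl ⟨a, b, h, rfl⟩)⟩

def square {a b c d : V} (h : X.IsSquare a b c d) : X.Cube :=
  ⟨{a, b, c, d}, Or.inr (Or.inr ⟨a, b, c, d, h, rfl⟩)⟩

theorem eq_vertex_or_edge_or_square (C : X.Cube) :
    (∃ a, C = vertex X a) ∨ (∃ (a b : V) (h : X.graph.Adj a b), C = edge h) ∨
      ∃ (a b c d : V) (h : X.IsSquare a b c d), C = square h := by
  obtain ⟨S, ⟨a, rfl⟩ | ⟨a, b, h, rfl⟩ | ⟨a, b, c, d, h, rfl⟩⟩ := C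
  · exact Or.inl ⟨a, rfl⟩
  · exact Or.inr (Or.inl ⟨a, b, h, rfl⟩)
  · exact Or.inr (Or.inr ⟨a, b, c, d, h, rfl⟩)

theorem edge_symm {a b : V} (h : X.graph.Adj a b) : edge h.symm = edge h :=
  Subtype.ext (Set.pair_comm b a)

theorem square_rotate {a b c d : V} (h : X.IsSquare a b c d) : square (X.rotate h) = square h := by
  refine Subtype.ext ?_
  ext v
  simp only [square, Set.mem_insert_iff, Set.mem_singleton_iff]
  tauto

theorem square_reflect {a b c d : V} (h : X.IsSquare a b c d) :
    square (X.reflect h) = square h := by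
  refine Subtype.ext ?_
  ext v
  simp only [square, Set.mem_insert_iff, Set.mem_singleton_iff]
  tauto

/-- The dimension of a cube, which has `2 ^ dim` vertices. -/
noncomputable def dim (C : X.Cube) : ℤ := (Nat.log 2 C.1.ncard : ℤ)

theorem ncard_edge {a b : V} (h : X.graph.Adj a b) : (edge h).1.ncard = 2 :=
  Set.ncard_pair h.ne

theorem ncard_square {a b c d : V} (h : X.IsSquare a b c d) : (square h).1.ncard = 4 := by
  have hab : a ≠ b := (X.adj h).ne
  have hbc : b ≠ c := (X.adj (X.rotate h)).ne
  have hcd : c ≠ d := (X.adj (X.rotate (X.rotate h))).ne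
  have had : a ≠ d := (X.adj (X.reflect h)).ne
  rw [square, Set.ncard_insert_of_notMem (by simp [hab, X.diag_ne h, had]),
    Set.ncard_insert_of_notMem (by simp [hbc, isSquare_ne h]), Set.ncard_pair hcd]

@[simp]
theorem dim_vertex (a : V) : (vertex X a).dim = 0 := by
  simp [dim, vertex]

@[simp]
theorem dim_edge {a b : V} (h : X.graph.Adj a b) : (edge h).dim = 1 := by
  rw [dim, ncard_edge]
  norm_num

@[simp]
theorem dim_square {a b c d : V} (h : X.IsSquare a b c d) : (square h).dim = 2 := by
  rw [dim, ncard_square, show 4 = 2 ^ 2 by norm_num, Nat.log_pow one_lt_two, Nat.cast_ofNat]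

theorem vertex_inj {a b : V} (h : vertex X a = vertex X b) : a = b :=
  Set.singleton_injective (congrArg Subtype.val h)

theorem edge_inj {a b c : V} {h : X.graph.Adj a b} {h' : X.graph.Adj a c}
    (e : edge h = edge h') : b = c := by
  have hb : b ∈ (edge h').1 := by rw [← e]; simp [edge]
  exact hb.resolve_left h.ne'

theorem eq_or_eq_of_adj {x y z y' u : V} (h : X.IsSquare x y z y') (hu : X.graph.Adj x u)
    (hmem : u ∈ (square h).1) : u = y ∨ u = y' := by
  rcases hmem with rfl | rfl | rfl | hu'
  · exact absurd rfl hu.ne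
  · exact Or.inl rfl
  · exact absurd hu (X.diag_not_adj h)
  · exact Or.inr hu'

/-- `C` is a codimension one face of `D`. -/
def IsFacet (C D : X.Cube) : Prop :=
  (∃ (x y : V) (h : X.graph.Adj x y), C = vertex X x ∧ D = edge h) ∨
  ∃ (x y z y' : V) (h : X.IsSquare x y z y'), C = edge (X.adj h) ∧ D = square h

theorem IsFacet.dim_eq {C D : X.Cube} (h : IsFacet C D) : D.dim = C.dim + 1 := by
  rcases h with ⟨x, y, h, rfl, rfl⟩ | ⟨x, y, z, y', h, rfl, rfl⟩
  · rw [dim_vertex, dim_edge]; rfl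
  · rw [dim_square, dim_edge]; rfl

/-- `A, B, C, D` is the square of the subdivision at the vertex `A` of the square `C`; `B` and `D`
are the two sides of `C` at `A`. -/
def Corner (A B C D : X.Cube) : Prop :=
  ∃ (x y z y' : V) (h : X.IsSquare x y z y'), A = vertex X x ∧ B = edge (X.adj h) ∧ C = square h ∧
    D = edge (X.adj (X.reflect h))

theorem Corner.symm {A B C D : X.Cube} (h : Corner A B C D) : Corner A D C B := by
  obtain ⟨x, y, z, y', h, rfl, rfl, rfl, rfl⟩ := h
  exact ⟨x, y', z, y, X.reflect h, rfl, rfl, (square_reflect h).symm, rfl⟩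

theorem Corner.dims {A B C D : X.Cube} (h : Corner A B C D) :
    A.dim = 0 ∧ B.dim = 1 ∧ C.dim = 2 ∧ D.dim = 1 := by
  obtain ⟨x, y, z, y', h, rfl, rfl, rfl, rfl⟩ := h
  exact ⟨dim_vertex _, dim_edge _, dim_square _, dim_edge _⟩

theorem Corner.isFacet_left {A B C D : X.Cube} (h : Corner A B C D) : IsFacet A B := by
  obtain ⟨x, y, z, y', h, rfl, rfl, rfl, rfl⟩ := h
  exact Or.inl ⟨_, _, _, rfl, rfl⟩

theorem Corner.isFacet_right {A B C D : X.Cube} (h : Corner A B C D) : IsFacet B C := by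
  obtain ⟨x, y, z, y', h, rfl, rfl, rfl, rfl⟩ := h
  exact Or.inr ⟨_, _, _, _, _, rfl, rfl⟩

theorem Corner.ne {A B C D : X.Cube} (h : Corner A B C D) : B ≠ D := by
  obtain ⟨x, y, z, y', h, rfl, rfl, rfl, rfl⟩ := h
  exact fun e => isSquare_ne h (edge_inj e)

theorem Corner.unique_edges {A B C D B' D' : X.Cube} (h : Corner A B C D)
    (h' : Corner A B' C D') : (B = B' ∧ D = D') ∨ (B = D' ∧ D = B') := by
  have hne := h'.ne
  obtain ⟨x, y, z, y', hsq, rfl, rfl, rfl, rfl⟩ := h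
  obtain ⟨x₁, y₁, z₁, y₁', hsq₁, hx, rfl, hC, rfl⟩ := h'
  obtain rfl := vertex_inj hx
  have hy₁ : y₁ ∈ (square hsq).1 := by rw [hC]; simp [square]
  have hy₁' : y₁' ∈ (square hsq).1 := by rw [hC]; simp [square]
  rcases eq_or_eq_of_adj hsq (X.adj hsq₁) hy₁ with rfl | rfl <;>
    rcases eq_or_eq_of_adj hsq (X.adj (X.reflect hsq₁)) hy₁' with rfl | rfl
  · exact absurd rfl hne
  · exact Or.inl ⟨rfl, rfl⟩
  · exact Or.inr ⟨rfl, rfl⟩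
  · exact absurd rfl hne

theorem Corner.unique_ends {A B C D A' C' : X.Cube} (h : Corner A B C D)
    (h' : Corner A' B C' D) : A = A' ∧ C = C' := by
  obtain ⟨x, y, z, y', hsq, rfl, rfl, rfl, rfl⟩ := h
  obtain ⟨x₁, y₁, z₁, y₁', hsq₁, rfl, hB, rfl, hD⟩ := h'
  have hxy : x₁ ∈ (edge (X.adj hsq)).1 := by rw [hB]; simp [edge]
  have hxy' : x₁ ∈ (edge (X.adj (X.reflect hsq))).1 := by rw [hD]; simp [edge]
  have hx : x₁ = x := by
    rcases hxy with rfl | hy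
    · rfl
    · exact hxy'.resolve_right fun hy' => isSquare_ne hsq (hy.symm.trans hy')
  subst hx
  obtain rfl := edge_inj hB
  obtain rfl := edge_inj hD
  obtain rfl := corner_unique hsq hsq₁
  exact ⟨rfl, rfl⟩

/-- Consecutive sides of a square belong to different classes of parallel sides; the two classes
are told apart by whether or not a side separates the ends `x` and `y` of a fixed side. -/
theorem Corner.mem_iff_mem_iff_not {A B C D : X.Cube} (h : Corner A B C D) {x y : V}
    (hxy : X.graph.Adj x y) (hx : x ∈ C.1) (hy : y ∈ C.1) :
    (x ∈ B.1 ↔ y ∈ B.1) ↔ ¬ (x ∈ D.1 ↔ y ∈ D.1) := by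
  obtain ⟨a, b, c, d, hsq, rfl, rfl, rfl, rfl⟩ := h
  have hac := X.diag_ne hsq
  have hbd := isSquare_ne hsq
  have hab := (X.adj hsq).ne
  have hbc := (X.adj (X.rotate hsq)).ne
  have hcd := (X.adj (X.rotate (X.rotate hsq))).ne
  have hda := (X.adj (X.reflect hsq)).ne
  have hrot := square_rotate hsq
  have hrot₂ := square_rotate (X.rotate hsq)
  have hrot₃ := square_rotate (X.rotate (X.rotate hsq))
  rcases hx with rfl | rfl | rfl | rfl
  · rcases eq_or_eq_of_adj hsq hxy hy with rfl | rfl <;> simp [edge, *, Ne.symm]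
  · rcases eq_or_eq_of_adj (X.rotate hsq) hxy (hrot ▸ hy) with rfl | rfl <;>
      simp [edge, *, Ne.symm]
  · rcases eq_or_eq_of_adj (X.rotate (X.rotate hsq)) hxy (hrot₂ ▸ hrot ▸ hy) with rfl | rfl <;>
      simp [edge, *, Ne.symm]
  · rcases eq_or_eq_of_adj (X.rotate (X.rotate (X.rotate hsq))) hxy
      (hrot₃ ▸ hrot₂ ▸ hrot ▸ hy) with rfl | rfl <;> simp [edge, *, Ne.symm]

/-- The squares of the subdivision, as 4-cycles that start at any of their vertices. -/
def CornerCycle (A B C D : X.Cube) : Prop :=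
  Corner A B C D ∨ Corner B C D A ∨ Corner C D A B ∨ Corner D A B C

namespace CornerCycle

theorem reflect {A B C D : X.Cube} : CornerCycle A B C D → CornerCycle A D C B
  | Or.inl h => Or.inl h.symm
  | Or.inr (Or.inl h) => Or.inr (Or.inr (Or.inr h.symm))
  | Or.inr (Or.inr (Or.inl h)) => Or.inr (Or.inr (Or.inl h.symm))
  | Or.inr (Or.inr (Or.inr h)) => Or.inr (Or.inl h.symm)

/-- The three cases are those of a first vertex of dimension 0, 2 and 1. -/
theorem cases {A B C D : X.Cube} (h : CornerCycle A B C D) :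
    (A.dim = 0 ∧ Corner A B C D) ∨ (A.dim = 2 ∧ Corner C B A D) ∨
      A.dim = 1 ∧ (Corner B A D C ∨ Corner D A B C) := by
  rcases h with h | h | h | h
  · exact Or.inl ⟨h.dims.1, h⟩
  · exact Or.inr (Or.inr ⟨h.dims.2.2.2, Or.inl h.symm⟩)
  · exact Or.inr (Or.inl ⟨h.dims.2.2.1, h.symm⟩)
  · exact Or.inr (Or.inr ⟨h.dims.2.1, Or.inr h⟩)

theorem diag_unique {A B C D B' D' : X.Cube} (h : CornerCycle A B C D)
    (h' : CornerCycle A B' C D') : (B = B' ∧ D = D') ∨ (B = D' ∧ D = B') := by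
  rcases h.cases with ⟨hA, h⟩ | ⟨hA, h⟩ | ⟨hA, h⟩ <;>
    rcases h'.cases with ⟨hA', h'⟩ | ⟨hA', h'⟩ | ⟨hA', h'⟩ <;>
    try omega
  · exact h.unique_edges h'
  · exact h.unique_edges h'
  · rcases h with h | h <;> rcases h' with h' | h'
    · exact Or.inl (h.unique_ends h')
    · exact Or.inr (h.unique_ends h')
    · exact Or.inr (h.unique_ends h').symm
    · exact Or.inl (h.unique_ends h').symm

end CornerCycle

end Cube

open SquareComplex.Cube

variable (X) in
/-- The cubical subdivision, whose vertices are the cubes of `X`. The dimension of cubes is a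
grading of its vertices. -/
noncomputable def subdivision : SquareComplex X.Cube where
  graph :=
    { Adj := fun C D => IsFacet C D ∨ IsFacet D C
      symm := ⟨fun _ _ h => h.symm⟩
      loopless := ⟨fun C h => by rcases h with h | h <;> have := h.dim_eq <;> omega⟩ }
  IsSquare := CornerCycle
  rotate := by unfold CornerCycle; tauto
  reflect := CornerCycle.reflect
  adj := by
    rintro a b c d (h | h | h | h)
    · exact Or.inl h.isFacet_left
    · exact Or.inr h.symm.isFacet_left
    · exact Or.inr h.symm.isFacet_right
    · exact Or.inl h.isFacet_right
  diag_ne := by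
    rintro a b c d (h | h | h | h) rfl
    · have := h.dims; omega
    · exact h.ne rfl
    · have := h.dims; omega
    · exact h.ne rfl
  diag_not_adj := by
    rintro a b c d (h | h | h | h) (h' | h') <;> have := h.dims <;> have := h'.dim_eq <;> omega
  diag_unique := CornerCycle.diag_unique

theorem subdivision_isSquare_corner {x y z y' : V} (h : X.IsSquare x y z y') :
    X.subdivision.IsSquare (vertex X x) (edge (X.adj h)) (square h) (edge (X.adj (X.reflect h))) :=
  Or.inl ⟨_, _, _, _, h, rfl, rfl, rfl, rfl⟩

theorem Cube.Corner.not_triangle (hX : X.IsNonpositivelyCurved) {A B C D P Q R : X.Cube}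
    (hBC : Corner A B P C) (hBD : Corner A B Q D) (hCD : Corner A C R D) : False := by
  obtain ⟨x, y, z, y', hsq, rfl, rfl, rfl, rfl⟩ := hBC
  obtain ⟨x₁, y₁, z₁, y₁', hsq₁, hx₁, hy₁, rfl, rfl⟩ := hBD
  obtain rfl := vertex_inj hx₁
  obtain rfl := edge_inj hy₁
  obtain ⟨x₂, y₂, z₂, y₂', hsq₂, hx₂, hy₂, rfl, hy₂'⟩ := hCD
  obtain rfl := vertex_inj hx₂
  obtain rfl := edge_inj hy₂
  obtain rfl := edge_inj hy₂'
  exact hX.not_three_squares hsq hsq₂ hsq₁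

theorem Cube.Corner.not_triangle_square {C B₁ B₂ B₃ P Q R : X.Cube}
    (h₁₂ : Corner P B₁ C B₂) (h₁₃ : Corner Q B₁ C B₃) (h₂₃ : Corner R B₂ C B₃) : False := by
  obtain ⟨x, y, hxy, hx, hy⟩ : ∃ x y, X.graph.Adj x y ∧ x ∈ C.1 ∧ y ∈ C.1 := by
    obtain ⟨x, y, z, y', hsq, -, -, rfl, -⟩ := h₁₂
    exact ⟨x, y, X.adj hsq, by simp [square], by simp [square]⟩
  have := h₁₂.mem_iff_mem_iff_not hxy hx hy
  have := h₁₃.mem_iff_mem_iff_not hxy hx hy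
  have := h₂₃.mem_iff_mem_iff_not hxy hx hy
  tauto

/-- The link of a vertex of `X` does not change, and the links of the midpoints of an edge and of a
square are bipartite. -/
theorem subdivision_isNonpositivelyCurved (hX : X.IsNonpositivelyCurved) :
    X.subdivision.IsNonpositivelyCurved := by
  classical
  intro S s hs
  obtain ⟨⟨b₁, _⟩, ⟨b₂, _⟩, ⟨b₃, _⟩, ⟨p, hp⟩, ⟨q, hq⟩, ⟨r, hr⟩, -⟩ :=
    SimpleGraph.is3Clique_iff.1 hs
  have hp : CornerCycle S b₁ p b₂ := hp
  have hq : CornerCycle S b₁ q b₃ := hq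
  have hr : CornerCycle S b₂ r b₃ := hr
  rcases hp.cases with ⟨hS, hp⟩ | ⟨hS, hp⟩ | ⟨hS, hp⟩ <;>
    rcases hq.cases with ⟨hS', hq⟩ | ⟨hS', hq⟩ | ⟨hS', hq⟩ <;> try omega
  all_goals
    rcases hr.cases with ⟨hS'', hr⟩ | ⟨hS'', hr⟩ | ⟨hS'', hr⟩ <;> try omega
  · exact hp.not_triangle hX hq hr
  · exact hp.not_triangle_square hq hr
  · rcases hp with hp | hp <;> rcases hq with hq | hq <;> rcases hr with hr | hr <;>
      have := hp.dims <;> have := hq.dims <;> have := hr.dims <;> omega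

end SquareComplex

namespace SquareComplex

open SquareComplex.Cube

variable {V : Type u} {X : SquareComplex V}

theorem Homotopic.append {u v w : V} {p q : X.graph.Walk u v} (h : X.Homotopic p q)
    (r : X.graph.Walk v w) : X.Homotopic (p.append r) (q.append r) := by
  induction h with
  | refl p => exact .refl _
  | symm _ ih => exact .symm (ih r)
  | trans _ _ ih ih' => exact .trans (ih r) (ih' r)
  | cons h _ ih => exact .cons h (ih r)
  | backtrack h p => exact .backtrack h _
  | square hab hbc had hdc hsq p => exact .square hab hbc had hdc hsq _

theorem Homotopic.append_left {u v w : V} (r : X.graph.Walk u v) {p q : X.graph.Walk v w}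
    (h : X.Homotopic p q) : X.Homotopic (r.append p) (r.append q) := by
  induction r with
  | nil => exact h
  | cons e _ ih => exact .cons e (ih h)

theorem homotopic_of_isSimplyConnected (hX : X.IsSimplyConnected) {u v : V}
    (p q : X.graph.Walk u v) : X.Homotopic p q := by
  have hp : X.Homotopic (p.append (q.reverse.append q)) (p.append .nil) :=
    .append_left p (hX.2 v _)
  have hq : X.Homotopic ((p.append q.reverse).append q) (SimpleGraph.Walk.nil.append q) :=
    (hX.2 u _).append q
  rw [SimpleGraph.Walk.append_nil] at hp
  rw [SimpleGraph.Walk.nil_append, ← SimpleGraph.Walk.append_assoc] at hq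
  exact hp.symm.trans hq

/-- A covering of a square complex in combinatorial form: a fiber over every vertex, and lifts of
the edges, compatible with backtracks and squares. The point of the fiber over `b` that is joined
to the point `s` over a neighbor of `b` is `move b s`. -/
structure Covering (X : SquareComplex V) (S : Type*) where
  fiber : V → Set S
  move : V → S → S
  move_mem : ∀ {a b s}, X.graph.Adj a b → s ∈ fiber a → move b s ∈ fiber b
  move_move : ∀ {a b s}, X.graph.Adj a b → s ∈ fiber a → move a (move b s) = s
  move_square : ∀ {a b c d s}, X.IsSquare a b c d → s ∈ fiber a →
    move c (move b s) = move c (move d s)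

theorem Cube.vertex_adj_edge {x y : V} (h : X.graph.Adj x y) :
    X.subdivision.graph.Adj (vertex X x) (edge h) :=
  Or.inl (Or.inl ⟨x, y, h, rfl, rfl⟩)

theorem Cube.edge_adj_square {x y z y' : V} (h : X.IsSquare x y z y') :
    X.subdivision.graph.Adj (edge (X.adj h)) (square h) :=
  Or.inl (Or.inr ⟨x, y, z, y', h, rfl, rfl⟩)

theorem Cube.edge_adj_vertex {x y : V} (h : X.graph.Adj x y) :
    X.subdivision.graph.Adj (edge h) (vertex X y) := by
  rw [← edge_symm h]
  exact (vertex_adj_edge h.symm).symm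

namespace Covering

variable {S : Type*} (c : Covering X.subdivision S)

theorem move_around_square {x y z y' : V} (hxy : X.graph.Adj x y) (hyz : X.graph.Adj y z)
    (hxy' : X.graph.Adj x y') (hy'z : X.graph.Adj y' z) (hsq : X.IsSquare x y z y') {s : S}
    (hs : s ∈ c.fiber (vertex X z)) :
    c.move (vertex X x) (c.move (edge hxy) (c.move (vertex X y) (c.move (edge hyz) s))) =
      c.move (vertex X x) (c.move (edge hxy') (c.move (vertex X y') (c.move (edge hy'z) s))) := by
  have at_z : X.subdivision.IsSquare (vertex X z) (edge hyz) (square hsq) (edge hy'z) := by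
    rw [← edge_symm hyz, ← edge_symm hy'z, ← square_rotate hsq, ← square_rotate (X.rotate hsq)]
    exact X.subdivision.reflect (subdivision_isSquare_corner (X.rotate (X.rotate hsq)))
  have at_y : X.subdivision.IsSquare (edge hyz) (vertex X y) (edge hxy) (square hsq) := by
    rw [← edge_symm hxy, ← square_rotate hsq]
    exact X.subdivision.rotate (X.subdivision.rotate (X.subdivision.rotate
      (X.subdivision.reflect (subdivision_isSquare_corner (X.rotate hsq)))))
  have at_y' : X.subdivision.IsSquare (edge hy'z) (vertex X y') (edge hxy') (square hsq) := by
    rw [← edge_symm hxy', ← square_reflect hsq, ← square_rotate (X.reflect hsq)]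
    exact X.subdivision.rotate (X.subdivision.rotate (X.subdivision.rotate
      (X.subdivision.reflect (subdivision_isSquare_corner (X.rotate (X.reflect hsq))))))
  have at_x : X.subdivision.IsSquare (square hsq) (edge hxy) (vertex X x) (edge hxy') :=
    X.subdivision.reflect (X.subdivision.rotate (X.subdivision.rotate
      (subdivision_isSquare_corner hsq)))
  have hs_yz := c.move_mem (X.subdivision.adj at_z) hs
  have hs_y'z := c.move_mem (X.subdivision.adj (X.subdivision.reflect at_z)) hs
  have hs_sq := c.move_mem (X.subdivision.adj (X.subdivision.rotate at_z)) hs_yz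
  rw [c.move_square at_y hs_yz, c.move_square at_x hs_sq, c.move_square at_z hs,
    ← c.move_square at_y' hs_y'z]

/-- The initial point of the lift of an edge path of `X` with final point `s`. -/
def lift (s : S) {o : V} : {x : V} → X.graph.Walk x o → S
  | _, .nil => s
  | x, .cons h p => c.move (vertex X x) (c.move (edge h) (lift s p))

theorem lift_mem {s : S} {o x : V} (hs : s ∈ c.fiber (vertex X o)) (p : X.graph.Walk x o) :
    c.lift s p ∈ c.fiber (vertex X x) := by
  induction p with
  | nil => exact hs
  | cons h p ih =>
    refine c.move_mem (vertex_adj_edge h).symm (c.move_mem ?_ (ih hs))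
    exact (edge_adj_vertex h).symm

theorem lift_eq_of_homotopic {s : S} {o x : V} (hs : s ∈ c.fiber (vertex X o))
    {p q : X.graph.Walk x o} (h : X.Homotopic p q) : c.lift s p = c.lift s q := by
  induction h with
  | refl p => rfl
  | symm _ ih => exact (ih hs).symm
  | trans _ _ ih ih' => exact (ih hs).trans (ih' hs)
  | cons h _ ih => rw [lift, lift, ih hs]
  | backtrack h p =>
    have hp := c.lift_mem hs p
    have hp_edge := c.move_mem (vertex_adj_edge h) hp
    rw [lift, lift, edge_symm h, c.move_move (edge_adj_vertex h) hp_edge,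
      c.move_move (vertex_adj_edge h) hp]
  | square hab hbc had hdc hsq p =>
    exact c.move_around_square hab hbc had hdc hsq (c.lift_mem hs p)

/-- A section over the vertices of `X`, invariant under transport along the edges of `X`. -/
structure IsVertexSection (σ : V → S) : Prop where
  mem : ∀ x, σ x ∈ c.fiber (vertex X x)
  move_edge : ∀ {x y} (h : X.graph.Adj x y),
    c.move (vertex X y) (c.move (edge h) (σ x)) = σ y

theorem exists_isVertexSection (hX : X.IsSimplyConnected) {o : V} {s : S}
    (hs : s ∈ c.fiber (vertex X o)) : ∃ σ, c.IsVertexSection σ ∧ σ o = s := by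
  let p (x : V) : X.graph.Walk x o := (hX.1 x o).some
  refine ⟨fun x => c.lift s (p x), ⟨fun x => c.lift_mem hs _, fun {x y} h => ?_⟩,
    c.lift_eq_of_homotopic hs (homotopic_of_isSimplyConnected hX _ .nil)⟩
  rw [← edge_symm h]
  exact c.lift_eq_of_homotopic hs
    (homotopic_of_isSimplyConnected hX (.cons h.symm (p x)) (p y))

namespace IsVertexSection

variable {c} {σ : V → S}

theorem move_edge_right (hσ : c.IsVertexSection σ) {x y : V} (h : X.graph.Adj x y) :
    c.move (edge h) (σ y) = c.move (edge h) (σ x) := by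
  rw [← hσ.move_edge h, c.move_move (edge_adj_vertex h)
    (c.move_mem (vertex_adj_edge h) (hσ.mem x))]

theorem move_square_rotate (hσ : c.IsVertexSection σ) {x y z y' : V} (h : X.IsSquare x y z y') :
    c.move (square h) (c.move (edge (X.adj (X.rotate h))) (σ y)) =
      c.move (square h) (c.move (edge (X.adj h)) (σ x)) := by
  have hcorner := c.move_square (subdivision_isSquare_corner (X.rotate h)) (hσ.mem y)
  rw [square_rotate] at hcorner
  rw [hcorner, edge_symm (X.adj h), hσ.move_edge_right]

theorem move_square_eq (hσ : c.IsVertexSection σ) {x y z y' x₁ y₁ z₁ y₁' : V}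
    {h : X.IsSquare x y z y'} {h₁ : X.IsSquare x₁ y₁ z₁ y₁'} (e : square h = square h₁) :
    c.move (square h) (c.move (edge (X.adj h₁)) (σ x₁)) =
      c.move (square h) (c.move (edge (X.adj h)) (σ x)) := by
  have same_vertex : ∀ {y z y'} (h : X.IsSquare x₁ y z y'), square h = square h₁ →
      c.move (square h) (c.move (edge (X.adj h₁)) (σ x₁)) =
        c.move (square h) (c.move (edge (X.adj h)) (σ x₁)) := by
    intro y z y' h e
    have hy₁ : y₁ ∈ (square h).1 := by rw [e]; simp [square]
    rcases eq_or_eq_of_adj h (X.adj h₁) hy₁ with rfl | rfl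
    · rfl
    · exact (c.move_square (subdivision_isSquare_corner h) (hσ.mem x₁)).symm
  have e₁ := square_rotate h
  have e₂ := square_rotate (X.rotate h)
  have e₃ := square_rotate (X.rotate (X.rotate h))
  have hx₁ : x₁ ∈ (square h).1 := by rw [e]; simp [square]
  rcases hx₁ with rfl | rfl | rfl | rfl
  · exact same_vertex h e
  · rw [← hσ.move_square_rotate h, ← e₁]
    exact same_vertex _ (e₁.trans e)
  · rw [← hσ.move_square_rotate h, ← e₁, ← hσ.move_square_rotate (X.rotate h), ← e₂]
    exact same_vertex _ (e₂.trans (e₁.trans e))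
  · rw [← hσ.move_square_rotate h, ← e₁, ← hσ.move_square_rotate (X.rotate h), ← e₂,
      ← hσ.move_square_rotate (X.rotate (X.rotate h)), ← e₃]
    exact same_vertex _ (e₃.trans (e₂.trans (e₁.trans e)))

theorem exists_extension (hσ : c.IsVertexSection σ) : ∃ τ : X.Cube → S,
    (∀ x, τ (vertex X x) = σ x) ∧
    (∀ {x y} (h : X.graph.Adj x y), τ (edge h) = c.move (edge h) (σ x)) ∧
    ∀ {x y z y'} (h : X.IsSquare x y z y'),
      τ (square h) = c.move (square h) (c.move (edge (X.adj h)) (σ x)) := by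
  have hvalue : ∀ C : X.Cube, ∃ t, (∀ x, C = vertex X x → t = σ x) ∧
      (∀ x y (h : X.graph.Adj x y), C = edge h → t = c.move C (σ x)) ∧
      ∀ x y z y' (h : X.IsSquare x y z y'), C = square h →
        t = c.move C (c.move (edge (X.adj h)) (σ x)) := by
    intro C
    rcases C.eq_vertex_or_edge_or_square with ⟨x, rfl⟩ | ⟨x, y, h, rfl⟩ | ⟨x, y, z, y', h, rfl⟩
    · exact ⟨σ x, fun x₁ e => by rw [vertex_inj e], fun _ _ _ e => by simpa using congrArg dim e,
        fun _ _ _ _ _ e => by simpa using congrArg dim e⟩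
    · refine ⟨c.move (edge h) (σ x), fun _ e => by simpa using congrArg dim e,
        fun x₁ y₁ h₁ e => ?_, fun _ _ _ _ _ e => by simpa using congrArg dim e⟩
      have hx₁ : x₁ ∈ (edge h).1 := by rw [e]; simp [edge]
      rcases hx₁ with rfl | rfl
      · rfl
      · exact (hσ.move_edge_right h).symm
    · exact ⟨c.move (square h) (c.move (edge (X.adj h)) (σ x)),
        fun _ e => by simpa using congrArg dim e, fun _ _ _ e => by simpa using congrArg dim e,
        fun _ _ _ _ _ e => (hσ.move_square_eq e).symm⟩
  choose τ hvertex hedge hsquare using hvalue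
  exact ⟨τ, fun x => hvertex _ x rfl, fun h => hedge _ _ _ h rfl,
    fun h => hsquare _ _ _ _ _ h rfl⟩

end IsVertexSection

theorem exists_section_of_vertex (hX : X.IsSimplyConnected) {o : V} {s : S}
    (hs : s ∈ c.fiber (vertex X o)) : ∃ τ : X.Cube → S, τ (vertex X o) = s ∧
      ∀ {C D}, X.subdivision.graph.Adj C D → c.move D (τ C) = τ D := by
  obtain ⟨σ, hσ, rfl⟩ := c.exists_isVertexSection hX hs
  obtain ⟨τ, hvertex, hedge, hsquare⟩ := hσ.exists_extension
  refine ⟨τ, hvertex o, ?_⟩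
  rintro C D ((⟨x, y, h, rfl, rfl⟩ | ⟨x, y, z, y', h, rfl, rfl⟩) |
    (⟨x, y, h, rfl, rfl⟩ | ⟨x, y, z, y', h, rfl, rfl⟩))
  · rw [hvertex, hedge]
  · rw [hedge, hsquare]
  · rw [hvertex, hedge, c.move_move (vertex_adj_edge h) (hσ.mem x)]
  · rw [hedge, hsquare, c.move_move (edge_adj_square h)
      (c.move_mem (vertex_adj_edge (X.adj h)) (hσ.mem x))]

theorem exists_section (hX : X.IsSimplyConnected) {O : X.Cube} {s : S} (hs : s ∈ c.fiber O) :
    ∃ τ : X.Cube → S, τ O = s ∧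
      ∀ {C D}, X.subdivision.graph.Adj C D → c.move D (τ C) = τ D := by
  have section_of_adj : ∀ {O O' : X.Cube} {s : S}, X.subdivision.graph.Adj O O' → s ∈ c.fiber O →
      (∃ τ : X.Cube → S, τ O' = c.move O' s ∧
        ∀ {C D}, X.subdivision.graph.Adj C D → c.move D (τ C) = τ D) →
      ∃ τ : X.Cube → S, τ O = s ∧
        ∀ {C D}, X.subdivision.graph.Adj C D → c.move D (τ C) = τ D := by
    rintro O O' s hO hs ⟨τ, hτ, hmove⟩
    exact ⟨τ, by rw [← hmove hO.symm, hτ, c.move_move hO hs], hmove⟩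
  have section_of_edge : ∀ {x y : V} (h : X.graph.Adj x y) {s : S}, s ∈ c.fiber (edge h) →
      ∃ τ : X.Cube → S, τ (edge h) = s ∧
        ∀ {C D}, X.subdivision.graph.Adj C D → c.move D (τ C) = τ D := fun h _ hs =>
    section_of_adj (edge_adj_vertex h) hs
      (c.exists_section_of_vertex hX (c.move_mem (edge_adj_vertex h) hs))
  rcases O.eq_vertex_or_edge_or_square with ⟨x, rfl⟩ | ⟨x, y, h, rfl⟩ | ⟨x, y, z, y', h, rfl⟩
  · exact c.exists_section_of_vertex hX hs
  · exact section_of_edge h hs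
  · exact section_of_adj (edge_adj_square h).symm hs
      (section_of_edge (X.adj h) (c.move_mem (edge_adj_square h).symm hs))

end Covering

/-- Equivalence of edge paths under replacements across squares, as a setoid. -/
def swapSetoid (X : SquareComplex V) : Setoid (List V) where
  r := X.SwapEq
  iseqv := ⟨SwapEq.refl, SwapEq.symm, SwapEq.trans⟩

/-- The universal covering of a nonpositively curved complex: the points over `a` are the classes
of reduced edge paths that start at `a`. -/
noncomputable def reducedPathCovering (hX : X.IsNonpositivelyCurved) :
    Covering X (Quotient X.swapSetoid) where
  fiber a := {s | ∃ l, X.Reduced (a :: l) ∧ s = ⟦a :: l⟧}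
  move w := Quotient.map (X.prepend w) fun _ _ h => prepend_congr hX h
  move_mem := by
    rintro a b _ - ⟨l, hl, rfl⟩
    obtain ⟨l', hl'⟩ := prepend_exists_cons (X := X) b (a :: l)
    exact ⟨l', hl' ▸ hl.prepend hX, congrArg _ hl'⟩
  move_move := by
    rintro a b _ - ⟨l, hl, rfl⟩
    exact Quotient.sound (prepend_backtrack hX hl)
  move_square := by
    rintro a b c d _ hsq ⟨l, -, rfl⟩
    exact Quotient.sound (prepend_square hX hsq)

theorem subdivision_uniqueNormalForms (hX : X.IsCAT0) : X.subdivision.UniqueNormalForms := by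
  intro O C l l' hl hl'
  let c := reducedPathCovering (subdivision_isNonpositivelyCurved hX.2)
  obtain ⟨τ, hO, hτ⟩ := c.exists_section hX.1 (O := O) (s := ⟦[O]⟧) ⟨[], reduced_singleton O, rfl⟩
  have hnormal : ∀ {l C}, X.subdivision.IsPath O (C :: l) →
      (⟦X.subdivision.normalForm (C :: l)⟧ : Quotient X.subdivision.swapSetoid) = τ C := by
    intro l
    induction l with
    | nil => rintro C ⟨⟩; exact hO.symm
    | cons D l ih =>
      rintro C (_ | ⟨hCD, hl⟩)
      rw [← hτ hCD.symm, ← ih hl]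
      rfl
  exact Quotient.exact ((hnormal hl).trans (hnormal hl').symm)

theorem subdivision_reachable_vertex {x y : V} (h : X.graph.Reachable x y) :
    X.subdivision.graph.Reachable (vertex X x) (vertex X y) := by
  obtain ⟨p⟩ := h
  induction p with
  | nil => exact .refl _
  | cons h _ ih =>
    exact (vertex_adj_edge h).reachable.trans ((edge_adj_vertex h).reachable.trans ih)

theorem subdivision_connected (hX : X.graph.Connected) : X.subdivision.graph.Connected := by
  have reachable_vertex : ∀ C : X.Cube, ∃ x, X.subdivision.graph.Reachable C (vertex X x) := by
    intro C
    rcases C.eq_vertex_or_edge_or_square with ⟨x, rfl⟩ | ⟨x, y, h, rfl⟩ | ⟨x, y, z, y', h, rfl⟩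
    · exact ⟨x, .refl _⟩
    · exact ⟨y, (edge_adj_vertex h).reachable⟩
    · exact ⟨y, (edge_adj_square h).symm.reachable.trans (edge_adj_vertex _).reachable⟩
  refine (SimpleGraph.connected_iff _).2 ⟨fun C D => ?_, hX.nonempty.map (vertex X)⟩
  obtain ⟨x, hx⟩ := reachable_vertex C
  obtain ⟨y, hy⟩ := reachable_vertex D
  exact hx.trans ((subdivision_reachable_vertex (hX x y)).trans hy.symm)

/-- The geometric properties of the cubical subdivision of a CAT(0) square complex, in terms of
the metric of its graph; the height `ht` stands for the dimension of cubes. -/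
structure IsGradedCAT0 (X : SquareComplex V) (ht : V → ℤ) : Prop where
  connected : X.graph.Connected
  npc : X.IsNonpositivelyCurved
  quadrangle : ∀ {o x y y' : V}, X.graph.Adj x y → X.graph.Adj x y' → y ≠ y' →
    X.graph.dist o y + 1 = X.graph.dist o x → X.graph.dist o y' + 1 = X.graph.dist o x →
    ∃ z, X.IsSquare x y z y' ∧ X.graph.dist o z + 2 = X.graph.dist o x
  ht_adj : ∀ {a b : V}, X.graph.Adj a b → ht b = ht a + 1 ∨ ht a = ht b + 1
  ht_square : ∀ {a b c d : V}, X.IsSquare a b c d → ht a + ht c = ht b + ht d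

theorem IsCAT0.subdivision (hX : X.IsCAT0) : IsGradedCAT0 X.subdivision Cube.dim where
  connected := subdivision_connected hX.1.1
  npc := subdivision_isNonpositivelyCurved hX.2
  quadrangle := SquareComplex.quadrangle (subdivision_isNonpositivelyCurved hX.2)
    (subdivision_connected hX.1.1) (subdivision_uniqueNormalForms hX)
  ht_adj := by
    rintro a b (h | h)
    · exact Or.inl h.dim_eq
    · exact Or.inr h.dim_eq
  ht_square := by
    rintro a b c d (h | h | h | h) <;> have := h.dims <;> omega

instance : MulAction X.aut X.Cube where
  smul σ C := ⟨(σ : Equiv.Perm V) '' C.1, by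
    obtain ⟨σ, hσ⟩ := σ
    obtain ⟨S, ⟨a, rfl⟩ | ⟨a, b, h, rfl⟩ | ⟨a, b, c, d, h, rfl⟩⟩ := C
    · exact Or.inl ⟨σ a, by simp⟩
    · exact Or.inr (Or.inl ⟨σ a, σ b, (hσ.1 a b).2 h, by simp [Set.image_pair]⟩)
    · exact Or.inr (Or.inr ⟨σ a, σ b, σ c, σ d, (hσ.2 a b c d).2 h, by
        simp [Set.image_insert_eq]⟩)⟩
  one_smul C := Subtype.ext (by
    change ((1 : Equiv.Perm V) : V → V) '' C.1 = C.1
    simp)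
  mul_smul σ τ C := Subtype.ext (by
    change ((σ * τ : Equiv.Perm V) : V → V) '' C.1 =
      (σ : Equiv.Perm V) '' ((τ : Equiv.Perm V) '' C.1)
    rw [Set.image_image]
    rfl)

theorem smul_cube_val (σ : X.aut) (C : X.Cube) : (σ • C).1 = (σ : Equiv.Perm V) '' C.1 := rfl

theorem smul_vertex (σ : X.aut) (a : V) : σ • vertex X a = vertex X ((σ : Equiv.Perm V) a) :=
  Subtype.ext (Set.image_singleton)

theorem smul_edge (σ : X.aut) {a b : V} (h : X.graph.Adj a b) :
    σ • edge h = edge ((σ.2.1 a b).2 h) :=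
  Subtype.ext (Set.image_pair _ _ _)

theorem smul_square (σ : X.aut) {a b c d : V} (h : X.IsSquare a b c d) :
    σ • square h = square ((σ.2.2 a b c d).2 h) :=
  Subtype.ext (by rw [smul_cube_val]; simp only [square, Set.image_insert_eq, Set.image_singleton])

theorem dim_smul (σ : X.aut) (C : X.Cube) : (σ • C).dim = C.dim := by
  simp only [dim, smul_cube_val]
  rw [Set.ncard_image_of_injective _ (Equiv.injective _)]

theorem Cube.IsFacet.smul (σ : X.aut) {C D : X.Cube} (h : IsFacet C D) :
    IsFacet (σ • C) (σ • D) := by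
  rcases h with ⟨x, y, h, rfl, rfl⟩ | ⟨x, y, z, y', h, rfl, rfl⟩
  · exact Or.inl ⟨_, _, _, smul_vertex σ x, smul_edge σ h⟩
  · exact Or.inr ⟨_, _, _, _, (σ.2.2 _ _ _ _).2 h, smul_edge σ _, smul_square σ h⟩

theorem Cube.Corner.smul (σ : X.aut) {A B C D : X.Cube} (h : Corner A B C D) :
    Corner (σ • A) (σ • B) (σ • C) (σ • D) := by
  obtain ⟨x, y, z, y', h, rfl, rfl, rfl, rfl⟩ := h
  exact ⟨_, _, _, _, (σ.2.2 _ _ _ _).2 h, smul_vertex σ x, smul_edge σ _, smul_square σ h,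
    smul_edge σ _⟩

theorem subdivision_adj_smul (σ : X.aut) {C D : X.Cube} (h : X.subdivision.graph.Adj C D) :
    X.subdivision.graph.Adj (σ • C) (σ • D) :=
  h.imp (fun h => h.smul σ) (fun h => h.smul σ)

theorem subdivision_isSquare_smul (σ : X.aut) {A B C D : X.Cube}
    (h : X.subdivision.IsSquare A B C D) :
    X.subdivision.IsSquare (σ • A) (σ • B) (σ • C) (σ • D) := by
  rcases h with h | h | h | h
  · exact Or.inl (h.smul σ)
  · exact Or.inr (Or.inl (h.smul σ))
  · exact Or.inr (Or.inr (Or.inl (h.smul σ)))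
  · exact Or.inr (Or.inr (Or.inr (h.smul σ)))

open Classical in
theorem isPoint_barycenter (C : X.Cube) :
    X.IsPoint fun v => if v ∈ C.1 then (C.1.ncard : ℝ)⁻¹ else 0 := by
  rcases C.eq_vertex_or_edge_or_square with ⟨a, rfl⟩ | ⟨a, b, h, rfl⟩ | ⟨a, b, c, d, h, rfl⟩
  · exact Or.inl ⟨a, by simp [vertex], fun v hv => by simp [vertex, hv]⟩
  · refine Or.inr (Or.inl ⟨a, b, h, 1 / 2, by norm_num, ?_⟩)
    rw [ncard_edge]
    simp +contextual [edge]
    norm_num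
  · refine Or.inr (Or.inr ⟨a, b, c, d, h, 1 / 2, by norm_num, 1 / 2, by norm_num, ?_⟩)
    rw [ncard_square]
    simp +contextual [square]
    norm_num

open Classical in
theorem hasGlobalFixedPoint_of_cube {G : Type v} [Group G] (ρ : G →* X.aut) (C : X.Cube)
    (hC : ∀ g, ρ g • C = C) : X.HasGlobalFixedPoint ρ := by
  refine ⟨⟨_, isPoint_barycenter C⟩, fun g => Subtype.ext (funext fun v => ?_)⟩
  have hmem : (ρ g : Equiv.Perm V)⁻¹ v ∈ C.1 ↔ v ∈ C.1 := by
    conv_rhs => rw [← hC g, smul_cube_val, Equiv.image_eq_preimage_symm]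
    rfl
  change (if (ρ g : Equiv.Perm V)⁻¹ v ∈ C.1 then (C.1.ncard : ℝ)⁻¹ else 0) = _
  simp only [hmem]

end SquareComplex

/-- The number of elements of `Γ` that satisfy `P`, as a real number: counts are compared with
fractions of one another throughout. -/
noncomputable def countIn {A : Type*} (Γ : Finset A) (P : A → Prop) : ℝ :=
  open Classical in ((Γ.filter P).card : ℝ)

section countIn

variable {A : Type*} {Γ : Finset A} {P Q R : A → Prop}

theorem countIn_eq_card_filter [DecidablePred P] : countIn Γ P = ((Γ.filter P).card : ℝ) := by
  rw [countIn]
  congr!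

theorem countIn_eq_sum [DecidablePred P] : countIn Γ P = ∑ c ∈ Γ, if P c then (1 : ℝ) else 0 := by
  rw [countIn_eq_card_filter, Finset.card_filter]
  push_cast
  rfl

theorem countIn_nonneg : 0 ≤ countIn Γ P := Nat.cast_nonneg _

theorem countIn_mono (h : ∀ c ∈ Γ, P c → Q c) : countIn Γ P ≤ countIn Γ Q := by
  classical
  exact Nat.cast_le.2 (Finset.card_le_card fun c hc => by
    simp only [Finset.mem_filter] at hc ⊢
    exact ⟨hc.1, h c hc.1 hc.2⟩)

theorem countIn_le_add (h : ∀ c ∈ Γ, P c → Q c ∨ R c) :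
    countIn Γ P ≤ countIn Γ Q + countIn Γ R := by
  classical
  refine (countIn_mono h).trans ?_
  simp only [countIn_eq_card_filter, Finset.filter_or]
  exact_mod_cast Finset.card_union_le _ _

theorem countIn_or_le : countIn Γ (fun c => P c ∨ Q c) ≤ countIn Γ P + countIn Γ Q :=
  countIn_le_add fun _ _ h => h

theorem exists_of_countIn_lt (h : countIn Γ Q < countIn Γ P) : ∃ c ∈ Γ, P c ∧ ¬ Q c := by
  by_contra! hPQ
  exact h.not_ge (countIn_mono hPQ)

theorem exists_of_countIn_pos (h : 0 < countIn Γ P) : ∃ c ∈ Γ, P c := by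
  classical
  rw [countIn_eq_card_filter, Nat.cast_pos, Finset.card_pos] at h
  exact h.imp fun c hc => Finset.mem_filter.1 hc

theorem sum_inv_eq_sum_of_symmetric {M : Type*} [AddCommMonoid M] [InvolutiveInv A]
    (hΓ : ∀ c ∈ Γ, c⁻¹ ∈ Γ) (f : A → M) : ∑ c ∈ Γ, f c⁻¹ = ∑ c ∈ Γ, f c :=
  Finset.sum_bij' (fun c _ => c⁻¹) (fun c _ => c⁻¹) hΓ hΓ (by simp) (by simp) (by simp)

theorem countIn_inv [InvolutiveInv A] (hΓ : ∀ c ∈ Γ, c⁻¹ ∈ Γ) (P : A → Prop) :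
    countIn Γ (fun c => P c⁻¹) = countIn Γ P := by
  classical
  simp only [countIn_eq_sum]
  exact sum_inv_eq_sum_of_symmetric hΓ fun c => if P c then (1 : ℝ) else 0

end countIn

namespace SquareComplex

variable {V : Type u} {X : SquareComplex V} {ht : V → ℤ}

/-- The vertices closer to `a` than to `b`; a halfspace when `a` and `b` are adjacent. -/
def half (X : SquareComplex V) (a b : V) : Set V := {x | X.graph.dist x a < X.graph.dist x b}

theorem mem_half {a b x : V} : x ∈ X.half a b ↔ X.graph.dist x a < X.graph.dist x b := Iff.rfl

theorem mem_half_comm {a b x : V} : x ∈ X.half a b ↔ X.graph.dist a x < X.graph.dist b x := by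
  rw [mem_half, SimpleGraph.dist_comm, SimpleGraph.dist_comm (v := b)]

theorem isSquare_transpose {a b c d : V} (h : X.IsSquare a b c d) : X.IsSquare d c b a :=
  X.rotate (X.rotate (X.reflect (X.rotate h)))

namespace IsGradedCAT0

theorem even_dist_sub_ht (hX : X.IsGradedCAT0 ht) (o x : V) :
    Even ((X.graph.dist o x : ℤ) - (ht x - ht o)) := by
  obtain ⟨p, hp⟩ := hX.connected.exists_walk_length_eq_dist o x
  rw [← hp, Int.even_iff]
  clear hp
  induction p with
  | nil => simp
  | cons h p ih =>
    rw [SimpleGraph.Walk.length_cons]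
    rcases hX.ht_adj h with h | h <;> omega

theorem dist_eq_add_one_or (hX : X.IsGradedCAT0 ht) {a b : V} (h : X.graph.Adj a b) (x : V) :
    X.graph.dist x b = X.graph.dist x a + 1 ∨ X.graph.dist x a = X.graph.dist x b + 1 := by
  have hdist := h.diff_dist_adj (u := x)
  have ha := Int.even_iff.1 (hX.even_dist_sub_ht x a)
  have hb := Int.even_iff.1 (hX.even_dist_sub_ht x b)
  rcases hX.ht_adj h with h | h <;> omega

theorem dist_eq_add_one_or_left (hX : X.IsGradedCAT0 ht) {a b : V} (h : X.graph.Adj a b) (x : V) :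
    X.graph.dist b x = X.graph.dist a x + 1 ∨ X.graph.dist a x = X.graph.dist b x + 1 := by
  simpa only [SimpleGraph.dist_comm] using hX.dist_eq_add_one_or h x

theorem mem_half_iff (hX : X.IsGradedCAT0 ht) {a b x : V} (h : X.graph.Adj a b) :
    x ∈ X.half a b ↔ X.graph.dist x a + 1 = X.graph.dist x b := by
  have := hX.dist_eq_add_one_or h x
  rw [mem_half]
  omega

theorem mem_half_iff_left (hX : X.IsGradedCAT0 ht) {a b x : V} (h : X.graph.Adj a b) :
    x ∈ X.half a b ↔ X.graph.dist a x + 1 = X.graph.dist b x := by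
  have := hX.dist_eq_add_one_or_left h x
  rw [mem_half_comm]
  omega

theorem notMem_half (hX : X.IsGradedCAT0 ht) {a b : V} (h : X.graph.Adj a b) {x : V} :
    x ∉ X.half a b ↔ x ∈ X.half b a := by
  have := hX.dist_eq_add_one_or h x
  rw [mem_half, mem_half]
  omega

theorem left_mem_half {a b : V} (h : X.graph.Adj a b) : a ∈ X.half a b := by
  rw [mem_half, SimpleGraph.dist_self, SimpleGraph.dist_eq_one_iff_adj.2 h]
  exact one_pos

theorem right_notMem_half {a b : V} : b ∉ X.half a b := by
  rw [mem_half, SimpleGraph.dist_self]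
  exact Nat.not_lt_zero _

theorem half_subset_of_isSquare (hX : X.IsGradedCAT0 ht) {a b c d : V} (h : X.IsSquare a b c d) :
    X.half a b ⊆ X.half d c := by
  intro x hx
  by_contra hx'
  have hba := (X.adj h).symm
  have hbc := X.adj (X.rotate h)
  have hdc := X.adj (isSquare_transpose h)
  rw [hX.notMem_half hdc, hX.mem_half_iff hdc.symm] at hx'
  rw [hX.mem_half_iff hba.symm] at hx
  have had := hX.dist_eq_add_one_or (X.adj (X.reflect h)) x
  have hbc' := hX.dist_eq_add_one_or hbc x
  -- Otherwise `a` and `c` both lie between `b` and `x`, and `abc` spans a second square.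
  obtain ⟨z, hz, hzx⟩ := hX.quadrangle (o := x) hba hbc (X.diag_ne h) (by omega) (by omega)
  have hz' : X.IsSquare a b c z := X.rotate (X.rotate (X.rotate (X.reflect hz)))
  rcases X.diag_unique h hz' with ⟨-, rfl⟩ | hbz
  · omega
  · exact isSquare_ne hz' hbz.1

theorem half_eq_of_isSquare (hX : X.IsGradedCAT0 ht) {a b c d : V} (h : X.IsSquare a b c d) :
    X.half a b = X.half d c :=
  (hX.half_subset_of_isSquare h).antisymm (hX.half_subset_of_isSquare (isSquare_transpose h))

theorem exists_adj_dist_add_one (hX : X.IsGradedCAT0 ht) {x z : V} (h : x ≠ z) :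
    ∃ y, X.graph.Adj x y ∧ X.graph.dist y z + 1 = X.graph.dist x z := by
  obtain ⟨p, hp⟩ := hX.connected.exists_walk_length_eq_dist x z
  cases p with
  | nil => exact absurd rfl h
  | @cons _ y _ hxy p =>
    refine ⟨y, hxy, ?_⟩
    have hyz := SimpleGraph.dist_le p
    have := hX.dist_eq_add_one_or_left hxy z
    rw [SimpleGraph.Walk.length_cons] at hp
    omega

theorem exists_isSquare_of_crossing (hX : X.IsGradedCAT0 ht) {p q a b : V}
    (hpq : X.graph.Adj p q) (hab : X.graph.Adj a b) (ha : a ∈ X.half p q) (hb : b ∉ X.half p q)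
    (hne : a ≠ p) : ∃ a' b', X.IsSquare a b b' a' ∧ a' ∈ X.half p q ∧ b' ∉ X.half p q ∧
      X.graph.dist a' p + 1 = X.graph.dist a p := by
  obtain ⟨a', haa', hdist⟩ := hX.exists_adj_dist_add_one hne
  rw [hX.notMem_half hpq, hX.mem_half_iff hpq.symm] at hb
  rw [hX.mem_half_iff hpq] at ha
  have ha' := hX.dist_eq_add_one_or hpq a'
  have hab_p := hX.dist_eq_add_one_or_left hab p
  have hab_q := hX.dist_eq_add_one_or_left hab q
  have haa'_q := hX.dist_eq_add_one_or_left haa' q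
  obtain ⟨b', hsq, hb'q⟩ := hX.quadrangle (o := q) hab haa' (by rintro rfl; omega)
    (by simp only [X.graph.dist_comm (u := q)]; omega)
    (by simp only [X.graph.dist_comm (u := q)]; omega)
  simp only [X.graph.dist_comm (u := q)] at hb'q
  have hb' := hX.dist_eq_add_one_or hpq b'
  have hbb'_p := hX.dist_eq_add_one_or_left (X.adj (X.rotate hsq)) p
  refine ⟨a', b', hsq, ?_, ?_, hdist⟩
  · rw [hX.mem_half_iff hpq]
    omega
  · rw [hX.notMem_half hpq, hX.mem_half_iff hpq.symm]
    omega

theorem half_eq_and_ht_sub_eq (hX : X.IsGradedCAT0 ht) {p q a b : V} (hpq : X.graph.Adj p q)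
    (hab : X.graph.Adj a b) (ha : a ∈ X.half p q) (hb : b ∉ X.half p q) :
    X.half a b = X.half p q ∧ ht b - ht a = ht q - ht p := by
  induction hn : X.graph.dist a p generalizing a b with
  | zero =>
    obtain rfl := hX.connected.dist_eq_zero_iff.1 hn
    rw [hX.notMem_half hpq, hX.mem_half_iff hpq.symm,
      SimpleGraph.dist_eq_one_iff_adj.2 hab.symm] at hb
    obtain rfl := hX.connected.dist_eq_zero_iff.1 (Nat.succ_injective hb)
    exact ⟨rfl, rfl⟩
  | succ n ih =>
    have hne : a ≠ p := by
      rintro rfl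
      simp at hn
    obtain ⟨a', b', hsq, ha', hb', hdist⟩ := hX.exists_isSquare_of_crossing hpq hab ha hb hne
    obtain ⟨hhalf, hht⟩ := ih (X.adj (isSquare_transpose hsq)) ha' hb' (by omega)
    refine ⟨(hX.half_eq_of_isSquare hsq).trans hhalf, ?_⟩
    have := hX.ht_square hsq
    omega

theorem half_eq_of_crossing (hX : X.IsGradedCAT0 ht) {p q a b : V} (hpq : X.graph.Adj p q)
    (hab : X.graph.Adj a b) (ha : a ∈ X.half p q) (hb : b ∉ X.half p q) :
    X.half a b = X.half p q :=
  (hX.half_eq_and_ht_sub_eq hpq hab ha hb).1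

theorem ht_sub_eq_of_crossing (hX : X.IsGradedCAT0 ht) {p q a b : V} (hpq : X.graph.Adj p q)
    (hab : X.graph.Adj a b) (ha : a ∈ X.half p q) (hb : b ∉ X.half p q) :
    ht b - ht a = ht q - ht p :=
  (hX.half_eq_and_ht_sub_eq hpq hab ha hb).2

theorem exists_crossing_between (hX : X.IsGradedCAT0 ht) {S : Set V} {x z : V} (hx : x ∈ S)
    (hz : z ∉ S) : ∃ a b, X.graph.Adj a b ∧ a ∈ S ∧ b ∉ S ∧
      X.graph.dist x z = X.graph.dist x a + 1 + X.graph.dist b z := by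
  induction hn : X.graph.dist x z generalizing x with
  | zero => exact absurd (hX.connected.dist_eq_zero_iff.1 hn ▸ hx) hz
  | succ n ih =>
    obtain ⟨y, hxy, hdist⟩ := hX.exists_adj_dist_add_one (fun e : x = z => hz (e ▸ hx))
    by_cases hy : y ∈ S
    · obtain ⟨a, b, hab, ha, hb, hsum⟩ := ih hy (by omega)
      refine ⟨a, b, hab, ha, hb, ?_⟩
      have hxya := hX.connected.dist_triangle (u := x) (v := y) (w := a)
      have hxaz := hX.connected.dist_triangle (u := x) (v := a) (w := z)
      have habz := hX.connected.dist_triangle (u := a) (v := b) (w := z)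
      rw [SimpleGraph.dist_eq_one_iff_adj.2 hab] at habz
      rw [SimpleGraph.dist_eq_one_iff_adj.2 hxy] at hxya
      omega
    · exact ⟨x, y, hxy, hx, hy, by rw [SimpleGraph.dist_self]; omega⟩

theorem half_convex (hX : X.IsGradedCAT0 ht) {p q x y z : V} (hpq : X.graph.Adj p q)
    (hx : x ∈ X.half p q) (hy : y ∈ X.half p q)
    (hz : X.graph.dist x z + X.graph.dist z y = X.graph.dist x y) : z ∈ X.half p q := by
  by_contra hz'
  obtain ⟨a, b, hab, ha, hb, hsum⟩ := hX.exists_crossing_between hx hz'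
  rw [← hX.half_eq_of_crossing hpq hab ha hb, mem_half_comm] at hy
  have hbzy := hX.connected.dist_triangle (u := b) (v := z) (w := y)
  have hxay := hX.connected.dist_triangle (u := x) (v := a) (w := y)
  omega

theorem exists_adj_toward_both (hX : X.IsGradedCAT0 ht) {v u x : V}
    (h : X.graph.dist x u < X.graph.dist x v + X.graph.dist v u) :
    ∃ p, X.graph.Adj v p ∧ X.graph.dist p u + 1 = X.graph.dist v u ∧
      X.graph.dist x p + 1 = X.graph.dist x v := by
  induction hn : X.graph.dist v u generalizing v with
  | zero =>
    obtain rfl := hX.connected.dist_eq_zero_iff.1 hn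
    omega
  | succ n ih =>
    obtain ⟨y, hvy, hyu⟩ := hX.exists_adj_dist_add_one (x := v) (z := u) (by rintro rfl; simp at hn)
    rcases hX.dist_eq_add_one_or hvy x with hxy | hxy
    · obtain ⟨p, hyp, hpu, hxp⟩ := ih (v := y) (by omega) (by omega)
      obtain ⟨z, hsq, hxz⟩ := hX.quadrangle (o := x) hvy.symm hyp (by rintro rfl; omega)
        (by omega) (by omega)
      have hvz : X.graph.Adj v z := X.adj (X.rotate hsq)
      have hzpu := (X.adj (X.rotate (X.rotate hsq))).diff_dist_adj (u := u)
      have hvzu := hX.dist_eq_add_one_or hvz u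
      simp only [X.graph.dist_comm (u := u)] at hzpu hvzu
      exact ⟨z, hvz, by omega, by omega⟩
    · exact ⟨y, hvy, by omega, hxy.symm⟩

theorem exists_median (hX : X.IsGradedCAT0 ht) (v u x : V) :
    ∃ m, X.graph.dist v m + X.graph.dist m u = X.graph.dist v u ∧
      X.graph.dist x m + X.graph.dist m v = X.graph.dist x v ∧
      X.graph.dist x m + X.graph.dist m u = X.graph.dist x u := by
  induction hn : X.graph.dist v u generalizing v with
  | zero =>
    obtain rfl := hX.connected.dist_eq_zero_iff.1 hn
    exact ⟨v, by simp⟩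
  | succ n ih =>
    by_cases h : X.graph.dist x u < X.graph.dist x v + X.graph.dist v u
    · obtain ⟨p, hvp, hpu, hxp⟩ := hX.exists_adj_toward_both h
      obtain ⟨m, hpmu, hxmp, hxmu⟩ := ih p (by omega)
      have hvpm := hX.connected.dist_triangle (u := v) (v := p) (w := m)
      have hvmu := hX.connected.dist_triangle (u := v) (v := m) (w := u)
      have hxmv := hX.connected.dist_triangle (u := x) (v := m) (w := v)
      rw [SimpleGraph.dist_eq_one_iff_adj.2 hvp] at hvpm
      rw [X.graph.dist_comm (u := m)] at hxmp hxmv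
      exact ⟨m, by omega, by rw [X.graph.dist_comm (u := m)]; omega, hxmu⟩
    · have := hX.connected.dist_triangle (u := x) (v := v) (w := u)
      exact ⟨v, by simp [hn], by simp, by omega⟩

theorem exists_adj_half_subset (hX : X.IsGradedCAT0 ht) {p q v : V} (hpq : X.graph.Adj p q)
    (hv : v ∉ X.half p q) : ∃ a, X.graph.Adj v a ∧ X.half p q ⊆ X.half a v := by
  obtain ⟨u, hu, hmin⟩ : ∃ u ∈ X.half p q, ∀ w ∈ X.half p q,
      X.graph.dist v u ≤ X.graph.dist v w := by
    have hne : (X.half p q).Nonempty := ⟨p, left_mem_half hpq⟩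
    exact ⟨_, Function.argminOn_mem (X.graph.dist v) _ hne,
      fun w hw => Function.argminOn_le (X.graph.dist v) _ hw⟩
  obtain ⟨a, hva, hau⟩ := hX.exists_adj_dist_add_one (fun e : v = u => hv (e ▸ hu))
  refine ⟨a, hva, fun x hx => ?_⟩
  by_contra hxa
  rw [hX.notMem_half hva.symm, hX.mem_half_iff_left hva] at hxa
  -- By convexity the median of `v`, `u` and `x` is a point of the halfspace, hence equal to `u`.
  obtain ⟨m, hvmu, hxmv, hxmu⟩ := hX.exists_median v u x
  have hvm := hmin m (hX.half_convex hpq hx hu hxmu)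
  obtain rfl : m = u := hX.connected.dist_eq_zero_iff.1 (by omega)
  have hamx := hX.connected.dist_triangle (u := a) (v := m) (w := x)
  simp only [X.graph.dist_comm (u := x), X.graph.dist_comm (u := m) (v := v)] at hxmv
  omega

theorem exists_isSquare_of_mem_half (hX : X.IsGradedCAT0 ht) {v a b x : V}
    (ha : X.graph.Adj v a) (hb : X.graph.Adj v b) (hne : a ≠ b) (hxa : x ∈ X.half a v)
    (hxb : x ∈ X.half b v) :
    ∃ w, X.IsSquare v a w b ∧ X.graph.dist x w + 2 = X.graph.dist x v :=
  hX.quadrangle ha hb hne ((hX.mem_half_iff ha.symm).1 hxa) ((hX.mem_half_iff hb.symm).1 hxb)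

theorem eq_of_half_subset (hX : X.IsGradedCAT0 ht) {v a b : V} (ha : X.graph.Adj v a)
    (h : X.half a v ⊆ X.half b v) : a = b := by
  have hab := h (left_mem_half ha.symm)
  rw [mem_half, SimpleGraph.dist_eq_one_iff_adj.2 ha.symm] at hab
  exact hX.connected.dist_eq_zero_iff.1 (Nat.lt_one_iff.1 hab)

end IsGradedCAT0

end SquareComplex

namespace SquareComplex

variable {V : Type u} {X : SquareComplex V} {ht : V → ℤ}

/-- An action of `A` by automorphisms of a graded CAT(0) square complex that preserve the height
function. -/
structure IsGradedAction (X : SquareComplex V) (ht : V → ℤ) (A : Type v) [Group A]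
    [MulAction A V] : Prop where
  cat0 : X.IsGradedCAT0 ht
  adj_smul : ∀ (g : A) {a b : V}, X.graph.Adj a b → X.graph.Adj (g • a) (g • b)
  square_smul : ∀ (g : A) {a b c d : V}, X.IsSquare a b c d →
    X.IsSquare (g • a) (g • b) (g • c) (g • d)
  ht_smul : ∀ (g : A) (a : V), ht (g • a) = ht a

/-- Adjacency in the link of `v`: the neighbors `a` and `b` of `v` span a square with `v`. -/
def LinkAdj (X : SquareComplex V) (v a b : V) : Prop := ∃ w, X.IsSquare v a w b

theorem LinkAdj.symm {v a b : V} (h : X.LinkAdj v a b) : X.LinkAdj v b a :=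
  h.imp fun _ h => X.reflect h

theorem LinkAdj.ne {v a b : V} : X.LinkAdj v a b → a ≠ b
  | ⟨_, h⟩ => isSquare_ne h

theorem LinkAdj.adj {v a b : V} : X.LinkAdj v a b → X.graph.Adj v a
  | ⟨_, h⟩ => X.adj h

theorem LinkAdj.not_triangle (hX : X.IsGradedCAT0 ht) {v a b c : V} (hab : X.LinkAdj v a b)
    (hbc : X.LinkAdj v b c) (hac : X.LinkAdj v a c) : False :=
  let ⟨_, hab⟩ := hab
  let ⟨_, hbc⟩ := hbc
  let ⟨_, hac⟩ := hac
  hX.npc.not_three_squares hab hbc hac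

theorem linkAdj_of_mem_half (hX : X.IsGradedCAT0 ht) {v a b x : V} (ha : X.graph.Adj v a)
    (hb : X.graph.Adj v b) (hne : a ≠ b) (hxa : x ∈ X.half a v) (hxb : x ∈ X.half b v) :
    X.LinkAdj v a b :=
  let ⟨w, hw, _⟩ := hX.exists_isSquare_of_mem_half ha hb hne hxa hxb
  ⟨w, hw⟩

section Letters

variable {A : Type v} [Group A] [MulAction A V] {v a b : V} {c : A}

/-- `a` is the first vertex of a geodesic from `v` to `c • v`: the halfspace of `a` separates `v`
from `c • v`. -/
def IsDirection (X : SquareComplex V) (v : V) (c : A) (a : V) : Prop :=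
  X.graph.Adj v a ∧ c • v ∈ X.half a v

/-- The letter `c` resets the state `a`, which stands for the halfspace of `a` at `v`: the pullback
of this halfspace by `c` lies in a halfspace at `v` that contains `c⁻¹ • v`. -/
def Resets (X : SquareComplex V) (v a : V) (c : A) : Prop :=
  ∃ b, X.IsDirection v c⁻¹ b ∧ ∀ x, c • x ∈ X.half a v → x ∈ X.half b v

/-- The letter `c` passes from the state `a` to the state `b`: the pullback by `c` of the halfspace
of `a` at `v` is the halfspace of `b` at `v`. -/
def Passes (X : SquareComplex V) (v a : V) (c : A) (b : V) : Prop :=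
  X.graph.Adj v b ∧ ∀ x, x ∈ X.half b v ↔ c • x ∈ X.half a v

theorem IsDirection.eq_or_linkAdj (hX : X.IsGradedCAT0 ht) (ha : X.IsDirection v c a)
    (hb : X.IsDirection v c b) : a = b ∨ X.LinkAdj v a b :=
  or_iff_not_imp_left.2 fun hne => linkAdj_of_mem_half hX ha.1 hb.1 hne ha.2 hb.2

theorem IsDirection.smul_ne (h : X.IsDirection v c a) : c • v ≠ v := fun hcv =>
  IsGradedCAT0.right_notMem_half (hcv ▸ h.2)

theorem IsGradedCAT0.exists_isDirection (hX : X.IsGradedCAT0 ht) (h : c • v ≠ v) :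
    ∃ a, X.IsDirection v c a := by
  obtain ⟨a, hva, hdist⟩ := hX.exists_adj_dist_add_one h.symm
  exact ⟨a, hva, (hX.mem_half_iff_left hva.symm).2 hdist⟩

theorem Passes.not_isDirection (h : X.Passes v a c b) : ¬ X.IsDirection v c a := fun ha =>
  IsGradedCAT0.right_notMem_half ((h.2 v).2 ha.2)

theorem Passes.inv (h : X.Passes v a c b) (ha : X.graph.Adj v a) : X.Passes v b c⁻¹ a :=
  ⟨ha, fun x => by rw [h.2, smul_inv_smul]⟩

theorem Passes.unique (hX : X.IsGradedCAT0 ht) {b' : V} (h : X.Passes v a c b)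
    (h' : X.Passes v a c b') : b = b' :=
  hX.eq_of_half_subset h.1 fun x hx => (h'.2 x).2 ((h.2 x).1 hx)

end Letters

namespace IsGradedAction

variable {A : Type v} [Group A] [MulAction A V] {v a b : V} {c : A}

theorem dist_smul (hA : X.IsGradedAction ht A) (g : A) (a b : V) :
    X.graph.dist (g • a) (g • b) = X.graph.dist a b := by
  have dist_smul_le (g : A) (a b : V) : X.graph.dist (g • a) (g • b) ≤ X.graph.dist a b := by
    obtain ⟨p, hp⟩ := hA.cat0.connected.exists_walk_length_eq_dist a b
    let f : X.graph →g X.graph := ⟨fun x => g • x, fun h => hA.adj_smul g h⟩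
    rw [← hp, ← SimpleGraph.Walk.length_map f p]
    exact SimpleGraph.dist_le _
  refine (dist_smul_le g a b).antisymm ?_
  simpa only [inv_smul_smul] using dist_smul_le g⁻¹ (g • a) (g • b)

theorem dist_smul_left (hA : X.IsGradedAction ht A) (g : A) (a b : V) :
    X.graph.dist (g • a) b = X.graph.dist a (g⁻¹ • b) := by
  rw [← hA.dist_smul g a, smul_inv_smul]

theorem smul_mem_half_iff (hA : X.IsGradedAction ht A) (g : A) {a b x : V} :
    g • x ∈ X.half a b ↔ x ∈ X.half (g⁻¹ • a) (g⁻¹ • b) := by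
  simp only [mem_half, hA.dist_smul_left]

theorem linkAdj_smul (hA : X.IsGradedAction ht A) (hv : c • v = v) :
    X.LinkAdj v a b → X.LinkAdj v (c • a) (c • b)
  | ⟨w, hw⟩ => ⟨c • w, by simpa only [hv] using hA.square_smul c hw⟩

theorem passes_of_smul_eq (hA : X.IsGradedAction ht A) (ha : X.graph.Adj v a) (hv : c • v = v) :
    X.Passes v a c (c⁻¹ • a) := by
  have hv' : c⁻¹ • v = v := inv_smul_eq_iff.2 hv.symm
  refine ⟨?_, fun x => ?_⟩
  · simpa only [hv'] using hA.adj_smul c⁻¹ ha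
  · rw [hA.smul_mem_half_iff, hv']

theorem exists_passes_of_not_resets (hA : X.IsGradedAction ht A) (ha : X.graph.Adj v a)
    (hc : ¬ X.IsDirection v c a) (hr : ¬ X.Resets v a c) :
    ∃ b, X.Passes v a c b ∧ ∀ p, X.IsDirection v c⁻¹ p → X.LinkAdj v p b := by
  have hX := hA.cat0
  have ha' : X.graph.Adj (c⁻¹ • a) (c⁻¹ • v) := hA.adj_smul _ ha.symm
  have mem_pullback (x : V) : c • x ∈ X.half a v ↔ x ∈ X.half (c⁻¹ • a) (c⁻¹ • v) :=
    hA.smul_mem_half_iff c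
  obtain ⟨b, hb, hsub⟩ := hX.exists_adj_half_subset (v := v) ha'
    fun h => hc ⟨ha, (mem_pullback v).2 h⟩
  have hcv : c⁻¹ • v ∉ X.half b v := fun h =>
    hr ⟨b, ⟨hb, h⟩, fun x hx => hsub ((mem_pullback x).1 hx)⟩
  have hcab := hsub (IsGradedCAT0.left_mem_half ha')
  have hhalf := hX.half_eq_of_crossing hb.symm ha' hcab hcv
  refine ⟨b, ⟨hb, fun x => by rw [mem_pullback, hhalf]⟩, fun p hp => ?_⟩
  have hne : p ≠ b := fun h => hcv (h ▸ hp.2)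
  refine linkAdj_of_mem_half hX hp.1 hb hne ?_ hcab
  -- If `c⁻¹ • a` were not in the halfspace of `p`, its hyperplane would also be that of `b`.
  by_contra hcap
  have hhalf' := hX.half_eq_of_crossing hp.1.symm ha'.symm hp.2 hcap
  have hv : v ∈ X.half b v := by
    rw [← hhalf, ← hX.notMem_half ha'.symm, hhalf']
    exact IsGradedCAT0.right_notMem_half
  exact IsGradedCAT0.right_notMem_half hv

theorem linkAdj_of_not_resets (hA : X.IsGradedAction ht A) (ha : X.graph.Adj v a) {p : V}
    (hc : ¬ X.IsDirection v c a) (hr : ¬ X.Resets v a c) (hp : X.IsDirection v c p) :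
    X.LinkAdj v p a := by
  have hX := hA.cat0
  by_contra hlink
  have hne : p ≠ a := fun h => hc (h ▸ hp)
  have hdisj (x : V) (hxa : x ∈ X.half a v) : x ∈ X.half v p :=
    (hX.notMem_half hp.1.symm).1 fun hxp => hlink (linkAdj_of_mem_half hX hp.1 ha hne hxp hxa)
  have hp' : X.graph.Adj (c⁻¹ • v) (c⁻¹ • p) := hA.adj_smul _ hp.1
  have mem_pullback (x : V) : c • x ∈ X.half v p ↔ x ∈ X.half (c⁻¹ • v) (c⁻¹ • p) :=
    hA.smul_mem_half_iff c
  obtain ⟨b, hb, hsub⟩ := hX.exists_adj_half_subset (v := v) hp' <| by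
    rw [← mem_pullback, hX.notMem_half hp.1]
    exact hp.2
  exact hr ⟨b, ⟨hb, hsub (IsGradedCAT0.left_mem_half hp')⟩,
    fun x hx => hsub ((mem_pullback x).1 (hdisj _ hx))⟩

theorem eq_or_linkAdj_of_not_resets (hA : X.IsGradedAction ht A) (ha : X.graph.Adj v a)
    (hr : ¬ X.Resets v a c) (hb : X.IsDirection v c b) : b = a ∨ X.LinkAdj v b a := by
  by_cases hc : X.IsDirection v c a
  · exact hb.eq_or_linkAdj hA.cat0 hc
  · exact Or.inr (hA.linkAdj_of_not_resets ha hc hr hb)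

theorem eq_or_eq_of_not_resets (hA : X.IsGradedAction ht A) {p : V} (hab : X.LinkAdj v a b)
    (ha : ¬ X.Resets v a c) (hb : ¬ X.Resets v b c) (hp : X.IsDirection v c p) :
    p = a ∨ p = b := by
  rcases hA.eq_or_linkAdj_of_not_resets hab.adj ha hp with hpa | hpa
  · exact Or.inl hpa
  rcases hA.eq_or_linkAdj_of_not_resets hab.symm.adj hb hp with hpb | hpb
  · exact Or.inr hpb
  exact (LinkAdj.not_triangle hA.cat0 hpa hab hpb).elim

end IsGradedAction

end SquareComplex

namespace SquareComplex

variable {V : Type u} {X : SquareComplex V} {ht : V → ℤ} {A : Type v} [Group A] [MulAction A V]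

/-- The letter `c` passes from the state `a` to a state outside `T`. -/
def Escapes (X : SquareComplex V) (v : V) (T : V → Prop) (a : V) (c : A) : Prop :=
  ∃ b, X.Passes v a c b ∧ ¬ T b

theorem of_not_escapes {v a b : V} {T : V → Prop} {c : A} (h : ¬ X.Escapes v T a c)
    (hb : X.Passes v a c b) : T b :=
  by_contra fun hT => h ⟨b, hb, hT⟩

/-- Traps of level `i`: states that fewer than `e` letters of `Γ` reset and that, if `i` is
positive, fewer than `e` letters leave for a state that is not a trap of level `i - 1`. States that
are not traps can be used to build an automaton. -/
def IsTrap (X : SquareComplex V) (v : V) (Γ : Finset A) (e : ℝ) : ℕ → V → Prop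
  | 0, a => X.graph.Adj v a ∧ countIn Γ (X.Resets v a) < e
  | i + 1, a => (X.graph.Adj v a ∧ countIn Γ (X.Resets v a) < e) ∧
      countIn Γ (X.Escapes v (fun b => IsTrap X v Γ e i b) a) < e

section IsTrap

variable {v a : V} {Γ : Finset A} {e : ℝ} {i : ℕ}

theorem IsTrap.zero (h : X.IsTrap v Γ e i a) : X.IsTrap v Γ e 0 a := by
  cases i with
  | zero => exact h
  | succ i => exact h.1

theorem IsTrap.adj (h : X.IsTrap v Γ e i a) : X.graph.Adj v a := h.zero.1

theorem IsTrap.countIn_resets_lt (h : X.IsTrap v Γ e i a) : countIn Γ (X.Resets v a) < e :=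
  h.zero.2

theorem IsTrap.countIn_escapes_lt (h : X.IsTrap v Γ e (i + 1) a) :
    countIn Γ (X.Escapes v (X.IsTrap v Γ e i) a) < e := h.2

theorem IsTrap.pos (h : X.IsTrap v Γ e i a) : 0 < e :=
  countIn_nonneg.trans_lt h.countIn_resets_lt

theorem IsTrap.pred (h : X.IsTrap v Γ e (i + 1) a) : X.IsTrap v Γ e i a := by
  induction i generalizing a with
  | zero => exact h.zero
  | succ i ih =>
    refine ⟨h.1, (countIn_mono ?_).trans_lt h.2⟩
    rintro c - ⟨b, hab, hb⟩
    exact ⟨b, hab, fun h => hb (ih h)⟩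

theorem IsTrap.mono {e' : ℝ} (he : e ≤ e') (h : X.IsTrap v Γ e i a) : X.IsTrap v Γ e' i a := by
  induction i generalizing a with
  | zero => exact ⟨h.1, h.2.trans_le he⟩
  | succ i ih =>
    refine ⟨⟨h.adj, h.countIn_resets_lt.trans_le he⟩, (countIn_mono ?_).trans_lt (h.2.trans_le he)⟩
    rintro c - ⟨b, hab, hb⟩
    exact ⟨b, hab, fun h => hb (ih h)⟩

end IsTrap

/-- The sum of the distances by which the letters in `Γ` move `v`. -/
noncomputable def displacement (X : SquareComplex V) (Γ : Finset A) (v : V) : ℕ :=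
  ∑ c ∈ Γ, X.graph.dist v (c • v)

/-- `v` has minimal displacement among all vertices. -/
def IsMinDisplacement (X : SquareComplex V) (Γ : Finset A) (v : V) : Prop :=
  ∀ u, X.displacement Γ v ≤ X.displacement Γ u

theorem exists_isMinDisplacement [Nonempty V] (X : SquareComplex V) (Γ : Finset A) :
    ∃ v, X.IsMinDisplacement Γ v :=
  ⟨_, fun u => Function.argmin_le (X.displacement Γ) u⟩

theorem IsMinDisplacement.sum_sub_nonneg {Γ : Finset A} {v : V} (hv : X.IsMinDisplacement Γ v)
    (u : V) : 0 ≤ ∑ c ∈ Γ, ((X.graph.dist u (c • u) : ℤ) - X.graph.dist v (c • v)) := by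
  rw [Finset.sum_sub_distrib, sub_nonneg]
  exact_mod_cast hv u

open Classical in
/-- The half of the change of the displacement along the edge from `v` to `p` that is due to the
direction of `c • v`; the other half is due to the direction of `c⁻¹ • v`. -/
noncomputable def edgeShift (X : SquareComplex V) (v p : V) (c : A) : ℤ :=
  if X.IsDirection v c p then -1 else if X.Passes v p c p then 0 else 1

theorem sum_edgeShift (X : SquareComplex V) (v p : V) (Γ : Finset A) :
    ((∑ c ∈ Γ, X.edgeShift v p c : ℤ) : ℝ) =
      countIn Γ (fun c => ¬ X.IsDirection v c p ∧ ¬ X.Passes v p c p) -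
        countIn Γ (fun c => X.IsDirection v c p) := by
  classical
  rw [countIn_eq_sum, countIn_eq_sum, ← Finset.sum_sub_distrib, Int.cast_sum]
  refine Finset.sum_congr rfl fun c _ => ?_
  by_cases hdir : X.IsDirection v c p
  · simp [edgeShift, hdir]
  · by_cases hpass : X.Passes v p c p <;> simp [edgeShift, hdir, hpass]

namespace IsGradedAction

variable {v p : V} {Γ : Finset A} {e : ℝ} {c : A}

theorem smul_mem_half_of_isDirection (hA : X.IsGradedAction ht A) (h : X.IsDirection v c p) :
    c • p ∈ X.half p v := by
  by_contra hcp
  -- Otherwise `c` maps the oriented edge `v p` to an edge crossing its hyperplane backwards.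
  have hcross := hA.cat0.ht_sub_eq_of_crossing h.1.symm (hA.adj_smul c h.1) h.2 hcp
  rw [hA.ht_smul, hA.ht_smul] at hcross
  have := hA.cat0.ht_adj h.1
  omega

theorem dist_smul_le_add_edgeShift (hA : X.IsGradedAction ht A) (hp : X.graph.Adj v p) (c : A) :
    (X.graph.dist p (c • p) : ℤ) - X.graph.dist v (c • v) ≤
      X.edgeShift v p c + X.edgeShift v p c⁻¹ := by
  have hX := hA.cat0
  have hcp := hX.dist_eq_add_one_or_left hp (c • p)
  have hcv := hX.dist_eq_add_one_or hp (c⁻¹ • v)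
  have hdir (h : X.IsDirection v c p) : X.graph.dist p (c • p) < X.graph.dist v (c • p) :=
    mem_half_comm.1 (hA.smul_mem_half_of_isDirection h)
  have hdir_inv (h : X.IsDirection v c⁻¹ p) := mem_half.1 h.2
  simp only [hA.dist_smul_left, inv_inv] at hcv hdir_inv
  by_cases hpass : X.Passes v p c p
  · have hpc : X.graph.dist p (c • p) < X.graph.dist v (c • p) :=
      mem_half_comm.1 ((hpass.2 p).1 (IsGradedCAT0.left_mem_half hp.symm))
    have hpass_inv := hpass.inv hp
    rw [edgeShift, edgeShift, if_neg hpass.not_isDirection, if_pos hpass,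
      if_neg hpass_inv.not_isDirection, if_pos hpass_inv]
    omega
  · have hpass_inv : ¬ X.Passes v p c⁻¹ p := fun h =>
      hpass (by simpa only [inv_inv] using h.inv hp)
    rw [edgeShift, edgeShift, if_neg hpass, if_neg hpass_inv]
    grind

theorem countIn_isDirection_le (hA : X.IsGradedAction ht A) (hΓ : ∀ c ∈ Γ, c⁻¹ ∈ Γ)
    (hv : X.IsMinDisplacement Γ v) (hp : X.graph.Adj v p) :
    countIn Γ (fun c => X.IsDirection v c p) ≤
      countIn Γ (fun c => ¬ X.IsDirection v c p ∧ ¬ X.Passes v p c p) := by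
  have hsum := (hv.sum_sub_nonneg p).trans
    (Finset.sum_le_sum fun c _ => hA.dist_smul_le_add_edgeShift hp c)
  rw [Finset.sum_add_distrib, sum_inv_eq_sum_of_symmetric hΓ (X.edgeShift v p)] at hsum
  have hshift : (0 : ℝ) ≤ (∑ c ∈ Γ, X.edgeShift v p c : ℤ) := by exact_mod_cast (by omega)
  rw [sum_edgeShift] at hshift
  linarith

theorem lt_countIn_passes (hA : X.IsGradedAction ht A) (hΓ : ∀ c ∈ Γ, c⁻¹ ∈ Γ)
    (hv : X.IsMinDisplacement Γ v) {i : ℕ} (hp : X.IsTrap v Γ e (i + 1) p) :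
    countIn Γ (fun c => X.IsDirection v c p) - 2 * e <
      countIn Γ (fun c => ∃ b, b ≠ p ∧ X.Passes v p c b ∧ X.IsTrap v Γ e i b) := by
  have hdir := hA.countIn_isDirection_le hΓ hv hp.adj
  have hpass : countIn Γ (fun c => ¬ X.IsDirection v c p ∧ ¬ X.Passes v p c p) ≤
      countIn Γ (X.Resets v p) + countIn Γ (fun c => ∃ b, b ≠ p ∧ X.Passes v p c b) := by
    refine countIn_le_add fun c _ ⟨hdir, hpass⟩ => or_iff_not_imp_left.2 fun hr => ?_
    obtain ⟨b, hb, -⟩ := hA.exists_passes_of_not_resets hp.adj hdir hr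
    exact ⟨b, fun h => hpass (h ▸ hb), hb⟩
  have htrap : countIn Γ (fun c => ∃ b, b ≠ p ∧ X.Passes v p c b) ≤
      countIn Γ (X.Escapes v (X.IsTrap v Γ e i) p) +
      countIn Γ (fun c => ∃ b, b ≠ p ∧ X.Passes v p c b ∧ X.IsTrap v Γ e i b) :=
    countIn_le_add fun c _ ⟨b, hne, hb⟩ => or_iff_not_imp_left.2 fun hesc =>
      ⟨b, hne, hb, of_not_escapes hesc hb⟩
  linarith [hp.countIn_resets_lt, hp.countIn_escapes_lt]

theorem eq_or_linkAdj_of_isTrap (hA : X.IsGradedAction ht A) {b : V} {i : ℕ}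
    (hM : e ≤ countIn Γ (fun c => X.IsDirection v c p)) (hb : X.IsTrap v Γ e i b) :
    b = p ∨ X.LinkAdj v p b := by
  obtain ⟨c, -, hc, hr⟩ := exists_of_countIn_lt (hb.countIn_resets_lt.trans_le hM)
  exact (hA.eq_or_linkAdj_of_not_resets hb.adj hr hc).imp_left Eq.symm

theorem lt_countIn_linkAdj_inv_smul (hA : X.IsGradedAction ht A) (hΓ : ∀ c ∈ Γ, c⁻¹ ∈ Γ)
    (hv : X.IsMinDisplacement Γ v) {q b : V} {i j k : ℕ} (hp : X.IsTrap v Γ e (i + 1) p)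
    (hM : e ≤ countIn Γ (fun c => X.IsDirection v c p))
    (hq : X.IsTrap v Γ e j q) (hb : X.IsTrap v Γ e k b) (hpq : X.LinkAdj v p q)
    (hpb : X.LinkAdj v p b) (hne : q ≠ b) :
    countIn Γ (fun c => X.IsDirection v c p) - 5 * e <
      countIn Γ (fun c => c • v = v ∧ X.LinkAdj v p (c⁻¹ • p)) := by
  have hpass := hA.lt_countIn_passes hΓ hv hp
  have hcount : countIn Γ (fun c => ∃ b, b ≠ p ∧ X.Passes v p c b ∧ X.IsTrap v Γ e i b) ≤
      countIn Γ (fun c => (X.Resets v p c ∨ X.Resets v q c) ∨ X.Resets v b c) +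
        countIn Γ (fun c => c • v = v ∧ X.LinkAdj v p (c⁻¹ • p)) := by
    refine countIn_le_add fun c _ ⟨x, hxp, hx, htrap⟩ => or_iff_not_imp_left.2 fun hr => ?_
    push Not at hr
    obtain ⟨⟨hrp, hrq⟩, hrb⟩ := hr
    -- The direction of `c • v` could only be the common member `p` of `{p, q}` and `{p, b}`.
    have hcv : c • v = v := by
      by_contra hcv
      obtain ⟨y, hy⟩ := hA.cat0.exists_isDirection hcv
      have hyp : y ≠ p := fun h => hx.not_isDirection (h ▸ hy)
      exact hne (((hA.eq_or_eq_of_not_resets hpq hrp hrq hy).resolve_left hyp).symm.trans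
        ((hA.eq_or_eq_of_not_resets hpb hrp hrb hy).resolve_left hyp))
    obtain rfl := hx.unique hA.cat0 (hA.passes_of_smul_eq hp.adj hcv)
    exact ⟨hcv, (hA.eq_or_linkAdj_of_isTrap hM htrap).resolve_left hxp⟩
  have hor := countIn_or_le (Γ := Γ) (P := fun c => X.Resets v p c ∨ X.Resets v q c)
    (Q := X.Resets v b)
  have hor' := countIn_or_le (Γ := Γ) (P := X.Resets v p) (Q := X.Resets v q)
  linarith [hp.countIn_resets_lt, hq.countIn_resets_lt, hb.countIn_resets_lt]

theorem smul_eq_of_not_escapes (hA : X.IsGradedAction ht A) {b : V} {i : ℕ}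
    (hM : e ≤ countIn Γ (fun c => X.IsDirection v c p)) (hpb : X.LinkAdj v p b)
    (hcv : c • v = v) (hcp : X.LinkAdj v p (c⁻¹ • p))
    (hesc : ¬ X.Escapes v (X.IsTrap v Γ e i) b c) : c • p = b := by
  have htrap := of_not_escapes hesc (hA.passes_of_smul_eq hpb.symm.adj hcv)
  rcases hA.eq_or_linkAdj_of_isTrap hM htrap with h | h
  · exact (inv_smul_eq_iff.1 h).symm
  · have hlink := hA.linkAdj_smul (inv_smul_eq_iff.2 hcv.symm) hpb
    exact (LinkAdj.not_triangle hA.cat0 hcp hlink h).elim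

theorem exists_linkAdj_isTrap (hA : X.IsGradedAction ht A) (hΓ : ∀ c ∈ Γ, c⁻¹ ∈ Γ)
    (hv : X.IsMinDisplacement Γ v) {i : ℕ} (hp : X.IsTrap v Γ e (i + 2) p)
    (hM : 7 * e ≤ countIn Γ (fun c => X.IsDirection v c p)) :
    ∃ q, X.LinkAdj v p q ∧ X.IsTrap v Γ e (i + 1) q ∧
      ∀ b, X.IsTrap v Γ e 1 b → b = p ∨ b = q := by
  have he := hp.pos
  have hM' : e ≤ countIn Γ (fun c => X.IsDirection v c p) := by linarith
  obtain ⟨-, -, q, hqp, -, hq⟩ :=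
    exists_of_countIn_pos (lt_trans (by linarith) (hA.lt_countIn_passes hΓ hv hp))
  have hpq := (hA.eq_or_linkAdj_of_isTrap hM' hq).resolve_left hqp
  refine ⟨q, hpq, hq, fun b hb => or_iff_not_imp_left.2 fun hbp => ?_⟩
  by_contra hbq
  have hpb := (hA.eq_or_linkAdj_of_isTrap hM' hb).resolve_left hbp
  have hcount := hA.lt_countIn_linkAdj_inv_smul hΓ hv hp hM' hb hq hpb hpq hbq
  obtain ⟨c, -, ⟨hcv, hcp⟩, hesc⟩ := exists_of_countIn_lt (Q := fun c =>
    X.Escapes v (X.IsTrap v Γ e i) q c ∨ X.Escapes v (X.IsTrap v Γ e 0) b c)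
    (countIn_or_le.trans_lt
      (lt_trans (by linarith [hq.countIn_escapes_lt, hb.countIn_escapes_lt]) hcount))
  push Not at hesc
  exact hbq ((hA.smul_eq_of_not_escapes hM' hpb hcv hcp hesc.2).symm.trans
    (hA.smul_eq_of_not_escapes hM' hpq hcv hcp hesc.1))

end IsGradedAction

end SquareComplex

namespace SquareComplex

variable {V : Type u} {X : SquareComplex V} {ht : V → ℤ} {A : Type v} [Group A] [MulAction A V]

/-- The letter `c` resets neither `p` nor `q`, and passes from each of them only to `p` or `q`. -/
structure Preserves (X : SquareComplex V) (v p q : V) (c : A) : Prop where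
  not_resets_left : ¬ X.Resets v p c
  not_resets_right : ¬ X.Resets v q c
  eq_or_eq_left : ∀ {b}, X.Passes v p c b → b = p ∨ b = q
  eq_or_eq_right : ∀ {b}, X.Passes v q c b → b = p ∨ b = q

theorem Preserves.symm {v p q : V} {c : A} (h : X.Preserves v p q c) : X.Preserves v q p c :=
  ⟨h.not_resets_right, h.not_resets_left, fun hb => (h.eq_or_eq_right hb).symm,
    fun hb => (h.eq_or_eq_left hb).symm⟩

theorem countIn_not_preserves_lt {v p q : V} {Γ : Finset A} {e : ℝ} (hp : X.IsTrap v Γ e 2 p)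
    (hq : X.IsTrap v Γ e 2 q) (htrap : ∀ b, X.IsTrap v Γ e 1 b → b = p ∨ b = q) :
    countIn Γ (fun c => ¬ X.Preserves v p q c) < 4 * e := by
  have hsplit : countIn Γ (fun c => ¬ X.Preserves v p q c) ≤
      countIn Γ (fun c => X.Resets v p c ∨ X.Resets v q c) +
        countIn Γ (fun c => X.Escapes v (X.IsTrap v Γ e 1) p c ∨
          X.Escapes v (X.IsTrap v Γ e 1) q c) :=
    countIn_le_add fun c _ hc => by
      by_contra! h
      exact hc ⟨h.1.1, h.1.2, fun hb => htrap _ (of_not_escapes h.2.1 hb),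
        fun hb => htrap _ (of_not_escapes h.2.2 hb)⟩
  have hresets := countIn_or_le (Γ := Γ) (P := X.Resets v p) (Q := X.Resets v q)
  have hescapes := countIn_or_le (Γ := Γ) (P := X.Escapes v (X.IsTrap v Γ e 1) p)
    (Q := X.Escapes v (X.IsTrap v Γ e 1) q)
  linarith [hp.countIn_resets_lt, hq.countIn_resets_lt, hp.countIn_escapes_lt,
    hq.countIn_escapes_lt]

theorem dist_diag_le_two {v p q w : V} (hX : X.IsGradedCAT0 ht) (hs : X.IsSquare v p w q) :
    X.graph.dist v w ≤ 2 := by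
  have := hX.connected.dist_triangle (u := v) (v := p) (w := w)
  rwa [SimpleGraph.dist_eq_one_iff_adj.2 (X.adj hs),
    SimpleGraph.dist_eq_one_iff_adj.2 (X.adj (X.rotate hs))] at this

theorem diag_mem_half {v p q w : V} (hX : X.IsGradedCAT0 ht) (hs : X.IsSquare v p w q) :
    w ∈ X.half p v := by
  have hwp := SimpleGraph.dist_eq_one_iff_adj.2 (X.adj (X.rotate hs)).symm
  have hwv := hX.connected.pos_dist_of_ne (X.diag_ne hs).symm
  have := hX.dist_eq_add_one_or (X.adj hs) w
  rw [mem_half]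
  omega

namespace IsGradedAction

variable {v p q w : V} {Γ : Finset A} {e : ℝ} {c : A}

theorem half_smul_eq_of_passes (hA : X.IsGradedAction ht A) {x y : V} (h : X.Passes v x c y) :
    X.half (c • y) (c • v) = X.half x v := by
  ext z
  rw [← smul_inv_smul c z, ← h.2, hA.smul_mem_half_iff, inv_smul_smul, inv_smul_smul]

theorem dist_smul_self_le (hA : X.IsGradedAction ht A) (v w : V) (c : A) :
    X.graph.dist w (c • w) ≤ X.graph.dist v (c • v) + 2 * X.graph.dist v w := by
  have hwv := hA.cat0.connected.dist_triangle (u := w) (v := v) (w := c • w)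
  have hvw := hA.cat0.connected.dist_triangle (u := v) (v := c • v) (w := c • w)
  rw [hA.dist_smul] at hvw
  rw [X.graph.dist_comm (u := w) (v := v)] at hwv
  omega

theorem exists_isDirection_inv_of_between (hA : X.IsGradedAction ht A) {x : V}
    (hx : X.graph.dist v x + X.graph.dist x (c • v) = X.graph.dist v (c • v)) (hne : x ≠ c • v) :
    ∃ b, X.IsDirection v c⁻¹ b ∧
      X.graph.dist v x + X.graph.dist x (c • b) + 1 = X.graph.dist v (c • v) := by
  obtain ⟨b, hb, hdist⟩ := hA.cat0.exists_adj_dist_add_one hne.symm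
  have hvxb := hA.cat0.connected.dist_triangle (u := v) (v := x) (w := b)
  rw [X.graph.dist_comm (u := b), X.graph.dist_comm (u := c • v)] at hdist
  refine ⟨c⁻¹ • b, ⟨?_, ?_⟩, ?_⟩
  · simpa only [inv_smul_smul] using hA.adj_smul c⁻¹ hb
  · rw [mem_half, hA.dist_smul_left, hA.dist_smul_left, inv_inv, smul_inv_smul]
    omega
  · rw [smul_inv_smul]
    omega

theorem dist_add_two_le_of_passes (hA : X.IsGradedAction ht A) {x x' y y' : V}
    (hx : X.IsSquare v x w x') (hy : X.IsSquare v y w y') (hdir : X.IsDirection v c x)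
    (hdir_inv : ∀ b, X.IsDirection v c⁻¹ b → b = y) (hpass : X.Passes v x' c y') :
    X.graph.dist w (c • w) + 2 ≤ X.graph.dist v (c • v) := by
  have hX := hA.cat0
  have hvx := SimpleGraph.dist_eq_one_iff_adj.2 hdir.1
  have hxcv := (hX.mem_half_iff_left hdir.1.symm).1 hdir.2
  have heven := hX.even_dist_sub_ht v (c • v)
  rw [hA.ht_smul, sub_self, sub_zero, Int.even_iff] at heven
  have hne : x ≠ c • v := by
    rintro rfl
    rw [SimpleGraph.dist_self] at hxcv
    omega
  obtain ⟨b, hb, hdist⟩ := hA.exists_isDirection_inv_of_between (by omega) hne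
  obtain rfl := hdir_inv b hb
  -- `c` maps the hyperplane of `w b`, which is that of `y' v`, to that of `x' v`, hence of `w x`.
  have hhalf : X.half (c • w) (c • b) = X.half w x := by
    rw [hX.half_eq_of_isSquare (hA.square_smul c (X.reflect (X.rotate (X.rotate hy)))),
      hA.half_smul_eq_of_passes hpass,
      hX.half_eq_of_isSquare (X.reflect (X.rotate (X.rotate hx)))]
  have hwx : X.graph.Adj w x := (X.adj (X.rotate hx)).symm
  have hwb : X.graph.Adj (c • w) (c • b) := hA.adj_smul c (X.adj (X.rotate hy)).symm
  have hw : w ∈ X.half (c • w) (c • b) := hhalf ▸ IsGradedCAT0.left_mem_half hwx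
  have hcb : c • b ∉ X.half w x := hhalf ▸ IsGradedCAT0.right_notMem_half
  rw [hX.mem_half_iff hwb] at hw
  rw [hX.notMem_half hwx, hX.mem_half_iff_left hwx.symm] at hcb
  omega

theorem exists_isSquare_passes (hA : X.IsGradedAction ht A) (hs : X.IsSquare v p w q)
    (hc : X.Preserves v p q c) (hc' : X.Preserves v p q c⁻¹) (hq : ¬ X.IsDirection v c q) :
    ∃ y y', X.IsSquare v y w y' ∧ (∀ b, X.IsDirection v c⁻¹ b → b = y) ∧ X.Passes v q c y' := by
  obtain ⟨b, hb, hlink⟩ :=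
    hA.exists_passes_of_not_resets (X.adj (X.reflect hs)) hq hc.not_resets_right
  have hdir {z : V} (hz : X.IsDirection v c⁻¹ z) : (z = p ∨ z = q) ∧ z ≠ b :=
    ⟨hA.eq_or_eq_of_not_resets ⟨w, hs⟩ hc'.not_resets_left hc'.not_resets_right hz,
      (hlink z hz).ne⟩
  rcases hc.eq_or_eq_right hb with rfl | rfl
  · exact ⟨q, b, X.reflect hs, fun z hz => (hdir hz).1.resolve_left (hdir hz).2, hb⟩
  · exact ⟨p, b, hs, fun z hz => (hdir hz).1.resolve_right (hdir hz).2, hb⟩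

theorem dist_add_two_le_of_not_isDirection (hA : X.IsGradedAction ht A)
    (hs : X.IsSquare v p w q) (hc : X.Preserves v p q c) (hc' : X.Preserves v p q c⁻¹)
    (hp : X.IsDirection v c p) (hq : ¬ X.IsDirection v c q) :
    X.graph.dist w (c • w) + 2 ≤ X.graph.dist v (c • v) :=
  let ⟨_, _, hs', hdir, hpass⟩ := hA.exists_isSquare_passes hs hc hc' hq
  hA.dist_add_two_le_of_passes hs hs' hp hdir hpass

theorem dist_add_two_le_of_isDirection (hA : X.IsGradedAction ht A) (hs : X.IsSquare v p w q)
    (hp : X.IsDirection v c p) (hq : X.IsDirection v c q)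
    (hdir : ∀ b, X.IsDirection v c⁻¹ b → b = p ∨ b = q) (hne : c • v ≠ w) :
    X.graph.dist w (c • w) + 2 ≤ X.graph.dist v (c • v) := by
  have hX := hA.cat0
  obtain ⟨w', hs', hdist⟩ := hX.exists_isSquare_of_mem_half hp.1 hq.1 (isSquare_ne hs) hp.2 hq.2
  obtain rfl := corner_unique hs hs'
  rw [X.graph.dist_comm (u := c • v), X.graph.dist_comm (u := c • v)] at hdist
  have hvw := dist_diag_le_two hX hs
  have hvwc := hX.connected.dist_triangle (u := v) (v := w) (w := c • v)
  obtain ⟨b, hb, hdist'⟩ := hA.exists_isDirection_inv_of_between (by omega) hne.symm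
  have hbw : X.graph.Adj b w := by
    rcases hdir b hb with rfl | rfl
    · exact X.adj (X.rotate hs)
    · exact X.adj (X.rotate (X.reflect hs))
  have hwbw := hX.connected.dist_triangle (u := w) (v := c • b) (w := c • w)
  rw [hA.dist_smul, SimpleGraph.dist_eq_one_iff_adj.2 hbw] at hwbw
  omega

theorem smul_diag_eq (hA : X.IsGradedAction ht A) (hs : X.IsSquare v p w q)
    (hc : X.Preserves v p q c) (hcv : c • v = v) : c • w = w := by
  have hp := hc.eq_or_eq_left (hA.passes_of_smul_eq (X.adj hs) hcv)
  have hq := hc.eq_or_eq_right (hA.passes_of_smul_eq (X.adj (X.reflect hs)) hcv)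
  have hs' := hA.square_smul c⁻¹ hs
  rw [inv_smul_eq_iff.2 hcv.symm] at hs'
  have hne := isSquare_ne hs'
  have hs'' : X.IsSquare v p (c⁻¹ • w) q := by
    rcases hp with hp | hp <;> rcases hq with hq | hq <;> rw [hp, hq] at hs' hne
    · exact absurd rfl hne
    · exact hs'
    · exact X.reflect hs'
    · exact absurd rfl hne
  exact eq_inv_smul_iff.1 (corner_unique hs hs'')

theorem smul_eq_or_dist_add_two_le (hA : X.IsGradedAction ht A) (hs : X.IsSquare v p w q)
    (hc : X.Preserves v p q c) (hc' : X.Preserves v p q c⁻¹) :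
    c • v = v ∨ c • v = w ∨ X.graph.dist w (c • w) + 2 ≤ X.graph.dist v (c • v) := by
  refine or_iff_not_imp_left.2 fun hv => or_iff_not_imp_left.2 fun hw => ?_
  have hdir {d : A} {x : V} (hd : X.Preserves v p q d) (hx : X.IsDirection v d x) :
      x = p ∨ x = q :=
    hA.eq_or_eq_of_not_resets ⟨w, hs⟩ hd.not_resets_left hd.not_resets_right hx
  obtain ⟨x, hx⟩ := hA.cat0.exists_isDirection hv
  wlog hxp : x = p generalizing p q
  · exact this (X.reflect hs) hc.symm hc'.symm (fun hd hx => (hdir hd.symm hx).symm)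
      ((hdir hc hx).resolve_left hxp)
  subst hxp
  by_cases hq : X.IsDirection v c q
  · exact hA.dist_add_two_le_of_isDirection hs hx hq (fun b => hdir hc') hw
  · exact hA.dist_add_two_le_of_not_isDirection hs hc hc' hx hq

theorem dist_smul_diag_le (hA : X.IsGradedAction ht A) (hs : X.IsSquare v p w q)
    (hc : X.Preserves v p q c) (hc' : X.Preserves v p q c⁻¹) :
    X.graph.dist w (c • w) ≤ X.graph.dist v (c • v) := by
  rcases hA.smul_eq_or_dist_add_two_le hs hc hc' with h | h | h
  · rw [hA.smul_diag_eq hs hc h, SimpleGraph.dist_self]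
    exact Nat.zero_le _
  · have hdist := hA.dist_smul c v (c • v)
    rw [h] at hdist ⊢
    exact hdist.le
  · omega

theorem countIn_dist_add_two_le (hA : X.IsGradedAction ht A) (hv : X.IsMinDisplacement Γ v)
    (hvw : X.graph.dist v w ≤ 2) {P : A → Prop}
    (hP : ∀ c, P c → X.graph.dist w (c • w) ≤ X.graph.dist v (c • v)) :
    countIn Γ (fun c => P c ∧ X.graph.dist w (c • w) + 2 ≤ X.graph.dist v (c • v)) ≤
      2 * countIn Γ (fun c => ¬ P c) := by
  classical
  have hsum : (0 : ℝ) ≤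
      ∑ c ∈ Γ, ((X.graph.dist w (c • w) : ℝ) - X.graph.dist v (c • v)) := by
    exact_mod_cast hv.sum_sub_nonneg w
  have hle : ∑ c ∈ Γ, ((X.graph.dist w (c • w) : ℝ) - X.graph.dist v (c • v)) ≤
      4 * countIn Γ (fun c => ¬ P c) -
        2 * countIn Γ (fun c => P c ∧ X.graph.dist w (c • w) + 2 ≤ X.graph.dist v (c • v)) := by
    rw [countIn_eq_sum, countIn_eq_sum, Finset.mul_sum, Finset.mul_sum, ← Finset.sum_sub_distrib]
    refine Finset.sum_le_sum fun c _ => ?_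
    have hself := hA.dist_smul_self_le v w c
    have hself' : (X.graph.dist w (c • w) : ℝ) ≤ X.graph.dist v (c • v) + 4 := by
      exact_mod_cast hself.trans (by omega)
    by_cases hc : P c
    · have hle : (X.graph.dist w (c • w) : ℝ) ≤ X.graph.dist v (c • v) := by
        exact_mod_cast hP c hc
      by_cases hdrop : X.graph.dist w (c • w) + 2 ≤ X.graph.dist v (c • v)
      · have : (X.graph.dist w (c • w) : ℝ) + 2 ≤ X.graph.dist v (c • v) := by
          exact_mod_cast hdrop
        simp only [hc, hdrop, not_true, if_false, and_self, if_true]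
        linarith
      · simp only [hc, hdrop, not_true, if_false, and_false]
        linarith
    · simp only [hc, not_false_eq_true, if_true, false_and, if_false]
      linarith
  linarith

theorem smul_eq_diag_of_isDirection (hA : X.IsGradedAction ht A) (hs : X.IsSquare v p w q)
    (hc : X.Preserves v p q c) (hc' : X.Preserves v p q c⁻¹)
    (hdrop : ¬ X.graph.dist w (c • w) + 2 ≤ X.graph.dist v (c • v))
    (hp : X.IsDirection v c p) : c • v = w :=
  ((hA.smul_eq_or_dist_add_two_le hs hc hc').resolve_left hp.smul_ne).resolve_right hdrop

theorem smul_eq_of_passes_of_ne (hA : X.IsGradedAction ht A) (hs : X.IsSquare v p w q)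
    (hc : X.Preserves v p q c) (hc' : X.Preserves v p q c⁻¹)
    (hdrop : ¬ X.graph.dist w (c • w) + 2 ≤ X.graph.dist v (c • v)) {b : V}
    (hb : X.Passes v p c b) (hne : b ≠ p) : c • q = p := by
  rcases hA.smul_eq_or_dist_add_two_le hs hc hc' with hcv | hcw | h
  · obtain rfl := hb.unique hA.cat0 (hA.passes_of_smul_eq (X.adj hs) hcv)
    rw [← (hc.eq_or_eq_left hb).resolve_left hne, smul_inv_smul]
  · refine absurd ⟨X.adj hs, ?_⟩ hb.not_isDirection
    rw [hcw]
    exact diag_mem_half hA.cat0 hs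
  · exact absurd h hdrop

/-- Otherwise most letters preserve a pair of neighbors `p`, `q` of `v` that spans a square with
opposite corner `w`. Since few of them can bring `w` closer to its image than `v`, some letter maps
`v` to `w` and some letter maps `q` to `p`, which contradicts the grading. -/
theorem countIn_isDirection_lt (hA : X.IsGradedAction ht A) (hΓ : ∀ c ∈ Γ, c⁻¹ ∈ Γ)
    (hv : X.IsMinDisplacement Γ v) (hp : X.IsTrap v Γ e 3 p) :
    countIn Γ (fun c => X.IsDirection v c p) < 32 * e := by
  by_contra! hM
  have he := hp.pos
  obtain ⟨q, ⟨w, hs⟩, hq, htrap⟩ := hA.exists_linkAdj_isTrap hΓ hv hp (by linarith)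
  let P : A → Prop := fun c => X.Preserves v p q c ∧ X.Preserves v p q c⁻¹
  have hnot : countIn Γ (fun c => ¬ P c) < 8 * e := by
    have hsplit : countIn Γ (fun c => ¬ P c) ≤ countIn Γ (fun c => ¬ X.Preserves v p q c) +
        countIn Γ (fun c => ¬ X.Preserves v p q c⁻¹) :=
      countIn_le_add fun c _ h => not_and_or.1 h
    rw [countIn_inv hΓ fun c => ¬ X.Preserves v p q c] at hsplit
    linarith [countIn_not_preserves_lt hp.pred hq htrap]
  have hdrop := hA.countIn_dist_add_two_le hv (dist_diag_le_two hA.cat0 hs)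
    (P := P) fun c hc => hA.dist_smul_diag_le hs hc.1 hc.2
  have hexists {Q : A → Prop} (hQ : 24 * e < countIn Γ Q) : ∃ c, Q c ∧ P c ∧
      ¬ X.graph.dist w (c • w) + 2 ≤ X.graph.dist v (c • v) := by
    obtain ⟨c, -, hc, h⟩ := exists_of_countIn_lt (countIn_or_le
      (P := fun c => ¬ P c)
      (Q := fun c => P c ∧ X.graph.dist w (c • w) + 2 ≤ X.graph.dist v (c • v))
      |>.trans_lt (lt_trans (by linarith) hQ))
    push Not at h
    exact ⟨c, hc, h.1, not_le.2 (h.2 h.1)⟩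
  have hw : ht w = ht v := by
    obtain ⟨c, hc, hP, hnd⟩ := hexists (lt_of_lt_of_le (by linarith) hM)
    rw [← hA.smul_eq_diag_of_isDirection hs hP.1 hP.2 hnd hc, hA.ht_smul]
  have hpq : ht p = ht q := by
    obtain ⟨c, ⟨b, hne, hb, -⟩, hP, hnd⟩ :=
      hexists (lt_trans (by linarith) (hA.lt_countIn_passes hΓ hv hp))
    rw [← hA.smul_eq_of_passes_of_ne hs hP.1 hP.2 hnd hb hne, hA.ht_smul]
  have hsquare := hA.cat0.ht_square hs
  have hadj := hA.cat0.ht_adj hp.adj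
  omega

end IsGradedAction

end SquareComplex

namespace SquareComplex

variable {V : Type u} {X : SquareComplex V} {ht : V → ℤ} {A : Type v} [Group A] [MulAction A V]

/-- A set of at most `B` neighbors of `v`, not all of whose halfspaces avoid the `Γ`-orbit of `v`,
such that the inverses of at least `e` letters of `Γ` carry the halfspace of each of these
neighbors into the halfspace of another one. -/
def HasHalfspaceAutomaton (X : SquareComplex V) (v : V) (Γ : Finset A) (e : ℝ) (B : ℕ) : Prop :=
  ∃ S : Finset V, S.card ≤ B ∧
    (∀ a ∈ S, e ≤ countIn Γ fun c => ∃ b ∈ S, ∀ x, c • x ∈ X.half a v → x ∈ X.half b v) ∧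
    ∃ a ∈ S, ∃ c ∈ Γ, c⁻¹ • v ∈ X.half a v

theorem HasHalfspaceAutomaton.mono {v : V} {Γ : Finset A} {e e' : ℝ} {B : ℕ} (he : e' ≤ e)
    (h : X.HasHalfspaceAutomaton v Γ e B) : X.HasHalfspaceAutomaton v Γ e' B :=
  let ⟨S, hcard, hcarry, hstart⟩ := h
  ⟨S, hcard, fun a ha => he.trans (hcarry a ha), hstart⟩

open Classical in
/-- The states reached from `U` by at most `k` passes. A pair of a state and a letter that does not
pass to any state contributes the junk state `v`. -/
noncomputable def reachableStates (X : SquareComplex V) (v : V) (Γ : Finset A) (U : Finset V) :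
    ℕ → Finset V
  | 0 => U
  | k + 1 => reachableStates X v Γ U k ∪ (reachableStates X v Γ U k ×ˢ Γ).image
      fun x => if h : ∃ b, X.Passes v x.1 x.2 b then h.choose else v

theorem card_reachableStates_le (v : V) (Γ : Finset A) (U : Finset V) (k : ℕ) :
    (X.reachableStates v Γ U k).card ≤ U.card * (Γ.card + 1) ^ k := by
  classical
  induction k with
  | zero => exact (mul_one _).ge
  | succ k ih =>
    calc (X.reachableStates v Γ U (k + 1)).card
        ≤ (X.reachableStates v Γ U k).card + (X.reachableStates v Γ U k ×ˢ Γ).card :=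
          (Finset.card_union_le _ _).trans (Nat.add_le_add_left Finset.card_image_le _)
      _ = (X.reachableStates v Γ U k).card * (Γ.card + 1) := by rw [Finset.card_product]; ring
      _ ≤ U.card * (Γ.card + 1) ^ k * (Γ.card + 1) := Nat.mul_le_mul_right _ ih
      _ = U.card * (Γ.card + 1) ^ (k + 1) := by ring

theorem mem_reachableStates_succ (hX : X.IsGradedCAT0 ht) {v a b : V} {Γ : Finset A}
    {U : Finset V} {k : ℕ} {c : A} (ha : a ∈ X.reachableStates v Γ U k) (hc : c ∈ Γ)
    (h : X.Passes v a c b) : b ∈ X.reachableStates v Γ U (k + 1) := by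
  classical
  refine Finset.mem_union_right _ (Finset.mem_image.2 ⟨(a, c), Finset.mk_mem_product ha hc, ?_⟩)
  have hb : ∃ b, X.Passes v a c b := ⟨b, h⟩
  rw [dif_pos hb]
  exact hb.choose_spec.unique hX h

theorem reachableStates_mono (v : V) (Γ : Finset A) (U : Finset V) :
    Monotone (X.reachableStates v Γ U) := by
  classical
  exact monotone_nat_of_le_succ fun k => Finset.subset_union_left

theorem exists_eq_or_eq_of_linkAdj (hX : X.IsGradedCAT0 ht) (v : V) {T : V → Prop}
    (hT : ∀ a b, T a → T b → a = b ∨ X.LinkAdj v a b) : ∃ a b, ∀ x, T x → x = a ∨ x = b := by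
  by_cases ha : ∃ a, T a
  · obtain ⟨a, ha⟩ := ha
    by_cases hb : ∃ b, T b ∧ b ≠ a
    · obtain ⟨b, hb, hba⟩ := hb
      refine ⟨a, b, fun x hx => ?_⟩
      by_contra! hne
      exact LinkAdj.not_triangle hX ((hT x a hx ha).resolve_left hne.1)
        ((hT a b ha hb).resolve_left hba.symm) ((hT x b hx hb).resolve_left hne.2)
    · push Not at hb
      exact ⟨a, a, fun x hx => Or.inl (hb x hx)⟩
  · exact ⟨v, v, fun x hx => absurd ⟨x, hx⟩ ha⟩

theorem exists_finset_isDirection (hX : X.IsGradedCAT0 ht) (v : V) (Γ : Finset A) :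
    ∃ U : Finset V, U.card ≤ 2 * Γ.card ∧ ∀ c ∈ Γ, ∀ a, X.IsDirection v c a → a ∈ U := by
  classical
  choose f g hfg using fun c : A => exists_eq_or_eq_of_linkAdj hX v
    fun a b (ha : X.IsDirection v c a) (hb : X.IsDirection v c b) => ha.eq_or_linkAdj hX hb
  refine ⟨Γ.biUnion fun c => {f c, g c}, ?_, fun c hc a ha => ?_⟩
  · exact (Finset.card_biUnion_le_card_mul _ _ 2 fun c _ => Finset.card_le_two).trans
      (mul_comm _ _).le
  · rw [Finset.mem_biUnion]
    exact ⟨c, hc, by simpa only [Finset.mem_insert, Finset.mem_singleton] using hfg c a ha⟩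

section IsTrap

variable {v : V} {Γ : Finset A} {e : ℝ}

theorem le_countIn_of_not_isTrap (hΓ : ∀ c ∈ Γ, c⁻¹ ∈ Γ) {E : V → Prop}
    (hE : countIn Γ (fun c => ∃ b, E b ∧ X.IsDirection v c b) ≤ e) {S : Finset V}
    (hdir : ∀ c ∈ Γ, ∀ b, X.IsDirection v c b → ¬ E b → b ∈ S) {a : V} (ha : X.graph.Adj v a)
    {i : ℕ} (hnot : ¬ X.IsTrap v Γ (2 * e) i a)
    (hpass : ∀ j, i = j + 1 → ∀ c ∈ Γ, ∀ b, X.Passes v a c b → ¬ X.IsTrap v Γ (2 * e) j b → b ∈ S) :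
    e ≤ countIn Γ (fun c => ∃ b ∈ S, ∀ x, c • x ∈ X.half a v → x ∈ X.half b v) := by
  have he : 0 ≤ e := countIn_nonneg.trans hE
  by_cases hr : 2 * e ≤ countIn Γ (X.Resets v a)
  · have hsplit : countIn Γ (X.Resets v a) ≤
        countIn Γ (fun c => ∃ b ∈ S, ∀ x, c • x ∈ X.half a v → x ∈ X.half b v) +
          countIn Γ (fun c => ∃ b, E b ∧ X.IsDirection v c⁻¹ b) :=
      countIn_le_add fun c hc ⟨b, hb, hcarry⟩ => or_iff_not_imp_right.2 fun hnotE =>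
        ⟨b, hdir c⁻¹ (hΓ c hc) b hb fun h => hnotE ⟨b, h, hb⟩, hcarry⟩
    rw [countIn_inv hΓ fun c => ∃ b, E b ∧ X.IsDirection v c b] at hsplit
    linarith
  · obtain _ | j := i
    · exact absurd ⟨ha, not_le.1 hr⟩ hnot
    · have hesc : 2 * e ≤ countIn Γ (X.Escapes v (X.IsTrap v Γ (2 * e) j) a) :=
        not_lt.1 fun h => hnot ⟨⟨ha, not_le.1 hr⟩, h⟩
      exact le_trans (by linarith) (hesc.trans (countIn_mono fun c hc ⟨b, hb, hnotb⟩ =>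
        ⟨b, hpass j rfl c hc b hb hnotb, fun x => (hb.2 x).2⟩))

end IsTrap

namespace IsGradedAction

variable {v : V} {Γ : Finset A} {e : ℝ}

theorem hasHalfspaceAutomaton_of_not_isTrap (hA : X.IsGradedAction ht A)
    (hΓ : ∀ c ∈ Γ, c⁻¹ ∈ Γ) {E : V → Prop}
    (hE : countIn Γ (fun c => ∃ a, E a ∧ X.IsDirection v c a) ≤ e)
    (htrap : ∀ a, X.IsTrap v Γ (2 * e) 3 a → E a) (hmoved : e < countIn Γ (fun c => c • v ≠ v)) :
    X.HasHalfspaceAutomaton v Γ e (2 * Γ.card * (Γ.card + 1) ^ 3) := by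
  classical
  obtain ⟨U, hU, hdir⟩ := exists_finset_isDirection hA.cat0 v Γ
  let S := (X.reachableStates v Γ U 3).filter fun a => X.graph.Adj v a ∧
    ∃ i ≤ 3, a ∈ X.reachableStates v Γ U (3 - i) ∧ ¬ X.IsTrap v Γ (2 * e) i a
  have hS {a i} (hi : i ≤ 3) (hadj : X.graph.Adj v a) (ha : a ∈ X.reachableStates v Γ U (3 - i))
      (hnot : ¬ X.IsTrap v Γ (2 * e) i a) : a ∈ S :=
    Finset.mem_filter.2
      ⟨reachableStates_mono v Γ U (Nat.sub_le 3 i) ha, hadj, i, hi, ha, hnot⟩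
  have hdirS {a c} (hc : c ∈ Γ) (ha : X.IsDirection v c a) (hnot : ¬ E a) : a ∈ S :=
    hS le_rfl ha.1 (hdir c hc a ha) (mt (htrap a) hnot)
  refine ⟨S, ?_, fun a ha => ?_, ?_⟩
  · exact (Finset.card_filter_le _ _).trans
      ((card_reachableStates_le v Γ U 3).trans (Nat.mul_le_mul_right _ hU))
  · obtain ⟨-, hadj, i, hi, hreach, hnot⟩ := Finset.mem_filter.1 ha
    refine le_countIn_of_not_isTrap hΓ hE (fun c hc b => hdirS hc) hadj hnot ?_
    rintro i rfl c hc b hb hnotb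
    have hreachb := mem_reachableStates_succ hA.cat0 hreach hc hb
    rw [show 3 - (i + 1) + 1 = 3 - i by omega] at hreachb
    exact hS (by omega) hb.1 hreachb hnotb
  · obtain ⟨c, hc, hcv, hnot⟩ := exists_of_countIn_lt (hE.trans_lt hmoved)
    obtain ⟨a, ha⟩ := hA.cat0.exists_isDirection hcv
    refine ⟨a, hdirS hc ha fun h => hnot ⟨a, h, ha⟩, c⁻¹, hΓ c hc, ?_⟩
    rw [inv_inv]
    exact ha.2

theorem linkAdj_and_linkAdj_of_not_resets (hA : X.IsGradedAction ht A) {a b x : V} {c : A}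
    (ha : X.graph.Adj v a) (hb : X.graph.Adj v b) (hne : a ≠ b) (hab : ¬ X.LinkAdj v a b)
    (hra : ¬ X.Resets v a c) (hrb : ¬ X.Resets v b c) (hx : X.IsDirection v c x) :
    X.LinkAdj v x a ∧ X.LinkAdj v x b := by
  rcases hA.eq_or_linkAdj_of_not_resets ha hra hx with rfl | hxa <;>
    rcases hA.eq_or_linkAdj_of_not_resets hb hrb hx with rfl | hxb
  · exact absurd rfl hne
  · exact absurd hxb hab
  · exact absurd hxa.symm hab
  · exact ⟨hxa, hxb⟩

theorem hasHalfspaceAutomaton_of_not_linkAdj (hA : X.IsGradedAction ht A)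
    (hΓ : ∀ c ∈ Γ, c⁻¹ ∈ Γ) (hv : X.IsMinDisplacement Γ v) {a b : V} (ha : X.IsTrap v Γ e 0 a)
    (hb : X.IsTrap v Γ e 0 b) (hne : a ≠ b) (hab : ¬ X.LinkAdj v a b)
    (hmoved : 134 * e ≤ countIn Γ (fun c => c • v ≠ v)) :
    X.HasHalfspaceAutomaton v Γ (2 * e) (2 * Γ.card * (Γ.card + 1) ^ 3) := by
  have he := ha.pos
  have hlink {c : A} {x : V} (hx : X.IsDirection v c x) (hra : ¬ X.Resets v a c)
      (hrb : ¬ X.Resets v b c) : X.LinkAdj v x a ∧ X.LinkAdj v x b :=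
    hA.linkAdj_and_linkAdj_of_not_resets ha.adj hb.adj hne hab hra hrb hx
  refine hA.hasHalfspaceAutomaton_of_not_isTrap hΓ
    (E := fun x => ¬ (X.LinkAdj v x a ∧ X.LinkAdj v x b)) ?_ (fun x hx hlinkx => ?_) (by linarith)
  · have hsplit : countIn Γ (fun c => ∃ x, ¬ (X.LinkAdj v x a ∧ X.LinkAdj v x b) ∧
        X.IsDirection v c x) ≤ countIn Γ (X.Resets v a) + countIn Γ (X.Resets v b) :=
      countIn_le_add fun c _ ⟨x, hnot, hx⟩ => by
        by_contra! hr
        exact hnot (hlink hx hr.1 hr.2)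
    linarith [ha.countIn_resets_lt, hb.countIn_resets_lt]
  · -- A direction other than `x` would form a triangle with `x` and `a` in the link of `v`.
    have hsplit : countIn Γ (fun c => c • v ≠ v) ≤ countIn Γ (fun c => X.IsDirection v c x) +
        countIn Γ (fun c => X.Resets v x c ∨ X.Resets v a c ∨ X.Resets v b c) := by
      refine countIn_le_add fun c _ hc => ?_
      by_contra! h
      obtain ⟨y, hy⟩ := hA.cat0.exists_isDirection hc
      exact LinkAdj.not_triangle hA.cat0 (hA.linkAdj_of_not_resets hx.adj h.1 h.2.1 hy) hlinkx.1
        (hlink hy h.2.2.1 h.2.2.2).1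
    have hor := countIn_or_le (Γ := Γ) (P := X.Resets v x)
      (Q := fun c => X.Resets v a c ∨ X.Resets v b c)
    have hor' := countIn_or_le (Γ := Γ) (P := X.Resets v a) (Q := X.Resets v b)
    linarith [hA.countIn_isDirection_lt hΓ hv hx, hx.countIn_resets_lt, ha.countIn_resets_lt,
      hb.countIn_resets_lt]

/-- The thresholds for the numbers of letters towards `k₁` and `k₂` drop by factors of `64`: a
vertex with `32 * (2 * θ)` such letters is not a trap for `2 * θ`. -/
theorem hasHalfspaceAutomaton_of_isTrap_imp (hA : X.IsGradedAction ht A)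
    (hΓ : ∀ c ∈ Γ, c⁻¹ ∈ Γ) (hv : X.IsMinDisplacement Γ v) {k₁ k₂ : V} (he : 0 < e)
    (htrap : ∀ b, X.IsTrap v Γ e 0 b → b = k₁ ∨ b = k₂)
    (hle : countIn Γ (fun c => X.IsDirection v c k₂) ≤ countIn Γ (fun c => X.IsDirection v c k₁))
    (hmoved : e ≤ countIn Γ (fun c => c • v ≠ v)) :
    X.HasHalfspaceAutomaton v Γ (e / 16384) (2 * Γ.card * (Γ.card + 1) ^ 3) := by
  have hmem {θ : ℝ} {b : V} (hθ : 2 * θ ≤ e) (hb : X.IsTrap v Γ (2 * θ) 3 b) : b = k₁ ∨ b = k₂ :=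
    htrap b (hb.mono hθ).zero
  by_cases hk₁ : countIn Γ (fun c => X.IsDirection v c k₁) < e / 4
  · refine (hA.hasHalfspaceAutomaton_of_not_isTrap (e := e / 2) hΓ ?_
      (fun b hb => hmem (by linarith) hb) (by linarith)).mono (by linarith)
    have hsplit : countIn Γ (fun c => ∃ b, (b = k₁ ∨ b = k₂) ∧ X.IsDirection v c b) ≤
        countIn Γ (fun c => X.IsDirection v c k₁) + countIn Γ (fun c => X.IsDirection v c k₂) :=
      countIn_le_add fun c _ ⟨b, hb, hdir⟩ => by
        rcases hb with rfl | rfl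
        exacts [Or.inl hdir, Or.inr hdir]
    linarith
  by_cases hk₂ : countIn Γ (fun c => X.IsDirection v c k₂) < e / 256
  · refine (hA.hasHalfspaceAutomaton_of_not_isTrap (e := e / 256) (E := (· = k₂)) hΓ ?_
      (fun _ hb => (hmem (by linarith) hb).resolve_left ?_) (by linarith)).mono (by linarith)
    · exact (countIn_mono fun c _ ⟨_, hb, hdir⟩ => hb ▸ hdir).trans hk₂.le
    · rintro rfl
      linarith [hA.countIn_isDirection_lt hΓ hv hb]
  · refine hA.hasHalfspaceAutomaton_of_not_isTrap (E := fun _ => False) hΓ ?_ (fun b hb => ?_)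
      (by linarith)
    · simp only [countIn, false_and, exists_false, Finset.filter_false, Finset.card_empty,
        Nat.cast_zero]
      positivity
    · have hdir := hA.countIn_isDirection_lt hΓ hv hb
      rcases hmem (by linarith) hb with rfl | rfl <;> linarith

theorem hasHalfspaceAutomaton (hA : X.IsGradedAction ht A) (hΓ : ∀ c ∈ Γ, c⁻¹ ∈ Γ)
    (hv : X.IsMinDisplacement Γ v) (hpos : 0 < countIn Γ (fun c => c • v ≠ v)) :
    X.HasHalfspaceAutomaton v Γ (countIn Γ (fun c => c • v ≠ v) / 2 ^ 22)
      (2 * Γ.card * (Γ.card + 1) ^ 3) := by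
  obtain ⟨e, he⟩ : ∃ e, countIn Γ (fun c => c • v ≠ v) = 134 * e := ⟨_ / 134, by ring⟩
  have he0 : 0 < e := by linarith
  by_cases hlink : ∀ a b, X.IsTrap v Γ e 0 a → X.IsTrap v Γ e 0 b → a = b ∨ X.LinkAdj v a b
  · obtain ⟨k₁, k₂, htrap⟩ := exists_eq_or_eq_of_linkAdj hA.cat0 v hlink
    wlog hle : countIn Γ (fun c => X.IsDirection v c k₂) ≤ countIn Γ (fun c => X.IsDirection v c k₁)
      generalizing k₁ k₂
    · exact this k₂ k₁ (fun b hb => (htrap b hb).symm) (not_le.1 hle).le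
    exact (hA.hasHalfspaceAutomaton_of_isTrap_imp hΓ hv he0 htrap hle (by linarith)).mono
      (by linarith)
  · push Not at hlink
    obtain ⟨a, b, ha, hb, hne, hab⟩ := hlink
    exact (hA.hasHalfspaceAutomaton_of_not_linkAdj hΓ hv ha hb hne hab he.ge).mono (by linarith)

end IsGradedAction

end SquareComplex

section FreeGroup

open FreeGroup hiding IsReduced norm

variable {α : Type*}

theorem letter_compatible_iff {x y : α × Bool} : (x.1 = y.1 → x.2 = y.2) ↔ x ≠ (y.1, !y.2) := by
  obtain ⟨i, a⟩ := x
  obtain ⟨j, b⟩ := y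
  cases a <;> cases b <;> simp

theorem isReduced_cons_cons_iff_ne {x y : α × Bool} {w : List (α × Bool)} :
    FreeGroup.IsReduced (x :: y :: w) ↔ x ≠ (y.1, !y.2) ∧ FreeGroup.IsReduced (y :: w) := by
  rw [FreeGroup.isReduced_cons_cons, letter_compatible_iff]

theorem isReduced_replicate (k : ℕ) (x : α × Bool) : FreeGroup.IsReduced (List.replicate k x) :=
  List.isChain_replicate_of_rel _ fun _ => rfl

theorem exists_isReduced_append_of_cancel (x : List (α × Bool)) :
    ∀ y : List (α × Bool), FreeGroup.IsReduced x → FreeGroup.IsReduced y →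
      ∃ u p w, x = u ++ p ∧ y = invRev p ++ w ∧ FreeGroup.IsReduced (u ++ w) := by
  classical
  induction x using List.reverseRecOn with
  | nil => exact fun y _ hy => ⟨[], [], y, rfl, rfl, hy⟩
  | append_singleton x a ih =>
    rintro (_ | ⟨b, y⟩) hx hy
    · exact ⟨x ++ [a], [], [], by simp, by simp [invRev], by simpa using hx⟩
    by_cases hba : b = (a.1, !a.2)
    · obtain ⟨u, p, w, rfl, rfl, huw⟩ := ih y (hx.infix (List.prefix_append _ _).isInfix)
        (hy.infix (List.suffix_cons _ _).isInfix)
      refine ⟨u, p ++ [a], w, List.append_assoc .., ?_, huw⟩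
      rw [invRev_append, hba]
      simp [invRev]
    · have hab : a ≠ (b.1, !b.2) := by
        rintro rfl
        simp at hba
      refine ⟨x ++ [a], [], b :: y, by simp, by simp [invRev], ?_⟩
      exact FreeGroup.IsReduced.append_overlap hx (isReduced_cons_cons_iff_ne.2 ⟨hab, hy⟩)
        (List.cons_ne_nil _ _)

theorem exists_letter_notMem [Nontrivial α] {s : Finset (α × Bool)} (hs : s.card ≤ 3) :
    ∃ x, x ∉ s := by
  classical
  obtain ⟨i, j, hij⟩ := exists_pair_ne α
  have hlt : s.card < (({i, j} : Finset α) ×ˢ (Finset.univ : Finset Bool)).card := by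
    rw [Finset.card_product, Finset.card_pair hij, Finset.card_univ, Fintype.card_bool]
    omega
  obtain ⟨x, -, hx⟩ := Finset.exists_mem_notMem_of_card_lt_card hlt
  exact ⟨x, hx⟩

section ReducedLists

variable [Fintype α]

variable (α) in
/-- The reduced words of length `k` in the letters of `α` and their inverses. -/
noncomputable def reducedLists (k : ℕ) : Finset (List (α × Bool)) :=
  ((List.finite_length_eq (α × Bool) k).subset
    (fun w (h : w.length = k ∧ FreeGroup.IsReduced w) => h.1)).toFinset

theorem mem_reducedLists {k : ℕ} {w : List (α × Bool)} :
    w ∈ reducedLists α k ↔ w.length = k ∧ FreeGroup.IsReduced w :=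
  Set.Finite.mem_toFinset _

theorem card_filter_isReduced_cons {y : α × Bool} {w : List (α × Bool)}
    [DecidablePred fun x => FreeGroup.IsReduced (x :: y :: w)]
    (hw : FreeGroup.IsReduced (y :: w)) :
    (Finset.univ.filter fun x => FreeGroup.IsReduced (x :: y :: w)).card =
      2 * Fintype.card α - 1 := by
  classical
  have : (Finset.univ.filter fun x => FreeGroup.IsReduced (x :: y :: w)) =
      Finset.univ.erase (y.1, !y.2) := by
    ext x
    simp only [Finset.mem_filter, Finset.mem_univ, true_and, Finset.mem_erase, and_true,
      isReduced_cons_cons_iff_ne, hw]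
  rw [this, Finset.card_erase_of_mem (Finset.mem_univ _), Finset.card_univ, Fintype.card_prod,
    Fintype.card_bool, mul_comm]

theorem card_reducedLists_add_two (k : ℕ) :
    (reducedLists α (k + 2)).card = (reducedLists α (k + 1)).card * (2 * Fintype.card α - 1) := by
  classical
  have hsigma : ((reducedLists α (k + 1)).sigma fun w => Finset.univ.filter fun x : α × Bool =>
      FreeGroup.IsReduced (x :: w)).card = (reducedLists α (k + 2)).card := by
    refine Finset.card_bij (fun x _ => x.2 :: x.1) ?_ ?_ ?_
    · rintro ⟨w, x⟩ h
      simp only [Finset.mem_sigma, mem_reducedLists, Finset.mem_filter, Finset.mem_univ,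
        true_and] at h
      exact mem_reducedLists.2 ⟨by rw [List.length_cons, h.1.1], h.2⟩
    · rintro ⟨w, x⟩ - ⟨w', x'⟩ - h
      simp only [List.cons.injEq] at h
      obtain ⟨rfl, rfl⟩ := h
      rfl
    · rintro (_ | ⟨x, w⟩) hw
      · simp [mem_reducedLists] at hw
      rw [mem_reducedLists] at hw
      refine ⟨⟨w, x⟩, ?_, rfl⟩
      simp only [Finset.mem_sigma, mem_reducedLists, Finset.mem_filter, Finset.mem_univ, true_and]
      exact ⟨⟨by simpa using hw.1, hw.2.infix (List.suffix_cons _ _).isInfix⟩, hw.2⟩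
  rw [← hsigma, Finset.card_sigma]
  refine Finset.sum_const_nat ?_
  rintro (_ | ⟨y, w⟩) hw
  · simp [mem_reducedLists] at hw
  · exact card_filter_isReduced_cons (mem_reducedLists.1 hw).2

theorem card_reducedLists_one : (reducedLists α 1).card = 2 * Fintype.card α := by
  classical
  have : reducedLists α 1 = Finset.univ.image fun x : α × Bool => [x] := by
    ext w
    simp only [mem_reducedLists, Finset.mem_image, Finset.mem_univ, true_and,
      List.length_eq_one_iff]
    constructor
    · rintro ⟨⟨x, rfl⟩, -⟩
      exact ⟨x, rfl⟩
    · rintro ⟨x, rfl⟩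
      exact ⟨⟨x, rfl⟩, FreeGroup.IsReduced.singleton⟩
  rw [this, Finset.card_image_of_injective _ (fun x y h => by simpa using h), Finset.card_univ,
    Fintype.card_prod, Fintype.card_bool, mul_comm]

theorem card_reducedLists_add_one (k : ℕ) :
    (reducedLists α (k + 1)).card = 2 * Fintype.card α * (2 * Fintype.card α - 1) ^ k := by
  induction k with
  | zero => rw [card_reducedLists_one, pow_zero, mul_one]
  | succ k ih => rw [card_reducedLists_add_two, ih, pow_succ, mul_assoc]

end ReducedLists

variable [DecidableEq α]

theorem exists_toWord_mul (g c : FreeGroup α) :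
    ∃ u p w, g.toWord = u ++ p ∧ c.toWord = invRev p ++ w ∧ (g * c).toWord = u ++ w := by
  obtain ⟨u, p, w, hg, hc, huw⟩ :=
    exists_isReduced_append_of_cancel g.toWord c.toWord isReduced_toWord isReduced_toWord
  refine ⟨u, p, w, hg, hc, ?_⟩
  rw [← huw.reduce_eq, ← toWord_mk]
  congr 1
  rw [← mk_toWord (x := g), ← mk_toWord (x := c), hg, hc, ← mul_mk, ← mul_mk, ← mul_mk, ← inv_mk]
  group

theorem even_norm_mul_add_norm_add_norm (g c : FreeGroup α) :
    Even ((g * c).norm + g.norm + c.norm) := by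
  obtain ⟨u, p, w, hg, hc, hgc⟩ := exists_toWord_mul g c
  simp only [FreeGroup.norm, hg, hc, hgc, List.length_append, invRev_length]
  exact ⟨u.length + w.length + p.length, by ring⟩

theorem take_toWord_eq_of_norm_mul_lt {g c : FreeGroup α} {l : ℕ}
    (h : (g * c).norm + 2 * l < g.norm + c.norm) :
    c.toWord.take l = (invRev g.toWord).take l := by
  obtain ⟨u, p, w, hg, hc, hgc⟩ := exists_toWord_mul g c
  simp only [FreeGroup.norm, hg, hc, hgc, List.length_append, invRev_length] at h
  rw [hg, hc, invRev_append, List.take_append_of_le_length (by rw [invRev_length]; omega),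
    List.take_append_of_le_length (by rw [invRev_length]; omega)]

theorem drop_toWord_eq_of_le_norm {h c : FreeGroup α} {l : ℕ}
    (hl : l ≤ c.norm) (hc : (h * c⁻¹).norm + c.norm ≤ h.norm + 2 * l) :
    c.toWord.drop l = h.toWord.drop (h.norm - (c.norm - l)) := by
  obtain ⟨u, p, w, hh, hc', hhc⟩ := exists_toWord_mul h c⁻¹
  have hcw : c.toWord = invRev w ++ p := by
    rw [← inv_inv c, toWord_inv, hc', invRev_append, invRev_invRev]
  simp only [FreeGroup.norm, hh, hcw, hhc, List.length_append, invRev_length] at hl hc ⊢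
  rw [List.drop_append, List.drop_append, List.drop_of_length_le (by rw [invRev_length]; omega),
    List.drop_of_length_le (l := u) (by omega), invRev_length]
  congr 2
  omega

/-- Conjugation by a power of a letter that cancels on neither side. -/
theorem exists_norm_conj_eq [Nontrivial α] {g : FreeGroup α} {L : ℕ} (hg : 0 < g.norm)
    (hL : g.norm ≤ L) (heven : Even (g.norm + L)) : ∃ s ≤ L, ∃ x,
      (FreeGroup.mk (List.replicate s x) * g * (FreeGroup.mk (List.replicate s x))⁻¹).norm = L := by
  obtain ⟨a, w, ha⟩ := List.exists_cons_of_length_pos (l := g.toWord) hg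
  obtain ⟨w', b, hb⟩ : ∃ w' b, g.toWord = w' ++ [b] :=
    ⟨_, _, (List.dropLast_append_getLast (l := g.toWord) (by simp [ha])).symm⟩
  obtain ⟨x, hx⟩ := exists_letter_notMem (s := {(a.1, !a.2), b})
    (Finset.card_le_two.trans (by norm_num))
  obtain ⟨hxa, hxb⟩ : x ≠ (a.1, !a.2) ∧ x ≠ b := by simpa using hx
  obtain ⟨s, rfl⟩ : ∃ s, L = g.norm + (s + s) := by
    rw [Nat.even_iff] at heven
    exact ⟨(L - g.norm) / 2, by omega⟩
  have hreduced : FreeGroup.IsReduced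
      (List.replicate s x ++ (g.toWord ++ List.replicate s (x.1, !x.2))) := by
    refine List.isChain_append.2 ⟨isReduced_replicate s x, List.isChain_append.2
      ⟨isReduced_toWord, isReduced_replicate s _, fun c hc y hy => ?_⟩, fun y hy c hc => ?_⟩ <;>
      rw [letter_compatible_iff]
    · obtain rfl : b = c := by simpa [hb, List.getLast?_append] using hc
      obtain rfl := List.eq_of_mem_replicate (List.mem_of_mem_head? hy)
      simpa [eq_comm] using hxb
    · obtain rfl : a = c := by simpa [ha] using hc
      obtain rfl := List.eq_of_mem_replicate (List.mem_of_mem_getLast? hy)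
      exact hxa
  refine ⟨s, by omega, x, ?_⟩
  have hconj : FreeGroup.mk (List.replicate s x) * g * (FreeGroup.mk (List.replicate s x))⁻¹ =
      FreeGroup.mk (List.replicate s x ++ (g.toWord ++ List.replicate s (x.1, !x.2))) := by
    rw [← mul_mk, ← mul_mk, mk_toWord, inv_mk, mul_assoc]
    simp [invRev]
  rw [hconj, FreeGroup.norm, toWord_mk, hreduced.reduce_eq]
  simp only [List.length_append, List.length_replicate, FreeGroup.norm]
  omega

variable [Fintype α]

variable (α) in
/-- The sphere of radius `m` around `1` in the free group on `α`. -/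
noncomputable def wordSphere (m : ℕ) : Finset (FreeGroup α) := (reducedLists α m).image FreeGroup.mk

theorem mem_wordSphere {m : ℕ} {g : FreeGroup α} : g ∈ wordSphere α m ↔ g.norm = m := by
  rw [wordSphere, Finset.mem_image]
  constructor
  · rintro ⟨w, hw, rfl⟩
    rw [mem_reducedLists] at hw
    rw [FreeGroup.norm, toWord_mk, hw.2.reduce_eq, hw.1]
  · intro h
    exact ⟨g.toWord, mem_reducedLists.2 ⟨h, isReduced_toWord⟩, mk_toWord⟩

theorem card_wordSphere (m : ℕ) : (wordSphere α m).card = (reducedLists α m).card := by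
  refine Finset.card_image_of_injOn fun x hx y hy h => ?_
  rw [← (mem_reducedLists.1 hx).2.reduce_eq, ← (mem_reducedLists.1 hy).2.reduce_eq]
  exact reduce.sound h

theorem card_wordSphere_add_one (m : ℕ) :
    (wordSphere α (m + 1)).card = 2 * Fintype.card α * (2 * Fintype.card α - 1) ^ m := by
  rw [card_wordSphere, card_reducedLists_add_one]

theorem cast_card_wordSphere_add_one [Nonempty α] (m : ℕ) :
    ((wordSphere α (m + 1)).card : ℝ) =
      2 * Fintype.card α * (2 * (Fintype.card α : ℝ) - 1) ^ m := by
  have : 1 ≤ 2 * Fintype.card α := by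
    have := Fintype.card_pos (α := α)
    omega
  rw [card_wordSphere_add_one]
  push_cast [this]
  rfl

theorem card_wordSphere_pos [Nonempty α] (m : ℕ) : 0 < (wordSphere α m).card := by
  obtain ⟨g, hg⟩ := FreeGroup.norm_surjective (α := α) m
  exact Finset.card_pos.2 ⟨g, mem_wordSphere.2 hg⟩

theorem inv_mem_wordSphere {m : ℕ} {g : FreeGroup α} (h : g ∈ wordSphere α m) :
    g⁻¹ ∈ wordSphere α m := by
  rw [mem_wordSphere] at h ⊢
  rw [norm_inv_eq, h]

theorem mem_reducedLists_of_infix_toWord {g : FreeGroup α} {w : List (α × Bool)}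
    (h : w <:+: g.toWord) : w ∈ reducedLists α w.length :=
  mem_reducedLists.2 ⟨rfl, isReduced_toWord.infix h⟩

theorem card_cancelling_le (m l : ℕ) (g : FreeGroup α) :
    ((wordSphere α m).filter fun c => (g * c).norm + 2 * l < g.norm + m).card ≤
      (wordSphere α (m - l)).card := by
  rw [card_wordSphere]
  refine Finset.card_le_card_of_injOn (fun c => c.toWord.drop l) ?_ ?_
  · intro c hc
    obtain rfl := mem_wordSphere.1 (Finset.mem_filter.1 hc).1
    simpa [FreeGroup.norm] using mem_reducedLists_of_infix_toWord (List.drop_suffix l _).isInfix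
  · intro c hc c' hc' h
    simp only [Finset.coe_filter, mem_wordSphere, Set.mem_ofPred_eq] at hc hc'
    obtain ⟨rfl, hc⟩ := hc
    rw [← hc'.1] at hc'
    apply toWord_injective
    rw [← List.take_append_drop l c.toWord, ← List.take_append_drop l c'.toWord,
      take_toWord_eq_of_norm_mul_lt hc, take_toWord_eq_of_norm_mul_lt hc'.2]
    exact congrArg _ h

theorem card_right_factors_le {m l : ℕ} (hl : l ≤ m) (h : FreeGroup α) :
    ((wordSphere α m).filter fun c => (h * c⁻¹).norm + m ≤ h.norm + 2 * l).card ≤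
      (wordSphere α l).card := by
  rw [card_wordSphere]
  refine Finset.card_le_card_of_injOn (fun c => c.toWord.take l) ?_ ?_
  · intro c hc
    obtain rfl := mem_wordSphere.1 (Finset.mem_filter.1 hc).1
    simpa [List.length_take, show min l c.toWord.length = l from min_eq_left hl] using
      mem_reducedLists_of_infix_toWord (List.take_prefix l c.toWord).isInfix
  · intro c hc c' hc' htake
    simp only [Finset.coe_filter, mem_wordSphere, Set.mem_ofPred_eq] at hc hc'
    obtain ⟨rfl, hc⟩ := hc
    obtain ⟨hnorm, hc'⟩ := hc'
    rw [← hnorm] at hc'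
    apply toWord_injective
    rw [← List.take_append_drop l c.toWord, ← List.take_append_drop l c'.toWord,
      drop_toWord_eq_of_le_norm hl hc, drop_toWord_eq_of_le_norm (hnorm ▸ hl) hc', hnorm]
    exact congrArg (· ++ _) htake

/-- The product `g * c` and the first `l` letters of `c` determine `c`, since its other letters
survive in the product. -/
theorem sum_card_le_card_wordSphere_mul_card_biUnion {m l : ℕ} (hl : l ≤ m)
    (G : Finset (FreeGroup α)) (E : FreeGroup α → Finset (FreeGroup α))
    (hE : ∀ g ∈ G, ∀ c ∈ E g, c ∈ wordSphere α m ∧ g.norm + m ≤ (g * c).norm + 2 * l) :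
    ∑ g ∈ G, (E g).card ≤
      (wordSphere α l).card * (G.biUnion fun g => (E g).image (g * ·)).card := by
  have himage : G.biUnion (fun g => (E g).image (g * ·)) =
      (G.sigma E).image fun x => x.1 * x.2 := by
    ext h
    simp only [Finset.mem_biUnion, Finset.mem_image, Finset.mem_sigma, Sigma.exists, and_assoc,
      exists_and_left]
  rw [himage, ← Finset.card_sigma]
  refine Finset.card_le_mul_card_image _ _ fun h _ => ?_
  refine le_trans ?_ (card_right_factors_le hl h)
  refine Finset.card_le_card_of_injOn (fun x => x.2) ?_ ?_
  · rintro ⟨g, c⟩ hx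
    simp only [Finset.mem_coe, Finset.mem_filter, Finset.mem_sigma] at hx ⊢
    obtain ⟨⟨hg, hc⟩, rfl⟩ := hx
    rw [mul_inv_cancel_right]
    exact hE g hg c hc
  · rintro ⟨g, c⟩ hx ⟨g', c'⟩ hx' (rfl : c = c')
    simp only [Finset.mem_coe, Finset.mem_filter] at hx hx'
    rw [mul_right_cancel (hx.2.trans hx'.2.symm)]

theorem card_le_mul_countIn_wordSphere [Nontrivial α] {L : ℕ} {G : Finset (FreeGroup α)}
    {P : FreeGroup α → Prop} (hG : ∀ g ∈ G, 0 < g.norm ∧ g.norm ≤ L ∧ Even (g.norm + L))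
    (hP : ∀ g ∈ G, ∀ r, IsConj g r → P r) :
    (G.card : ℝ) ≤ (L + 1) * (2 * Fintype.card α) * countIn (wordSphere α L) P := by
  classical
  choose! s hs x hx using fun g hg => exists_norm_conj_eq (hG g hg).1 (hG g hg).2.1 (hG g hg).2.2
  let conj (g : FreeGroup α) : FreeGroup α :=
    FreeGroup.mk (List.replicate (s g) (x g)) * g * (FreeGroup.mk (List.replicate (s g) (x g)))⁻¹
  have hcard : G.card ≤ (Finset.range (L + 1) ×ˢ (Finset.univ : Finset (α × Bool)) ×ˢ
      (wordSphere α L).filter P).card := by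
    refine Finset.card_le_card_of_injOn (fun g => (s g, x g, conj g)) ?_ ?_
    · intro g hg
      simp only [Finset.coe_product, Set.mem_prod, Finset.mem_coe, Finset.mem_range,
        Finset.mem_univ, Finset.mem_filter, mem_wordSphere, true_and]
      exact ⟨Nat.lt_succ_of_le (hs g hg), hx g hg, hP g hg _ (isConj_iff.2 ⟨_, rfl⟩)⟩
    · intro g _ g' _ heq
      simp only [Prod.mk.injEq, conj] at heq
      obtain ⟨hsg, hxg, hgg⟩ := heq
      rw [hsg, hxg] at hgg
      exact mul_left_cancel (mul_right_cancel hgg)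
  rw [Finset.card_product, Finset.card_product, Finset.card_range, Finset.card_univ,
    Fintype.card_prod, Fintype.card_bool] at hcard
  rw [countIn_eq_card_filter]
  calc (G.card : ℝ) ≤ ((L + 1) * (Fintype.card α * 2 * ((wordSphere α L).filter P).card) : ℕ) :=
        Nat.cast_le.2 hcard
    _ = _ := by push_cast; ring

end FreeGroup

section WordAutomaton

open FreeGroup hiding IsReduced norm

variable {α : Type*} [DecidableEq α] [Fintype α] {m B : ℕ}

variable (α m B) in
/-- A nondeterministic automaton with state set `Fin B` that reads elements of the sphere of
radius `m` in the free group. A run starts at `initialState`, with `initialWord` already read. -/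
structure WordAutomaton where
  step : Fin B → wordSphere α m → Fin B → Prop
  initialState : Fin B
  initialWord : wordSphere α m

namespace WordAutomaton

instance : Finite (WordAutomaton α m B) :=
  Finite.of_injective (fun M => (M.step, M.initialState, M.initialWord)) fun M M' h => by
    cases M
    cases M'
    simpa using h

/-- `M.Run j q g`: some run of `j` steps ends in the state `q` and reads words with product `g`. -/
inductive Run (M : WordAutomaton α m B) : ℕ → Fin B → FreeGroup α → Prop
  | start : Run M 0 M.initialState M.initialWord
  | step {j : ℕ} {q q' : Fin B} {g : FreeGroup α} (c : wordSphere α m) :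
      Run M j q g → M.step q c q' → Run M (j + 1) q' (g * c)

/-- `M.Recognizes r`: some conjugate of `r` is the product of the words read in a run. -/
def Recognizes (M : WordAutomaton α m B) (r : FreeGroup α) : Prop :=
  ∃ j q g, M.Run j q g ∧ IsConj g r

/-- `M.CanRead q c`: the automaton has a transition out of the state `q` that reads `c`. -/
def CanRead (M : WordAutomaton α m B) (q : Fin B) (c : FreeGroup α) : Prop :=
  ∃ (hc : c ∈ wordSphere α m) (q' : Fin B), M.step q ⟨c, hc⟩ q'

/-- At every state the automaton can read at least `θ` words. -/
def IsBranching (M : WordAutomaton α m B) (θ : ℝ) : Prop :=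
  ∀ q, θ ≤ countIn (wordSphere α m) (M.CanRead q)

variable {M : WordAutomaton α m B} {θ β : ℝ} {l j : ℕ} {q : Fin B} {g c : FreeGroup α}

theorem Run.mul (hg : M.Run j q g) (hc : M.CanRead q c) : ∃ q', M.Run (j + 1) q' (g * c) := by
  obtain ⟨hc, q', hq'⟩ := hc
  exact ⟨q', .step ⟨c, hc⟩ hg hq'⟩

open Classical in
/-- The words that can be read at the state `q` and of which at most `l` letters cancel when they
are appended to `g`. -/
noncomputable def extensions (M : WordAutomaton α m B) (l : ℕ) (q : Fin B) (g : FreeGroup α) :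
    Finset (FreeGroup α) :=
  (wordSphere α m).filter fun c => M.CanRead q c ∧ g.norm + m ≤ (g * c).norm + 2 * l

theorem mem_extensions : c ∈ M.extensions l q g ↔
    c ∈ wordSphere α m ∧ M.CanRead q c ∧ g.norm + m ≤ (g * c).norm + 2 * l := by
  simp only [extensions, Finset.mem_filter]

theorem IsBranching.le_card_extensions_add (hM : M.IsBranching θ) (l : ℕ) (q : Fin B)
    (g : FreeGroup α) : θ ≤ (M.extensions l q g).card + (wordSphere α (m - l)).card := by
  classical
  refine (hM q).trans ((countIn_le_add
    (Q := fun c => M.CanRead q c ∧ g.norm + m ≤ (g * c).norm + 2 * l)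
    (R := fun c => (g * c).norm + 2 * l < g.norm + m) fun c _ hc => ?_).trans
      (add_le_add countIn_eq_card_filter.le ?_))
  · exact (le_or_gt _ _).imp_left fun h => ⟨hc, h⟩
  · rw [countIn_eq_card_filter]
    exact_mod_cast card_cancelling_le m l g

theorem IsBranching.card_mul_le_card_biUnion [Nonempty α] (hM : M.IsBranching θ) (hl : l ≤ m)
    (hβ : β * (wordSphere α l).card + (wordSphere α (m - l)).card ≤ θ)
    (G : Finset (FreeGroup α)) (q : FreeGroup α → Fin B) :
    G.card * β ≤ (G.biUnion fun g => (M.extensions l (q g) g).image (g * ·)).card := by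
  have hpairs :
      G.card * (β * (wordSphere α l).card) ≤ ∑ g ∈ G, ((M.extensions l (q g) g).card : ℝ) := by
    rw [← nsmul_eq_mul, ← Finset.sum_const]
    refine Finset.sum_le_sum fun g _ => ?_
    linarith [hM.le_card_extensions_add l (q g) g]
  have hfibres := sum_card_le_card_wordSphere_mul_card_biUnion hl G
    (fun g => M.extensions l (q g) g)
    fun g _ c hc => ⟨(mem_extensions.1 hc).1, (mem_extensions.1 hc).2.2⟩
  have hpos : (0 : ℝ) < (wordSphere α l).card := Nat.cast_pos.2 (card_wordSphere_pos l)
  refine le_of_mul_le_mul_left ?_ hpos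
  calc ((wordSphere α l).card : ℝ) * (G.card * β)
      = G.card * (β * (wordSphere α l).card) := by ring
    _ ≤ _ := hpairs.trans (by exact_mod_cast hfibres)

theorem IsBranching.exists_runs [Nonempty α] (hM : M.IsBranching θ) (hl : 2 * l < m)
    (hβ0 : 0 ≤ β) (hβ : β * (wordSphere α l).card + (wordSphere α (m - l)).card ≤ θ) (j : ℕ) :
    ∃ G : Finset (FreeGroup α), β ^ j ≤ G.card ∧ ∀ g ∈ G, (∃ q, M.Run j q g) ∧
      0 < g.norm ∧ g.norm ≤ (j + 1) * m ∧ Even (g.norm + (j + 1) * m) := by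
  induction j with
  | zero =>
    refine ⟨{↑M.initialWord}, by simp, fun g hg => ?_⟩
    obtain rfl := Finset.mem_singleton.1 hg
    rw [mem_wordSphere.1 M.initialWord.2, zero_add, one_mul]
    exact ⟨⟨_, .start⟩, by omega, le_rfl, ⟨m, rfl⟩⟩
  | succ j ih =>
    obtain ⟨G, hGcard, hG⟩ := ih
    have : Nonempty (Fin B) := ⟨M.initialState⟩
    choose! q hq using fun g hg => (hG g hg).1
    refine ⟨G.biUnion fun g => (M.extensions l (q g) g).image (g * ·), ?_, fun h hh => ?_⟩
    · rw [pow_succ]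
      exact (mul_le_mul_of_nonneg_right hGcard hβ0).trans
        (hM.card_mul_le_card_biUnion (by omega) hβ G q)
    · obtain ⟨g, hg, hh⟩ := Finset.mem_biUnion.1 hh
      obtain ⟨c, hc, rfl⟩ := Finset.mem_image.1 hh
      obtain ⟨hc, hread, hnorm⟩ := mem_extensions.1 hc
      obtain ⟨-, hpos, hle, heven⟩ := hG g hg
      have hmul := norm_mul_le g c
      have hparity := even_norm_mul_add_norm_add_norm g c
      rw [mem_wordSphere.1 hc] at hmul hparity
      rw [Nat.even_iff] at heven hparity ⊢
      rw [add_one_mul (j + 1) m]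
      exact ⟨(hq g hg).mul hread, by omega, by omega, by omega⟩

theorem IsBranching.pow_le_countIn_recognizes [Nontrivial α] (hM : M.IsBranching θ)
    (hl : 2 * l < m) (hβ0 : 0 ≤ β)
    (hβ : β * (wordSphere α l).card + (wordSphere α (m - l)).card ≤ θ) {L : ℕ}
    (hL : (j + 1) * m ≤ L) (heven : Even ((j + 1) * m + L)) :
    β ^ j ≤ (L + 1) * (2 * Fintype.card α) * countIn (wordSphere α L) M.Recognizes := by
  obtain ⟨G, hGcard, hG⟩ := hM.exists_runs hl hβ0 hβ j
  refine hGcard.trans (card_le_mul_countIn_wordSphere (fun g hg => ?_) fun g hg r hr => ?_)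
  · obtain ⟨-, hpos, hle, hparity⟩ := hG g hg
    refine ⟨hpos, hle.trans hL, ?_⟩
    rw [Nat.even_iff] at hparity heven ⊢
    omega
  · obtain ⟨⟨q, hq⟩, -⟩ := hG g hg
    exact ⟨j, q, g, hq, hr⟩

end WordAutomaton

end WordAutomaton

section UnionBound

variable {ι W A : Type*} [Finite W]

theorem natCard_subtype_add_natCard_subtype_not (P : W → Prop) :
    (Nat.card {w // P w} : ℝ) + Nat.card {w // ¬ P w} = Nat.card W := by
  classical
  rw [← Nat.card_congr (Equiv.sumCompl P), Nat.card_sum, Nat.cast_add]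

theorem natCard_pi_not_le [Finite ι] {S : W → Prop} {p : ℝ}
    (hp : p * Nat.card W ≤ Nat.card {w // S w}) :
    (Nat.card {R : ι → W // ∀ i, ¬ S (R i)} : ℝ) ≤
      Real.exp (-(p * Nat.card ι)) * Nat.card (ι → W) := by
  have hcompl : (Nat.card {w // ¬ S w} : ℝ) ≤ Real.exp (-p) * Nat.card W := by
    have := mul_le_mul_of_nonneg_right (Real.one_sub_le_exp_neg p) (Nat.cast_nonneg (Nat.card W))
    linarith [natCard_subtype_add_natCard_subtype_not S]
  rw [Nat.card_congr (Equiv.subtypePiEquivPi (p := fun (_ : ι) w => ¬ S w)), Nat.card_fun,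
    Nat.card_fun]
  push_cast
  calc (Nat.card {w // ¬ S w} : ℝ) ^ Nat.card ι
      ≤ (Real.exp (-p) * Nat.card W) ^ Nat.card ι := by gcongr
    _ = _ := by
      rw [mul_pow, ← Real.exp_nat_mul]
      ring_nf

theorem natCard_subtype_le_mul_of_forall_exists [Finite A] {P : W → Prop} {S : A → W → Prop}
    {C : ℝ} (hP : ∀ w, P w → ∃ a, S a w) (hS : ∀ a, (Nat.card {w // S a w} : ℝ) ≤ C) :
    (Nat.card {w // P w} : ℝ) ≤ Nat.card A * C := by
  have := Fintype.ofFinite A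
  choose f hf using fun w : {w // P w} => hP w w.2
  have hle : Nat.card {w // P w} ≤ Nat.card (Σ a, {w // S a w}) :=
    Nat.card_le_card_of_injective (fun w => ⟨f w, w.1, hf w⟩) fun w w' h =>
      Subtype.ext (congrArg (fun x : Σ a, {w // S a w} => x.2.1) h)
  rw [Nat.card_sigma] at hle
  calc (Nat.card {w // P w} : ℝ) ≤ ∑ a, (Nat.card {w // S a w} : ℝ) := by exact_mod_cast hle
    _ ≤ ∑ _ : A, C := Finset.sum_le_sum fun a _ => hS a
    _ = Nat.card A * C := by
      rw [Finset.sum_const, nsmul_eq_mul, Finset.card_univ, Nat.card_eq_fintype_card]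

theorem one_sub_card_mul_exp_le_card_div_card [Finite ι] [Nonempty W] [Finite A]
    {P : (ι → W) → Prop} {S : A → W → Prop} {p : ℝ}
    (hP : ∀ R, ¬ P R → ∃ a, ∀ i, ¬ S a (R i)) (hp : ∀ a, p * Nat.card W ≤ Nat.card {w // S a w}) :
    1 - Nat.card A * Real.exp (-(p * Nat.card ι)) ≤
      (Nat.card {R // P R} : ℝ) / Nat.card (ι → W) := by
  have hpos : (0 : ℝ) < Nat.card (ι → W) := Nat.cast_pos.2 Nat.card_pos
  have hbad := natCard_subtype_le_mul_of_forall_exists hP fun a => natCard_pi_not_le (ι := ι) (hp a)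
  rw [le_div_iff₀ hpos]
  linarith [natCard_subtype_add_natCard_subtype_not P]

end UnionBound

theorem exists_mul_le_and_even_add {m L : ℕ} (hm : Odd m) (hL : 2 * m ≤ L) :
    ∃ J, (J + 1) * m ≤ L ∧ L < (J + 3) * m ∧ Even ((J + 1) * m + L) := by
  have hdiv : L / m * m + L % m = L := Nat.div_add_mod' L m
  have hmod : L % m < m := Nat.mod_lt L hm.pos
  have hmod_nonneg := Nat.zero_le (L % m)
  obtain ⟨q, hq⟩ : ∃ q, L / m = q + 2 :=
    Nat.exists_eq_add_of_le' ((Nat.le_div_iff_mul_le hm.pos).2 hL)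
  rw [hq] at hdiv
  by_cases hparity : Even ((q + 1) * m + L)
  · exact ⟨q, by linarith, by linarith, hparity⟩
  · refine ⟨q + 1, by linarith, by linarith, ?_⟩
    rw [add_one_mul (q + 1), add_right_comm]
    exact (Nat.not_even_iff_odd.1 hparity).add_odd hm

theorem sq_add_four_le_mul_two_pow (j : ℕ) : (j + 4) ^ 2 ≤ 16 * 2 ^ j := by
  induction j with
  | zero => norm_num
  | succ j ih =>
    calc (j + 1 + 4) ^ 2 ≤ 2 * (j + 4) ^ 2 := by nlinarith [Nat.zero_le (j ^ 2 + 6 * j)]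
      _ ≤ 16 * 2 ^ (j + 1) := by omega

theorem three_le_two_mul_card_sub_one (α : Type*) [Fintype α] [Nontrivial α] :
    (3 : ℝ) ≤ 2 * Fintype.card α - 1 := by
  have : (2 : ℝ) ≤ Fintype.card α := by exact_mod_cast Fintype.one_lt_card (α := α)
  linarith

namespace WordAutomaton

variable {α : Type*} [DecidableEq α] [Fintype α] [Nontrivial α] {k B L J : ℕ} {D : ℝ}
  {M : WordAutomaton α (k + 2) B}

/-- Half of the branching pays for the words of which more than `17` letters cancel, since
`2 ^ 23 ≤ 3 ^ 15`. -/
theorem IsBranching.pow_div_pow_le_countIn_recognizes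
    (hM : M.IsBranching ((wordSphere α k).card / 2 ^ 22)) (hk : 33 ≤ k)
    (hL : (J + 1) * (k + 2) ≤ L) (heven : Even ((J + 1) * (k + 2) + L)) :
    ((2 * (Fintype.card α : ℝ) - 1) ^ (k - 17) / 2 ^ 23) ^ J ≤
      (L + 1) * (2 * Fintype.card α) * countIn (wordSphere α L) M.Recognizes := by
  have hb := three_le_two_mul_card_sub_one α
  have hb0 : 0 < 2 * (Fintype.card α : ℝ) - 1 := by linarith
  refine hM.pow_le_countIn_recognizes (l := 17) (by omega) (by positivity) ?_ hL heven
  obtain ⟨i, rfl⟩ := Nat.exists_eq_add_of_le' (by omega : 17 ≤ k)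
  rw [show i + 17 + 2 - 17 = i + 1 + 1 by omega, Nat.add_sub_cancel]
  simp only [cast_card_wordSphere_add_one]
  generalize 2 * (Fintype.card α : ℝ) - 1 = b at hb hb0 ⊢
  have hcancel : b ^ (i + 1) ≤ b ^ (i + 16) / 2 ^ 23 := by
    rw [le_div_iff₀ (by positivity)]
    have hconst : (2 : ℝ) ^ 23 ≤ b ^ 15 :=
      calc (2 : ℝ) ^ 23 ≤ 3 ^ 15 := by norm_num
        _ ≤ b ^ 15 := by gcongr
    calc b ^ (i + 1) * 2 ^ 23 ≤ b ^ (i + 1) * b ^ 15 := by gcongr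
      _ = b ^ (i + 16) := by ring
  calc b ^ i / 2 ^ 23 * (2 * Fintype.card α * b ^ 16) + 2 * Fintype.card α * b ^ (i + 1)
      = 2 * Fintype.card α * (b ^ (i + 16) / 2 ^ 23 + b ^ (i + 1)) := by ring
    _ ≤ 2 * Fintype.card α * (b ^ (i + 16) / 2 ^ 23 + b ^ (i + 16) / 2 ^ 23) := by gcongr
    _ = 2 * Fintype.card α * b ^ (i + 16) / 2 ^ 22 := by ring

theorem IsBranching.two_pow_mul_pow_le
    (hM : M.IsBranching ((wordSphere α k).card / 2 ^ 22)) (hk : 33 ≤ k)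
    (hL : (J + 1) * (k + 2) ≤ L) (heven : Even ((J + 1) * (k + 2) + L)) (hD1 : 1 ≤ D)
    (hD : 2 ^ 24 * (2 * (Fintype.card α : ℝ) - 1) ^ 19 ≤ D ^ (k + 2)) :
    2 ^ J * (2 * (Fintype.card α : ℝ) - 1) ^ (J * (k + 2)) ≤
      (L + 1) * (2 * Fintype.card α) * countIn (wordSphere α L) M.Recognizes * D ^ L := by
  have hruns := hM.pow_div_pow_le_countIn_recognizes hk hL heven
  have hb0 : 0 ≤ 2 * (Fintype.card α : ℝ) - 1 := by
    linarith [three_le_two_mul_card_sub_one α]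
  generalize 2 * (Fintype.card α : ℝ) - 1 = b at hb0 hD hruns ⊢
  have hDL : (2 ^ 24 * b ^ 19) ^ J ≤ D ^ L :=
    calc (2 ^ 24 * b ^ 19) ^ J ≤ (D ^ (k + 2)) ^ J := by gcongr
      _ = D ^ (J * (k + 2)) := by rw [← pow_mul, mul_comm]
      _ ≤ D ^ L := pow_le_pow_right₀ hD1 (by linarith)
  calc 2 ^ J * b ^ (J * (k + 2))
      = (b ^ (k - 17) / 2 ^ 23) ^ J * (2 ^ 24 * b ^ 19) ^ J := by
        rw [← mul_pow, mul_comm J, pow_mul, ← mul_pow,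
          show k + 2 = k - 17 + 19 by omega, pow_add b]
        ring
    _ ≤ _ := mul_le_mul hruns hDL (by positivity) ((by positivity : (0 : ℝ) ≤ _).trans hruns)

theorem IsBranching.mul_card_wordSphere_le
    (hM : M.IsBranching ((wordSphere α k).card / 2 ^ 22)) (hk : 33 ≤ k) (hodd : Odd k)
    (hL : 2 * (k + 2) ≤ L) (hD1 : 1 ≤ D)
    (hD : 2 ^ 24 * (2 * (Fintype.card α : ℝ) - 1) ^ 19 ≤ D ^ (k + 2)) :
    (L + 1) * (wordSphere α L).card ≤
      16 * (k + 2) ^ 2 * (2 * Fintype.card α) ^ 2 *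
        (2 * (Fintype.card α : ℝ) - 1) ^ (3 * (k + 2)) *
        (countIn (wordSphere α L) M.Recognizes * D ^ L) := by
  obtain ⟨J, hJle, hJlt, heven⟩ := exists_mul_le_and_even_add (hodd.add_even even_two) hL
  have hmain := hM.two_pow_mul_pow_le hk hJle heven hD1 hD
  have hb := three_le_two_mul_card_sub_one α
  have hwords : ((wordSphere α L).card : ℝ) ≤ 2 * Fintype.card α *
      (2 * (Fintype.card α : ℝ) - 1) ^ (J * (k + 2) + 3 * (k + 2)) := by
    obtain ⟨i, rfl⟩ := Nat.exists_eq_add_of_le' (by omega : 1 ≤ L)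
    rw [cast_card_wordSphere_add_one]
    gcongr
    · linarith
    · linarith
  have hL2 : ((L : ℝ) + 1) ^ 2 ≤ (k + 2) ^ 2 * (16 * 2 ^ J) := by
    have hlin : L + 1 ≤ (k + 2) * (J + 4) := by linarith
    have hquad : ((J : ℝ) + 4) ^ 2 ≤ 16 * 2 ^ J := by exact_mod_cast sq_add_four_le_mul_two_pow J
    calc ((L : ℝ) + 1) ^ 2 ≤ (((k : ℝ) + 2) * (J + 4)) ^ 2 := by
          gcongr
          exact_mod_cast hlin
      _ = ((k : ℝ) + 2) ^ 2 * ((J : ℝ) + 4) ^ 2 := mul_pow ..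
      _ ≤ _ := by gcongr
  have hb0 : 0 ≤ 2 * (Fintype.card α : ℝ) - 1 := by linarith
  generalize 2 * (Fintype.card α : ℝ) - 1 = b at hb0 hmain hwords ⊢
  have hpos : (0 : ℝ) < L + 1 := by positivity
  refine le_of_mul_le_mul_left ?_ hpos
  calc ((L : ℝ) + 1) * ((L + 1) * (wordSphere α L).card)
      = (L + 1) ^ 2 * (wordSphere α L).card := by ring
    _ ≤ (k + 2) ^ 2 * (16 * 2 ^ J) *
        (2 * Fintype.card α * b ^ (J * (k + 2) + 3 * (k + 2))) := by gcongr
    _ = 16 * (k + 2) ^ 2 * (2 * Fintype.card α) * b ^ (3 * (k + 2)) *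
        (2 ^ J * b ^ (J * (k + 2))) := by rw [pow_add]; ring
    _ ≤ 16 * (k + 2) ^ 2 * (2 * Fintype.card α) * b ^ (3 * (k + 2)) *
        ((L + 1) * (2 * Fintype.card α) * countIn (wordSphere α L) M.Recognizes * D ^ L) := by
      gcongr
    _ = _ := by ring

variable (α) in
/-- Recognized words are so numerous that one expects to see many of them among `D ^ L` random
words of length `L`. -/
theorem exists_mul_card_wordSphere_le (hD : 1 < D) :
    ∃ k, Odd k ∧ ∃ c : ℝ, 0 < c ∧ ∀ᶠ L : ℕ in atTop, ∀ (B : ℕ) (M : WordAutomaton α (k + 2) B),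
      M.IsBranching ((wordSphere α k).card / 2 ^ 22) →
      c * (L + 1) * (wordSphere α L).card ≤ countIn (wordSphere α L) M.Recognizes * D ^ L := by
  have hb0 : 0 < 2 * (Fintype.card α : ℝ) - 1 := by linarith [three_le_two_mul_card_sub_one α]
  have : (0 : ℝ) < Fintype.card α := Nat.cast_pos.2 Fintype.card_pos
  obtain ⟨i, hi⟩ := pow_unbounded_of_one_lt (2 ^ 24 * (2 * (Fintype.card α : ℝ) - 1) ^ 19) hD
  obtain ⟨k, hk⟩ : ∃ k, k = 2 * i + 33 := ⟨_, rfl⟩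
  have hDk : 2 ^ 24 * (2 * (Fintype.card α : ℝ) - 1) ^ 19 ≤ D ^ (k + 2) :=
    hi.le.trans (pow_le_pow_right₀ hD.le (by omega))
  refine ⟨k, ⟨i + 16, by omega⟩, (16 * (k + 2) ^ 2 * (2 * Fintype.card α) ^ 2 *
    (2 * (Fintype.card α : ℝ) - 1) ^ (3 * (k + 2)))⁻¹, by positivity, ?_⟩
  filter_upwards [eventually_ge_atTop (2 * (k + 2))] with L hL B M hM
  rw [mul_assoc, inv_mul_le_iff₀ (by positivity)]
  exact hM.mul_card_wordSphere_le (by omega) ⟨i + 16, by omega⟩ hL hD.le hDk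

end WordAutomaton

section FreeGroupAction

open FreeGroup hiding IsReduced norm

variable {α : Type*}

theorem exists_isReduced_append_pair [Nontrivial α] {w : List (α × Bool)}
    (hw : FreeGroup.IsReduced w) (a b : α × Bool) :
    ∃ z, FreeGroup.IsReduced (w ++ [z, a]) ∧ FreeGroup.IsReduced (w ++ [z, b]) := by
  classical
  obtain ⟨z, hz⟩ := exists_letter_notMem (s := {((w.getLastD a).1, !(w.getLastD a).2),
    (a.1, !a.2), (b.1, !b.2)}) Finset.card_le_three
  simp only [Finset.mem_insert, Finset.mem_singleton, not_or] at hz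
  have hred : ∀ x : α × Bool, z ≠ (x.1, !x.2) → FreeGroup.IsReduced (w ++ [z, x]) := by
    refine fun x hzx => List.isChain_append.2
      ⟨hw, isReduced_cons_cons_iff_ne.2 ⟨hzx, .singleton⟩, fun y hy z' hz' => ?_⟩
    obtain rfl : z = z' := by simpa using hz'
    refine letter_compatible_iff.2 fun hyz => hz.1 ?_
    rw [List.getLastD_eq_getLast?, Option.mem_def.1 hy, hyz]
    simp
  exact ⟨z, hred a hz.2.1, hred b hz.2.2⟩

variable {V : Type*} [MulAction (FreeGroup α) V] {v : V}

theorem mk_append_smul (w w' : List (α × Bool)) (v : V) :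
    FreeGroup.mk (w ++ w') • v = FreeGroup.mk w • FreeGroup.mk w' • v := by
  rw [smul_smul, mul_mk]

theorem mk_smul_of_forall_letter_smul_eq
    (h : ∀ a b : α × Bool, FreeGroup.mk [a] • v = FreeGroup.mk [b] • v) (a : α × Bool)
    (w : List (α × Bool)) : (Even w.length → FreeGroup.mk w • v = v) ∧
      (Odd w.length → FreeGroup.mk w • v = FreeGroup.mk [a] • v) := by
  induction w with
  | nil => exact ⟨fun _ => one_smul _ v, fun h => by simp at h⟩
  | cons b w ih =>
    rw [List.length_cons, ← List.singleton_append, mk_append_smul, Nat.even_add_one,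
      Nat.not_even_iff_odd, Nat.odd_add_one, Nat.not_odd_iff_even]
    refine ⟨fun hodd => ?_, fun heven => by rw [ih.1 heven, h b a]⟩
    have hinv : FreeGroup.mk [(b.1, !b.2)] = (FreeGroup.mk [b])⁻¹ := rfl
    rw [ih.2 hodd, h a (b.1, !b.2), hinv, smul_inv_smul]

variable [DecidableEq α]

theorem exists_smul_ne_of_letter_smul_ne [Nontrivial α] {a b : α × Bool}
    (hab : FreeGroup.mk [a] • v ≠ FreeGroup.mk [b] • v) (y : FreeGroup α) :
    ∃ c : FreeGroup α, c.norm = y.norm + 2 ∧ c • v ≠ v ∧ c.toWord.take y.norm = y.toWord := by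
  obtain ⟨z, hza, hzb⟩ := exists_isReduced_append_pair isReduced_toWord a b (w := y.toWord)
  have hword : ∀ {x}, FreeGroup.IsReduced (y.toWord ++ [z, x]) →
      (FreeGroup.mk (y.toWord ++ [z, x])).toWord = y.toWord ++ [z, x] := fun h => by
    rw [toWord_mk, h.reduce_eq]
  have hmove : ∀ {x}, FreeGroup.IsReduced (y.toWord ++ [z, x]) →
      FreeGroup.mk (y.toWord ++ [z, x]) • v ≠ v →
      ∃ c : FreeGroup α, c.norm = y.norm + 2 ∧ c • v ≠ v ∧ c.toWord.take y.norm = y.toWord :=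
    fun h hne => ⟨_, by simp only [FreeGroup.norm, hword h, List.length_append, List.length_cons,
      List.length_nil], hne, by rw [hword h, FreeGroup.norm, List.take_left]⟩
  by_cases hfix : FreeGroup.mk (y.toWord ++ [z, a]) • v = v
  · refine hmove hzb fun hfix' => hab ?_
    rw [List.append_cons, mk_append_smul] at hfix hfix'
    exact smul_left_cancel _ (hfix.trans hfix'.symm)
  · exact hmove hza hfix

variable [Fintype α]

theorem card_wordSphere_le_countIn_of_letter_smul_ne [Nontrivial α] {a b : α × Bool}
    (hab : FreeGroup.mk [a] • v ≠ FreeGroup.mk [b] • v) (k : ℕ) :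
    ((wordSphere α k).card : ℝ) ≤ countIn (wordSphere α (k + 2)) (fun c => c • v ≠ v) := by
  classical
  choose f hnorm hmove htake using exists_smul_ne_of_letter_smul_ne hab
  rw [countIn_eq_card_filter, Nat.cast_le]
  refine Finset.card_le_card_of_injOn f (fun y hy => ?_) (fun y hy y' hy' h => ?_)
  · rw [Finset.mem_coe, mem_wordSphere] at hy
    rw [Finset.mem_coe, Finset.mem_filter, mem_wordSphere, hnorm, hy]
    exact ⟨rfl, hmove y⟩
  · rw [Finset.mem_coe, mem_wordSphere] at hy hy'
    refine toWord_injective ?_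
    rw [← htake y, ← htake y', hy, hy', h]

/-- Either two letters move `v` to different vertices, or all words of odd length act on `v` in the
same way. -/
theorem card_wordSphere_le_countIn_smul_ne [Nontrivial α] (hv : ∃ g : FreeGroup α, g • v ≠ v)
    {k : ℕ} (hk : Odd k) :
    ((wordSphere α k).card : ℝ) ≤ countIn (wordSphere α (k + 2)) (fun c => c • v ≠ v) := by
  classical
  by_cases hab : ∃ a b : α × Bool, FreeGroup.mk [a] • v ≠ FreeGroup.mk [b] • v
  · obtain ⟨a, b, hab⟩ := hab
    exact card_wordSphere_le_countIn_of_letter_smul_ne hab k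
  · push Not at hab
    have a : α × Bool := (Classical.arbitrary α, true)
    have hact := mk_smul_of_forall_letter_smul_eq hab a
    have ha : FreeGroup.mk [a] • v ≠ v := by
      obtain ⟨g, hg⟩ := hv
      refine fun ha => hg ?_
      rw [← mk_toWord (x := g)]
      rcases Nat.even_or_odd g.toWord.length with h | h
      · exact (hact _).1 h
      · rw [(hact _).2 h, ha]
    obtain ⟨i, rfl⟩ := hk
    rw [countIn_eq_card_filter, Nat.cast_le, Finset.filter_true_of_mem fun c hc => ?_]
    · rw [card_wordSphere_add_one, show 2 * i + 1 + 2 = (2 * i + 2) + 1 by ring,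
        card_wordSphere_add_one]
      have hcard := Fintype.card_pos (α := α)
      exact Nat.mul_le_mul_left _ (Nat.pow_le_pow_right (by omega) (by omega))
    · have hnorm : c.toWord.length = 2 * i + 1 + 2 := mem_wordSphere.1 hc
      rw [← mk_toWord (x := c), (hact _).2 ⟨i + 1, by rw [hnorm]; ring⟩]
      exact ha

end FreeGroupAction

namespace SquareComplex

variable {α : Type*} [DecidableEq α] [Fintype α] {V : Type u} {X : SquareComplex V}

/-- The states are the halfspaces; reading `c` is allowed when `c⁻¹` carries the present halfspace
into the next one. A run with product `g` then keeps `g⁻¹ • v` away from `v`. -/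
theorem HasHalfspaceAutomaton.exists_wordAutomaton {v : V} [MulAction (FreeGroup α) V] {θ : ℝ}
    {m B : ℕ} (h : X.HasHalfspaceAutomaton v (wordSphere α m) θ B) :
    ∃ M : WordAutomaton α m B, M.IsBranching θ ∧ ∀ j q g, M.Run j q g → g • v ≠ v := by
  obtain ⟨S, hB, hS, a, ha, c, hc, hca⟩ := h
  obtain ⟨f, hf⟩ : ∃ f : Fin B → S, Function.Surjective f := by
    obtain ⟨i⟩ := Function.Embedding.nonempty_of_card_le (α := S) (β := Fin B) (by simpa using hB)
    have : Nonempty S := ⟨⟨a, ha⟩⟩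
    exact ⟨_, Function.invFun_surjective i.injective⟩
  obtain ⟨q, hq⟩ := hf ⟨a, ha⟩
  refine ⟨⟨fun q c q' => ∀ x, (c : FreeGroup α) • x ∈ X.half (f q) v → x ∈ X.half (f q') v,
    q, ⟨c, hc⟩⟩, fun q => ?_, fun j q g hrun hg => ?_⟩
  · refine (hS (f q) (f q).2).trans (countIn_mono fun c hc ⟨b, hb, hsub⟩ => ⟨hc, ?_⟩)
    obtain ⟨q', hq'⟩ := hf ⟨b, hb⟩
    exact ⟨q', by simpa only [hq'] using hsub⟩
  · have hmem : g⁻¹ • v ∈ X.half (f q) v := by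
      clear hg
      induction hrun with
      | start => simpa only [hq] using hca
      | step c _ hstep ih =>
        refine hstep _ ?_
        rwa [smul_smul, mul_inv_rev, mul_inv_cancel_left]
    rw [inv_smul_eq_iff.2 hg.symm] at hmem
    exact IsGradedCAT0.right_notMem_half hmem

theorem isGradedAction_subdivision {G : Type v} [Group G] (hX : X.IsCAT0) (φ : G →* X.aut) :
    letI : MulAction G X.Cube := MulAction.compHom _ φ
    X.subdivision.IsGradedAction (fun C => (Cube.dim C : ℤ)) G :=
  letI : MulAction G X.Cube := MulAction.compHom _ φ
  { cat0 := hX.subdivision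
    adj_smul := fun g _ _ h => subdivision_adj_smul (φ g) h
    square_smul := fun g _ _ _ _ h => subdivision_isSquare_smul (φ g) h
    ht_smul := fun g C => by exact_mod_cast dim_smul (φ g) C }

theorem exists_wordAutomaton [Nontrivial α] (hX : X.IsCAT0) (φ : FreeGroup α →* X.aut)
    (hφ : ∀ C : X.Cube, ∃ g, φ g • C ≠ C) {k : ℕ} (hk : Odd k) :
    ∃ M : WordAutomaton α (k + 2)
        (2 * (wordSphere α (k + 2)).card * ((wordSphere α (k + 2)).card + 1) ^ 3),
      M.IsBranching ((wordSphere α k).card / 2 ^ 22) ∧ ∀ j q g, M.Run j q g → φ g ≠ 1 := by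
  let _ : MulAction (FreeGroup α) X.Cube := MulAction.compHom _ φ
  have hA := isGradedAction_subdivision hX φ
  have := hA.cat0.connected.nonempty
  obtain ⟨v, hmin⟩ := X.subdivision.exists_isMinDisplacement (wordSphere α (k + 2))
  have hmoved := card_wordSphere_le_countIn_smul_ne (hφ v) hk
  have hpos : (0 : ℝ) < (wordSphere α k).card := Nat.cast_pos.2 (card_wordSphere_pos k)
  obtain ⟨M, hM, hrun⟩ := (hA.hasHalfspaceAutomaton (fun c => inv_mem_wordSphere) hmin
    (hpos.trans_le hmoved)).exists_wordAutomaton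
  refine ⟨M, fun q => le_trans ?_ (hM q), fun j q g hg hone => hrun j q g hg ?_⟩
  · gcongr
  · change φ g • v = v
    rw [hone, one_smul]

end SquareComplex

section RandomGroup

variable {n L : ℕ} {d : ℝ}

theorem natCard_reducedWord_subtype (P : FreeGroup (Fin n) → Prop) :
    (Nat.card {w : ReducedWord n L // P (FreeGroup.mk w.1.toList)} : ℝ) =
      countIn (wordSphere (Fin n) L) P := by
  classical
  rw [countIn_eq_card_filter, Nat.cast_inj, ← Nat.card_eq_finsetCard]
  refine Nat.card_congr (Equiv.ofBijective
    (fun w => ⟨FreeGroup.mk w.1.1.toList, Finset.mem_filter.2 ⟨mem_wordSphere.2 ?_, w.2⟩⟩)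
    ⟨fun w w' h => ?_, fun g => ?_⟩)
  · rw [FreeGroup.norm, FreeGroup.toWord_mk, w.1.2.reduce_eq, List.Vector.toList_length]
  · have hword := congrArg FreeGroup.toWord (Subtype.ext_iff.1 h)
    rw [FreeGroup.toWord_mk, FreeGroup.toWord_mk, w.1.2.reduce_eq, w'.1.2.reduce_eq] at hword
    exact Subtype.ext (Subtype.ext (List.Vector.toList_injective hword))
  · obtain ⟨hg, hP⟩ := Finset.mem_filter.1 g.2
    have hmk : FreeGroup.mk g.1.toWord = g := FreeGroup.mk_toWord
    exact ⟨⟨⟨⟨g.1.toWord, mem_wordSphere.1 hg⟩, FreeGroup.isReduced_toWord⟩, hmk.symm ▸ hP⟩,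
      Subtype.ext hmk⟩

theorem natCard_reducedWord : Nat.card (ReducedWord n L) = (wordSphere (Fin n) L).card := by
  classical
  have h := natCard_reducedWord_subtype (n := n) (L := L) fun _ => True
  rw [countIn_eq_card_filter, Finset.filter_true, Nat.cast_inj] at h
  rw [← h]
  exact (Nat.card_congr (Equiv.subtypeUnivEquiv fun _ => trivial)).symm

theorem exists_wordAutomaton_of_not_hasPropertyFC2 [Nontrivial (Fin n)] {R : Relators n d L}
    (hR : ¬ HasPropertyFC2.{u, 0} (relatorGroup R)) {k : ℕ} (hk : Odd k) :
    ∃ M : WordAutomaton (Fin n) (k + 2)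
        (2 * (wordSphere (Fin n) (k + 2)).card * ((wordSphere (Fin n) (k + 2)).card + 1) ^ 3),
      M.IsBranching ((wordSphere (Fin n) k).card / 2 ^ 22) ∧
        ∀ i, ¬ M.Recognizes (FreeGroup.mk (R i).1.toList) := by
  unfold HasPropertyFC2 at hR
  push Not at hR
  obtain ⟨V, X, hX, ρ, hρ⟩ := hR
  let π : FreeGroup (Fin n) →* relatorGroup R := PresentedGroup.mk _
  have hmoved : ∀ C : X.Cube, ∃ g, ρ.comp π g • C ≠ C := by
    intro C
    by_contra! hfix
    refine hρ (SquareComplex.hasGlobalFixedPoint_of_cube ρ C fun g => ?_)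
    obtain ⟨g, rfl⟩ := PresentedGroup.mk_surjective _ g
    exact hfix g
  obtain ⟨M, hM, hrun⟩ := SquareComplex.exists_wordAutomaton hX (ρ.comp π) hmoved hk
  refine ⟨M, hM, fun i ⟨j, q, g, hg, hconj⟩ => hrun j q g hg ?_⟩
  have hrel : π (FreeGroup.mk (R i).1.toList) = 1 := PresentedGroup.one_of_mem ⟨i, rfl⟩
  have hπ := π.map_isConj hconj
  rw [hrel, isConj_one_left] at hπ
  rw [MonoidHom.comp_apply, hπ, map_one]

theorem pow_le_two_mul_numRelators (hn : 1 ≤ n) (hd : 0 ≤ d) (L : ℕ) :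
    ((2 * (n : ℝ) - 1) ^ d) ^ L ≤ 2 * numRelators n d L := by
  have hn' : (1 : ℝ) ≤ n := by exact_mod_cast hn
  have hb : 1 ≤ 2 * (n : ℝ) - 1 := by linarith
  have hpow : 1 ≤ ((2 * (n : ℝ) - 1) ^ d) ^ L := one_le_pow₀ (Real.one_le_rpow hb hd)
  rw [numRelators, Real.rpow_mul_natCast (by linarith)]
  have hfloor := Nat.lt_floor_add_one (((2 * (n : ℝ) - 1) ^ d) ^ L)
  have hfloor_pos : (1 : ℝ) ≤ ⌊((2 * (n : ℝ) - 1) ^ d) ^ L⌋₊ := by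
    exact_mod_cast (Nat.one_le_floor_iff _).2 hpow
  linarith

theorem randomGroupProb_le_one (P : (G : Type) → [Group G] → Prop) :
    randomGroupProb n d P L ≤ 1 := by
  refine div_le_one_of_le₀ ?_ (Nat.cast_nonneg _)
  exact_mod_cast Nat.card_le_card_of_injective _ Subtype.val_injective

/-- The union bound over all automata that could certify an action without fixed point: each of them
recognizes none of the relators with exponentially small probability, and their number does not
depend on `L`. -/
theorem exists_one_sub_mul_exp_le_randomGroupProb (hd : 0 < d) (hn : 2 ≤ n) :
    ∃ N c : ℝ, 0 < c ∧ ∀ᶠ L : ℕ in atTop, 1 - N * Real.exp (-(c * (L + 1))) ≤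
      randomGroupProb n d (fun G [Group G] => HasPropertyFC2.{u, 0} G) L := by
  have : Nontrivial (Fin n) := Fin.nontrivial_iff_two_le.2 hn
  have hn' : (2 : ℝ) ≤ n := by exact_mod_cast hn
  obtain ⟨k, hk, c, hc, hrecognized⟩ := WordAutomaton.exists_mul_card_wordSphere_le (Fin n)
    (Real.one_lt_rpow (by linarith : 1 < 2 * (n : ℝ) - 1) hd)
  let A := {M : WordAutomaton (Fin n) (k + 2)
    (2 * (wordSphere (Fin n) (k + 2)).card * ((wordSphere (Fin n) (k + 2)).card + 1) ^ 3) //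
      M.IsBranching ((wordSphere (Fin n) k).card / 2 ^ 22)}
  refine ⟨Nat.card A, c / 2, half_pos hc, ?_⟩
  filter_upwards [hrecognized] with L hL
  have hrelators := pow_le_two_mul_numRelators (by omega : 1 ≤ n) hd.le L
  have hpos : (0 : ℝ) < numRelators n d L := by
    have : 0 < ((2 * (n : ℝ) - 1) ^ d) ^ L :=
      pow_pos (Real.rpow_pos_of_pos (by linarith) d) L
    linarith
  have : Nonempty (ReducedWord n L) :=
    (Nat.card_pos_iff.1 (natCard_reducedWord.symm ▸ card_wordSphere_pos L)).1
  have hunion := one_sub_card_mul_exp_le_card_div_card (A := A)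
    (P := fun R : Relators n d L => HasPropertyFC2.{u, 0} (relatorGroup R))
    (S := fun M w => M.1.Recognizes (FreeGroup.mk w.1.toList))
    (p := c / 2 * (L + 1) / numRelators n d L)
    (fun R hR => by
      obtain ⟨M, hM, hrel⟩ := exists_wordAutomaton_of_not_hasPropertyFC2 hR hk
      exact ⟨⟨M, hM⟩, hrel⟩)
    (fun M => by
      rw [natCard_reducedWord, natCard_reducedWord_subtype M.1.Recognizes, div_mul_eq_mul_div,
        div_le_iff₀ hpos]
      have hexpected := (hL _ M.1 M.2).trans
        (mul_le_mul_of_nonneg_left hrelators countIn_nonneg)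
      linarith)
  rwa [Nat.card_fin, div_mul_cancel₀ _ hpos.ne'] at hunion

theorem tendsto_one_sub_mul_exp_neg {c : ℝ} (hc : 0 < c) (N : ℝ) :
    Tendsto (fun L : ℕ => 1 - N * Real.exp (-(c * (L + 1)))) atTop (𝓝 1) := by
  have hlin : Tendsto (fun L : ℕ => c * ((L : ℝ) + 1)) atTop atTop :=
    (tendsto_atTop_add_const_right _ _ tendsto_natCast_atTop_atTop).const_mul_atTop hc
  simpa using ((Real.tendsto_exp_neg_atTop_nhds_zero.comp hlin).const_mul N).const_sub 1

end RandomGroup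

theorem mainTheorem3_general (d : ℝ) (hd : 0 < d) (n : ℕ) (hn : 2 ≤ n) :
    HoldsWithOverwhelmingProbability n d (fun G [Group G] => HasPropertyFC2.{u, 0} G) := by
  obtain ⟨N, c, hc, hlower⟩ := exists_one_sub_mul_exp_le_randomGroupProb.{u} hd hn
  exact tendsto_of_tendsto_of_tendsto_of_le_of_le' (tendsto_one_sub_mul_exp_neg hc N)
    tendsto_const_nhds hlower (Eventually.of_forall fun _ => randomGroupProb_le_one _)

theorem mainTheorem3 (d : ℝ) (hd0 : 0 < d) (hd1 : d < 1) (n : ℕ) (hn : 7 ≤ n)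
    (hnd : 24 ≤ (2 * (n : ℝ) - 1) ^ d) :
    HoldsWithOverwhelmingProbability n d (fun G [Group G] => HasPropertyFC2.{u, 0} G) :=
  mainTheorem3_general d hd0 n (by omega)
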